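/- **Setting.** Let $T\ge 1$, $\omega$ a primitive $T$-th root of unity, $\Pi=\langle \mathsf s,\mathsf t\mid \mathsf s^T=\mathsf t^2=(\mathsf s\mathsf t)^2=1\rangle$, acting on $\mathbb P^1$ by $\mathsf s:z\mapsto\omega z$, $\mathsf t:z\mapsto\bar z$. Let $\mathfrak g$ be a finite-dimensional complex Lie algebra with a linear automorphism $\sigma$, $\sigma^T=1$, an antilinear involutive automorphism $\tau$ preserving each eigenspace of $\sigma$, and a non-degenerate invariant symmetric bilinear form with $\langle\sigma x,\sigma y\rangle=\langle x,y\rangle$, $\langle\tau x,\tau y\rangle=\overline{\langle x,y\rangle}$. Let $I^a$ be a basis of $\mathfrak g$ with $\tau I^a=I^a$ and $I_a$ the dual basis. Let $\tilde{\mathfrak g}=\mathfrak g[t,t^{-1}]\oplus\mathbb C\mathsf K\oplus\mathbb C\mathsf D$ with $\mathsf K$ central, $[x_m,y_n]=[x,y]_{m+n}+m\delta_{m+n,0}\langle x,y\rangle\mathsf K$ and $[\mathsf D,x_n]=n x_n$ (where $x_n=x\otimes t^n$), let $\hat{\mathfrak g}=\mathfrak g[t,t^{-1}]\oplus\mathbb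 C\mathsf K$, and extend $\sigma,\tau$ by $\sigma x_n=(\sigma x)_n$, $\sigma\mathsf K=\mathsf K$, $\sigma\mathsf D=\mathsf D$, $\tau x_n=(\tau x)_{-n}$, $\tau\mathsf K=-\mathsf K$, $\tau\mathsf D=-\mathsf D$. Let $\boldsymbol z\subset\mathbb P^1$ be a finite set containing $\infty$, whose points have disjoint $\Pi$-orbits, with multiplicities $n_x\ge1$ ($x\in\boldsymbol z$; put $n_{\mu x}=n_x$ for $\mu\in\Pi$), and with $n_\infty\ge2$ or $|\boldsymbol z|\ge2$. A point is *complex* if its stabiliser $\Pi_x$ is trivial; $\boldsymbol z_c$ is the set of complex points of $\boldsymbol z$, and $\boldsymbol{\mathcal Z}=\boldsymbol z\cup\overline{\boldsymbol z_c}$, $\boldsymbol{\mathcal Z}'=\boldsymbol{\mathcal Z}\setminus\{0,\infty\}$. Let the levels $\ell^x_p\in\mathbb C$ ($x\in\boldsymbol{\mathcal Z}$, $0\le p<n_x$; only $p\ge1$ for $x=\infty$; $\ell^x_p=0$ for $p\ge n_x$) satisfy $\ell^0_p=\ell^\infty_p=0$ for $T\nmid p$, $\ell^x_{n_x-1}\ne0$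 (for $x=\infty$ only if $n_\infty\ge2$), $\overline{\ell^x_p}=\ell^{\bar x}_p$ for complex $x$, $\overline{\ell^x_p}=\omega^{-kp}\ell^x_p$ if $x\ne0,\infty$ and $\omega^k\bar x=x$, and $\ell^0_p,\ell^\infty_p\in\mathbb R$. *Observables.* Let $\tilde{\mathfrak g}^{\mathcal D}$ be the real Lie algebra $\bigoplus_{x\in\boldsymbol z}\big(\tilde{\mathfrak g}\otimes\mathbb C[\varepsilon_x]/\varepsilon_x^{n_x}\big)^{\Pi_x}$ (with $\varepsilon_\infty\mathbb C[\varepsilon_\infty]/\varepsilon_\infty^{n_\infty}$ at $\infty$), where $\mathsf s.\varepsilon_x^p=\omega^{-p}\varepsilon_x^p$ for $x\neq\infty$, $\mathsf s.\varepsilon_\infty^p=\omega^{p}\varepsilon_\infty^p$, and $\mathsf t$ acts by complex conjugation of coefficients; $\hat{\mathfrak g}^{\mathcal D}$ is defined in the same way from $\hat{\mathfrak g}$, and the subscript $\mathbb C$ denotes complexification. For $X\in\tilde{\mathfrak g}$ and $x\in\boldsymbol z$ let $P X\varepsilon_x^p=\frac1{2|\Pi_x\cap\langle\mathsf s\rangle|}\sum_{\alpha\in\Pi_x}\alpha(X\varepsilon_x^p)$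 and $X^{(x)}_p=1\otimes PX\varepsilon_x^p-i\otimes P(iX)\varepsilon_x^p\in\tilde{\mathfrak g}^{\mathcal D}_{\mathbb C}$, and, for $x\in\boldsymbol z_c$, $X^{(\bar x)}_p=1\otimes PX\varepsilon_x^p+i\otimes P(iX)\varepsilon_x^p$. Let $\epsilon_x=1$ for $x\in\boldsymbol z$ and $\epsilon_x=-1$ for $x\in\overline{\boldsymbol z_c}$. Let $S_\ell$ be the Poisson algebra $S(\hat{\mathfrak g}^{\mathcal D}_{\mathbb C})$ modulo the ideal generated by all $\mathsf K^{(x)}_p-i\epsilon_x\ell^x_p$ ($x\in\boldsymbol{\mathcal Z}$), and $\hat S_\ell=\varprojlim S_\ell/\mathsf F_n$, where $\mathsf F_n$ is the intersection of the ideal generated by the $X^{(x)}_p$ with $X\in\mathfrak g\otimes t^n\mathbb C[t]$ if $x\in\boldsymbol z$ and $X\in\mathfrak g\otimes t^{-n}\mathbb C[t^{-1}]$ if $x\in\overline{\boldsymbol z_c}$, with the ideal obtained by exchanging these two subspaces. The level-fixing map $\pi_\ell:\tilde{\mathfrak g}^{\mathcal D}_{\mathbb C}\to\hat S_\ell$ is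 the linear map that is the canonical map on $\hat{\mathfrak g}^{\mathcal D}_{\mathbb C}$ (so $\mathsf K^{(x)}_p\mapsto i\epsilon_x\ell^x_p$) and sends $\mathsf D^{(x)}_r$ to $\epsilon_x\frac i2\sum_{p,q}\sum_{n\in\mathbb Z}\kappa^x_{p+q-r}(I_{a,-n})^{(x)}_p(I^a_n)^{(x)}_q$, where $\kappa^x_m=\sum_c(-1)^{|c|}\prod_j\ell^x_{n_x-1-c_j}\big/(\ell^x_{n_x-1})^{|c|+1}$, summed over the compositions $c$ of $m-n_x+1$ (and $\kappa^x_m=0$ for $m<n_x-1$); at the points $0,\infty$ only those $\mathsf D^{(x)}_r$ with $T\mid r$ are present. *Lax matrices.* Let $\varrho$ be the representation of $\tilde{\mathfrak g}$ on $\mathfrak g$-valued connections on $S^1$: $x_n\mapsto x\otimes e_n$ with $e_n(\theta)=e^{in\theta}$, $\mathsf K\mapsto0$, $\mathsf D\mapsto-i\partial$. With dual bases $I^{\tilde a}=(I^a_n,\mathsf K,\mathsf D)$ and $I_{\tilde a}=(I_{a,-n},\mathsf D,\mathsf K)$ of $\tilde{\mathfrak g}$ put $\mathcal A^x_p=I_{\tilde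 a}\otimes (I^{\tilde a})^{(x)}_p$ for $x\in\boldsymbol z$ and $\mathcal A^x_p=\tau I_{\tilde a}\otimes (I^{\tilde a})^{(x)}_p$ for $x\in\overline{\boldsymbol z_c}$, and let $A^x_p=\sum_n (I_a\otimes e_{-n})\otimes (I^a_n)^{(x)}_p$, respectively $A^x_p=\sum_n (I_a\otimes e_{n})\otimes (I^a_n)^{(x)}_p$, be the classical fields with coefficients in $S_\ell$. For a family $F^x_p$ write $$\Lambda[F](z)=\frac1T\sum_{k=0}^{T-1}\sum_{x\in\boldsymbol{\mathcal Z}'}\sum_{p=0}^{n_x-1}\frac{\omega^{-k}\sigma^kF^x_p}{(\omega^{-k}z-x)^{p+1}}+\sum_{p}F^0_pz^{-p-1}-\sum_{q=0}^{n_\infty-2}F^\infty_{q+1}z^q$$ (the middle sum over $0\le p<n_0$, absent if $0\notin\boldsymbol z$; $\sigma$ acts on the factor $\mathfrak g$ or $\tilde{\mathfrak g}$, and trivially on numbers). Let $\mathcal L=\Lambda[\mathcal A]$ be the formal Lax matrix, $\varphi=\Lambda[\ell]$ the twist function and $\mathscr L(z)=\varphi(z)^{-1}\Lambda[A](z)$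 the Lax matrix. Let $C^{(j)}$ be the component of $C=I_a\otimes I^a$ whose second factor lies in the $\omega^j$-eigenspace of $\sigma$, and $$\mathcal R^0(z,z')=\frac{\sum_{k=0}^{T-1}z^kz'^{\,T-1-k}C^{(-k)}}{z'^{\,T}-z^T},\qquad \mathcal R(z,z')=\mathcal R^0(z,z')\,\varphi(z')^{-1}.$$ Let $\delta_{\theta\theta'}=\sum_n e_n\otimes e_{-n}$ and $\delta'_{\theta\theta'}=\sum_n in\,e_n\otimes e_{-n}$. **Theorem.** The twist function has only finitely many zeros in the complement of the finite points of $\Pi\boldsymbol z$. For every $z\in\mathbb C\setminus\Pi\boldsymbol z$ with $\varphi(z)\neq0$, $$(\varrho\otimes\pi_\ell)\,\mathcal L(z)=\varphi(z)\big(\partial+\mathscr L(z)\big).$$ For all such $z,z'$ with $z^T\ne z'^{\,T}$, as formal Fourier series in $\theta,\theta'$ with coefficients in $\mathfrak g\otimes\mathfrak g\otimes S_\ell$, $$\{\mathscr L_1(z),\mathscr L_2(z')\}=[\mathcal R_{12}(z,z'),\mathscr L_1(z)]\,\delta_{\theta\theta'}-[\mathcal R_{21}(z',z),\mathscr L_2(z')]\,\delta_{\theta\theta'}-\big(\mathcal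 R_{12}(z,z')+\mathcal R_{21}(z',z)\big)\delta'_{\theta\theta'},$$ and, equivalently, with $r_{12}(z,z')=\frac12(\mathcal R_{12}(z,z')-\mathcal R_{21}(z',z))$ and $s_{12}(z,z')=\frac12(\mathcal R_{12}(z,z')+\mathcal R_{21}(z',z))$, the non-ultralocal $r/s$ form $$\{\mathscr L_1(z),\mathscr L_2(z')\}=[r_{12}(z,z'),\mathscr L_1(z)+\mathscr L_2(z')]\,\delta_{\theta\theta'}+[s_{12}(z,z'),\mathscr L_1(z)-\mathscr L_2(z')]\,\delta_{\theta\theta'}-2s_{12}(z,z')\,\delta'_{\theta\theta'}.$$ -/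

import Mathlib

open scoped TensorProduct ComplexConjugate

noncomputable section

namespace AffineGaudin

/-- A finite-dimensional complex Lie algebra `g` with a linear automorphism `σ` with `σ ^ T = 1`, an
antilinear involutive automorphism `τ` preserving every eigenspace of `σ`, and a non-degenerate
invariant symmetric bilinear form that is compatible with both (the condition `form_τ` says that it
is the complexification of a real-valued form on the real form of `g` fixed by `τ`). -/
structure DihedralLie (T : ℕ) (g : Type*) [LieRing g] [LieAlgebra ℂ g] where
  /-- the primitive root of unity -/
  ω : ℂ
  ω_prim : IsPrimitiveRoot ω T
  /-- the linear automorphism -/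
  σ : Module.End ℂ g
  σ_lie : ∀ x y, σ ⁅x, y⁆ = ⁅σ x, σ y⁆
  σ_pow : σ ^ T = 1
  /-- the antilinear automorphism -/
  τ : g →ₛₗ[starRingEnd ℂ] g
  τ_lie : ∀ x y, τ ⁅x, y⁆ = ⁅τ x, τ y⁆
  τ_τ : ∀ x, τ (τ x) = x
  τ_eigen : ∀ (j : ℕ) (x : g), σ x = ω ^ j • x → σ (τ x) = ω ^ j • τ x
  /-- the bilinear form -/
  form : LinearMap.BilinForm ℂ g
  form_nondeg : form.Nondegenerate
  form_symm : ∀ x y, form x y = form y x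
  form_inv : ∀ x y z, form ⁅x, y⁆ z = form x ⁅y, z⁆
  form_τ : ∀ x y, form (τ x) (τ y) = conj (form x y)
  form_σ : ∀ x y, form (σ x) (σ y) = form x y

/-! ### The affine Kac-Moody algebra -/

/-- The underlying space of the untwisted affine Kac-Moody algebra: `(f, k, d)` stands for
`∑ n, f n ⊗ t ^ n + k K + d D`. -/
def Aff (g : Type*) [AddCommGroup g] : Type _ := (ℤ →₀ g) × ℂ × ℂ

namespace Aff

variable {g : Type*}

instance [AddCommGroup g] : AddCommGroup (Aff g) :=
  inferInstanceAs (AddCommGroup ((ℤ →₀ g) × ℂ × ℂ))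

instance [AddCommGroup g] [Module ℂ g] : Module ℂ (Aff g) :=
  inferInstanceAs (Module ℂ ((ℤ →₀ g) × ℂ × ℂ))

/-- The loop part. -/
def loopPart [AddCommGroup g] [Module ℂ g] : Aff g →ₗ[ℂ] (ℤ →₀ g) := LinearMap.fst ℂ _ _

/-- The coefficient of `K`. -/
def coefK [AddCommGroup g] [Module ℂ g] : Aff g →ₗ[ℂ] ℂ :=
  LinearMap.fst ℂ _ _ ∘ₗ LinearMap.snd ℂ (ℤ →₀ g) (ℂ × ℂ)

/-- The coefficient of `D`. -/
def coefD [AddCommGroup g] [Module ℂ g] : Aff g →ₗ[ℂ] ℂ :=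
  LinearMap.snd ℂ _ _ ∘ₗ LinearMap.snd ℂ (ℤ →₀ g) (ℂ × ℂ)

/-- The central element `K`. -/
def K [AddCommGroup g] : Aff g := (0, 1, 0)

/-- The derivation element `D`. -/
def D [AddCommGroup g] : Aff g := (0, 0, 1)

/-- The element `x_n = x ⊗ t ^ n`. -/
def loop [AddCommGroup g] (n : ℤ) (x : g) : Aff g := (Finsupp.single n x, 0, 0)

end Aff

variable {T : ℕ} {g : Type*} [LieRing g] [LieAlgebra ℂ g]

namespace DihedralLie

variable (𝔇 : DihedralLie T g)

lemma ω_ne_zero [NeZero T] : 𝔇.ω ≠ 0 := 𝔇.ω_prim.ne_zero (NeZero.ne T)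

lemma σ_pow_apply (x : g) : (𝔇.σ ^ T) x = x := by rw [𝔇.σ_pow]; rfl

/-- The generators of the dihedral group act by `σ` and `τ`. -/
lemma σ_τ_σ [NeZero T] (x : g) : 𝔇.σ (𝔇.τ (𝔇.σ x)) = 𝔇.τ x := by
  have hω := 𝔇.ω_ne_zero
  have hT : (T : ℂ) ≠ 0 := Nat.cast_ne_zero.2 (NeZero.ne T)
  have hnorm : 𝔇.ω * conj 𝔇.ω = 1 := by
    rw [Complex.mul_conj, Complex.normSq_eq_norm_sq, 𝔇.ω_prim.norm'_eq_one (NeZero.ne T)]; simp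
  set e : ℕ → g := fun j => ∑ k ∈ Finset.range T, ((𝔇.ω ^ (j * k))⁻¹) • (𝔇.σ ^ k) x with he
  have heig : ∀ j, 𝔇.σ (e j) = 𝔇.ω ^ j • e j := by
    intro j
    have h1 : 𝔇.σ (e j) = 𝔇.ω ^ j • ∑ k ∈ Finset.range T,
        ((𝔇.ω ^ (j * (k + 1)))⁻¹) • (𝔇.σ ^ (k + 1)) x := by
      rw [he, map_sum, Finset.smul_sum]
      refine Finset.sum_congr rfl fun k _ => ?_
      rw [map_smul, smul_smul, pow_succ', Module.End.mul_apply]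
      congr 1
      rw [mul_add, mul_one, pow_add]
      field_simp
    rw [h1, he]
    congr 1
    have h2 := Finset.sum_range_succ' (fun k => ((𝔇.ω ^ (j * k))⁻¹) • (𝔇.σ ^ k) x) T
    rw [Finset.sum_range_succ] at h2
    have h3 : ((𝔇.ω ^ (j * T))⁻¹) • (𝔇.σ ^ T) x = ((𝔇.ω ^ (j * 0))⁻¹) • (𝔇.σ ^ 0) x := by
      rw [mul_comm, pow_mul, 𝔇.ω_prim.pow_eq_one, 𝔇.σ_pow]; simp
    rw [h3] at h2
    exact (add_right_cancel h2).symm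
  have hsum : ∑ j ∈ Finset.range T, e j = (T : ℂ) • x := by
    rw [he, Finset.sum_comm]
    rw [Finset.sum_eq_single_of_mem 0 (Finset.mem_range.2 (Nat.pos_of_ne_zero (NeZero.ne T)))]
    · simp [← Nat.cast_smul_eq_nsmul ℂ]
    · intro k hk hk0
      rw [← Finset.sum_smul]
      have hy : ((𝔇.ω ^ k)⁻¹) ≠ 1 := by
        rw [Ne, inv_eq_one]
        exact 𝔇.ω_prim.pow_ne_one_of_pos_of_lt hk0 (Finset.mem_range.1 hk)
      have h4 : ∑ j ∈ Finset.range T, (𝔇.ω ^ (j * k))⁻¹ = 0 := by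
        have h5 := mul_geom_sum ((𝔇.ω ^ k)⁻¹) T
        have h6 : ((𝔇.ω ^ k)⁻¹) ^ T = 1 := by
          rw [inv_pow, ← pow_mul, mul_comm, pow_mul, 𝔇.ω_prim.pow_eq_one]; simp
        rw [h6, sub_self] at h5
        rw [← (mul_eq_zero.1 h5).resolve_left (sub_ne_zero.2 hy)]
        refine Finset.sum_congr rfl fun j _ => ?_
        rw [inv_pow, ← pow_mul, mul_comm]
      rw [h4, zero_smul]
  have hgood : ∀ j, 𝔇.σ (𝔇.τ (𝔇.σ (e j))) = 𝔇.τ (e j) := by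
    intro j
    rw [heig j, LinearMap.map_smulₛₗ, map_smul, 𝔇.τ_eigen j _ (heig j), smul_smul, map_pow,
      ← mul_pow, mul_comm, hnorm, one_pow, one_smul]
  have hx : x = ∑ j ∈ Finset.range T, (T : ℂ)⁻¹ • e j := by
    rw [← Finset.smul_sum, hsum, smul_smul, inv_mul_cancel₀ hT, one_smul]
  rw [hx]
  simp only [map_sum, LinearMap.map_smulₛₗ, map_smul, hgood]

/-- The bilinear map on Laurent polynomials given on homogeneous elements by `β`. -/
def pairSum {M : Type*} [AddCommGroup M] [Module ℂ M] (β : ℤ → ℤ → g →ₗ[ℂ] g →ₗ[ℂ] M) :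
    (ℤ →₀ g) →ₗ[ℂ] (ℤ →₀ g) →ₗ[ℂ] M :=
  LinearMap.mk₂ ℂ (fun f h => f.sum fun m x => h.sum fun n y => β m n x y)
    (fun f f' h => Finsupp.sum_add_index' (by simp) (by simp [Finsupp.sum_add]))
    (fun c f h => by
      rw [Finsupp.sum_smul_index' (by simp), Finsupp.smul_sum]
      simp [Finsupp.smul_sum])
    (fun f h h' => by
      rw [← Finsupp.sum_add]
      refine Finsupp.sum_congr fun m _ => ?_
      exact Finsupp.sum_add_index' (by simp) (by simp))
    (fun c f h => by
      rw [Finsupp.smul_sum]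
      refine Finsupp.sum_congr fun m _ => ?_
      rw [Finsupp.sum_smul_index' (by simp), Finsupp.smul_sum]
      simp)

lemma pairSum_single {M : Type*} [AddCommGroup M] [Module ℂ M]
    (β : ℤ → ℤ → g →ₗ[ℂ] g →ₗ[ℂ] M) (m n : ℤ) (x y : g) :
    pairSum β (Finsupp.single m x) (Finsupp.single n y) = β m n x y := by
  simp [pairSum]

/-- The derivation `x_n ↦ n x_n` of the loop algebra. -/
def degree : (ℤ →₀ g) →ₗ[ℂ] (ℤ →₀ g) :=
  Finsupp.lsum ℂ fun n : ℤ => (n : ℂ) • Finsupp.lsingle n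

lemma degree_single (n : ℤ) (x : g) :
    degree (Finsupp.single n x) = Finsupp.single n ((n : ℂ) • x) := by
  simp [degree]

/-- The bracket of the loop algebra: `[x_m, y_n] = [x, y]_{m+n}`. -/
def loopBracket : (ℤ →₀ g) →ₗ[ℂ] (ℤ →₀ g) →ₗ[ℂ] (ℤ →₀ g) :=
  pairSum fun m n => (LieModule.toEnd ℂ g g : g →ₗ[ℂ] Module.End ℂ g).compr₂
    (Finsupp.lsingle (m + n))

/-- The cocycle of the loop algebra: `(x_m, y_n) ↦ m δ_{m+n,0} ⟨x, y⟩`. -/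
def cocycle : (ℤ →₀ g) →ₗ[ℂ] (ℤ →₀ g) →ₗ[ℂ] ℂ :=
  pairSum fun m n => (if m + n = 0 then (m : ℂ) else 0) • 𝔇.form

/-- The bracket of the affine Kac-Moody algebra:
`[x_m + α K + a D, y_n + β K + b D] = [x, y]_{m+n} + n a y_n - m b x_m + m δ_{m+n,0} ⟨x, y⟩ K`. -/
def affBracket : Aff g →ₗ[ℂ] Aff g →ₗ[ℂ] Aff g :=
  LinearMap.mk₂ ℂ
    (fun X Y =>
      ((loopBracket X.loopPart Y.loopPart + X.coefD • degree Y.loopPart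
          - Y.coefD • degree X.loopPart,
        𝔇.cocycle X.loopPart Y.loopPart, 0) : (ℤ →₀ g) × ℂ × ℂ))
    (fun X X' Y => by
      refine Prod.ext ?_ (Prod.ext ?_ ?_)
      · change _ = (_ : ℤ →₀ g) + _
        simp only [map_add, LinearMap.add_apply, add_smul, smul_add]; abel
      · change _ = (_ : ℂ) + _
        simp only [map_add, LinearMap.add_apply]
      · change _ = (_ : ℂ) + _
        simp)
    (fun c X Y => by
      refine Prod.ext ?_ (Prod.ext ?_ ?_)
      · change _ = c • (_ : ℤ →₀ g)
        simp only [map_smul, LinearMap.smul_apply, smul_add, smul_sub, smul_smul, smul_eq_mul,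
          mul_comm]
      · change _ = c • (_ : ℂ)
        simp only [map_smul, LinearMap.smul_apply]
      · change _ = c • (_ : ℂ)
        simp)
    (fun X Y Y' => by
      refine Prod.ext ?_ (Prod.ext ?_ ?_)
      · change _ = (_ : ℤ →₀ g) + _
        simp only [map_add, add_smul, smul_add]; abel
      · change _ = (_ : ℂ) + _
        simp only [map_add]
      · change _ = (_ : ℂ) + _
        simp)
    (fun c X Y => by
      refine Prod.ext ?_ (Prod.ext ?_ ?_)
      · change _ = c • (_ : ℤ →₀ g)
        simp only [map_smul, smul_add, smul_sub, smul_smul, smul_eq_mul, mul_comm]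
      · change _ = c • (_ : ℂ)
        simp only [map_smul]
      · change _ = c • (_ : ℂ)
        simp)

/-- The automorphism `σ` of the affine algebra: `x_n ↦ (σ x)_n`, `K ↦ K`, `D ↦ D`. -/
def affσ : Module.End ℂ (Aff g) where
  toFun X := ((Finsupp.mapRange.linearMap 𝔇.σ X.loopPart, X.coefK, X.coefD) : (ℤ →₀ g) × ℂ × ℂ)
  map_add' X Y := by simp only [map_add]; rfl
  map_smul' c X := by simp only [map_smul]; rfl

/-- The reindexing `x_n ↦ (τ x)_{-n}` of Laurent polynomials. -/
def loopτ : (ℤ →₀ g) →ₛₗ[starRingEnd ℂ] (ℤ →₀ g) where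
  toFun f := Finsupp.equivMapDomain (Equiv.neg ℤ) (f.mapRange 𝔇.τ (map_zero _))
  map_add' f h := by ext n; simp
  map_smul' c f := by ext n; simp

/-- The antilinear automorphism `τ` of the affine algebra: `x_n ↦ (τ x)_{-n}`, `K ↦ -K`,
`D ↦ -D`. -/
def affτ : Aff g →ₛₗ[starRingEnd ℂ] Aff g where
  toFun X := ((𝔇.loopτ X.loopPart, -conj X.coefK, -conj X.coefD) : (ℤ →₀ g) × ℂ × ℂ)
  map_add' X Y := by simp only [map_add, neg_add]; rfl
  map_smul' c X := by
    simp only [map_smul, LinearMap.map_smulₛₗ, smul_eq_mul, map_mul, ← mul_neg]; rfl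

lemma affσ_pow_T : 𝔇.affσ ^ T = 1 := by
  have h : ∀ (n : ℕ) (X : Aff g), (𝔇.affσ ^ n) X =
      ((Finsupp.mapRange.linearMap (𝔇.σ ^ n) X.loopPart, X.coefK, X.coefD) :
        (ℤ →₀ g) × ℂ × ℂ) := by
    intro n
    induction n with
    | zero =>
      intro X
      refine Prod.ext ?_ rfl
      change X.loopPart = Finsupp.mapRange.linearMap (1 : Module.End ℂ g) X.loopPart
      ext m
      simp
    | succ n ih =>
      intro X
      rw [pow_succ', Module.End.mul_apply, ih, pow_succ']
      refine Prod.ext ?_ rfl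
      change Finsupp.mapRange.linearMap 𝔇.σ (Finsupp.mapRange.linearMap (𝔇.σ ^ n) X.loopPart) = _
      ext m
      simp
  ext1 X
  rw [h, 𝔇.σ_pow]
  refine Prod.ext ?_ rfl
  change Finsupp.mapRange.linearMap (1 : Module.End ℂ g) X.loopPart = X.loopPart
  ext m
  simp

lemma affτ_affτ (X : Aff g) : 𝔇.affτ (𝔇.affτ X) = X := by
  refine Prod.ext ?_ (Prod.ext ?_ ?_)
  · change 𝔇.loopτ (𝔇.loopτ X.loopPart) = X.loopPart
    ext n
    simp [loopτ, 𝔇.τ_τ]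
  · change -conj (-conj X.coefK) = X.coefK
    simp
  · change -conj (-conj X.coefD) = X.coefD
    simp

lemma affσ_affτ_affσ [NeZero T] (X : Aff g) : 𝔇.affσ (𝔇.affτ (𝔇.affσ X)) = 𝔇.affτ X := by
  refine Prod.ext ?_ rfl
  change Finsupp.mapRange.linearMap 𝔇.σ (𝔇.loopτ (Finsupp.mapRange.linearMap 𝔇.σ X.loopPart))
    = 𝔇.loopτ X.loopPart
  ext n
  simp [loopτ, 𝔇.σ_τ_σ]

lemma affσ_affBracket (X Y : Aff g) :
    𝔇.affσ (𝔇.affBracket X Y) = 𝔇.affBracket (𝔇.affσ X) (𝔇.affσ Y) := by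
  have hd : ∀ f : ℤ →₀ g, Finsupp.mapRange.linearMap 𝔇.σ (degree f)
      = degree (Finsupp.mapRange.linearMap 𝔇.σ f) := by
    intro f
    induction f using Finsupp.induction_linear with
    | zero => simp
    | add f h hf hh => simp only [map_add, hf, hh]
    | single n x => simp [degree]
  refine Prod.ext ?_ (Prod.ext ?_ rfl)
  · change Finsupp.mapRange.linearMap 𝔇.σ (loopBracket X.loopPart Y.loopPart
        + X.coefD • degree Y.loopPart - Y.coefD • degree X.loopPart)
      = loopBracket (Finsupp.mapRange.linearMap 𝔇.σ X.loopPart)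
          (Finsupp.mapRange.linearMap 𝔇.σ Y.loopPart)
        + X.coefD • degree (Finsupp.mapRange.linearMap 𝔇.σ Y.loopPart)
        - Y.coefD • degree (Finsupp.mapRange.linearMap 𝔇.σ X.loopPart)
    rw [map_sub, map_add, map_smul, map_smul, hd, hd]
    congr 2
    generalize Aff.loopPart X = f
    generalize Aff.loopPart Y = h
    induction f using Finsupp.induction_linear with
    | zero => simp
    | add f f' hf hf' => simp only [map_add, LinearMap.add_apply, hf, hf']
    | single m x =>
      induction h using Finsupp.induction_linear with
      | zero => simp
      | add f f' hf hf' => simp only [map_add, hf, hf']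
      | single n y => simp [loopBracket, pairSum_single, 𝔇.σ_lie]
  · change 𝔇.cocycle X.loopPart Y.loopPart
      = 𝔇.cocycle (Finsupp.mapRange.linearMap 𝔇.σ X.loopPart)
          (Finsupp.mapRange.linearMap 𝔇.σ Y.loopPart)
    generalize Aff.loopPart X = f
    generalize Aff.loopPart Y = h
    induction f using Finsupp.induction_linear with
    | zero => simp
    | add f f' hf hf' => simp only [map_add, LinearMap.add_apply, hf, hf']
    | single m x =>
      induction h using Finsupp.induction_linear with
      | zero => simp
      | add f f' hf hf' => simp only [map_add, hf, hf']
      | single n y =>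
        simp only [cocycle, pairSum_single, Finsupp.mapRange.linearMap_apply,
          Finsupp.mapRange_single, LinearMap.smul_apply, 𝔇.form_σ]

lemma loopτ_single (n : ℤ) (x : g) :
    𝔇.loopτ (Finsupp.single n x) = Finsupp.single (-n) (𝔇.τ x) := by
  simp [loopτ, Finsupp.equivMapDomain_single]

lemma affτ_affBracket (X Y : Aff g) :
    𝔇.affτ (𝔇.affBracket X Y) = 𝔇.affBracket (𝔇.affτ X) (𝔇.affτ Y) := by
  have hd : ∀ f : ℤ →₀ g, 𝔇.loopτ (degree f) = -degree (𝔇.loopτ f) := by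
    intro f
    induction f using Finsupp.induction_linear with
    | zero => simp
    | add f h hf hh => simp only [map_add, hf, hh, neg_add]
    | single n x => simp [degree, loopτ_single, LinearMap.map_smulₛₗ]
  refine Prod.ext ?_ (Prod.ext ?_ ?_)
  · change 𝔇.loopτ (loopBracket X.loopPart Y.loopPart
        + X.coefD • degree Y.loopPart - Y.coefD • degree X.loopPart)
      = loopBracket (𝔇.loopτ X.loopPart) (𝔇.loopτ Y.loopPart)
        + (-conj X.coefD) • degree (𝔇.loopτ Y.loopPart)
        - (-conj Y.coefD) • degree (𝔇.loopτ X.loopPart)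
    rw [map_sub, map_add, LinearMap.map_smulₛₗ, LinearMap.map_smulₛₗ, hd, hd, smul_neg, smul_neg,
      neg_smul, neg_smul]
    congr 2
    generalize Aff.loopPart X = f
    generalize Aff.loopPart Y = h
    induction f using Finsupp.induction_linear with
    | zero => simp
    | add f f' hf hf' => simp only [map_add, LinearMap.add_apply, hf, hf']
    | single m x =>
      induction h using Finsupp.induction_linear with
      | zero => simp
      | add f f' hf hf' => simp only [map_add, hf, hf']
      | single n y =>
        simp [loopBracket, pairSum_single, loopτ_single, 𝔇.τ_lie, add_comm]
  · change -conj (𝔇.cocycle X.loopPart Y.loopPart)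
      = 𝔇.cocycle (𝔇.loopτ X.loopPart) (𝔇.loopτ Y.loopPart)
    generalize Aff.loopPart X = f
    generalize Aff.loopPart Y = h
    induction f using Finsupp.induction_linear with
    | zero => simp
    | add f f' hf hf' => simp only [map_add, LinearMap.add_apply, neg_add, hf, hf']
    | single m x =>
      induction h using Finsupp.induction_linear with
      | zero => simp
      | add f f' hf hf' => simp only [map_add, neg_add, hf, hf']
      | single n y =>
        have : -m + -n = 0 ↔ m + n = 0 := by omega
        simp only [cocycle, pairSum_single, loopτ_single, this, LinearMap.smul_apply, 𝔇.form_τ]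
        split_ifs <;> simp
  · change -conj (0 : ℂ) = 0
    simp

end DihedralLie

/-! ### The action of the dihedral group -/

section Dihedral

set_option linter.unusedSectionVars false

open scoped Classical

/-- The action on the Riemann sphere: `r k` (that is `s ^ k`) acts by `z ↦ ω ^ k z` and `sr k`
(that is `t s ^ k`) acts by `z ↦ conj (ω ^ k z)`. -/
def mobius (ω : ℂ) : DihedralGroup T → OnePoint ℂ → OnePoint ℂ
  | .r k => OnePoint.map fun z => ω ^ k.val * z
  | .sr k => OnePoint.map fun z => conj (ω ^ k.val * z)

variable [NeZero T]

lemma pow_val_add {M : Type*} [Monoid M] {a : M} (ha : a ^ T = 1) (i j : ZMod T) :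
    a ^ (i + j).val = a ^ i.val * a ^ j.val := by
  rw [← pow_add, ZMod.val_add, ← pow_mod_orderOf, Nat.mod_mod_of_dvd _ (orderOf_dvd_of_pow_eq_one ha),
    pow_mod_orderOf]

lemma pow_val_neg {a : ℂ} (ha : a ^ T = 1) (i : ZMod T) :
    a ^ (-i).val = conj (a ^ i.val) := by
  have h0 : a ≠ 0 := by
    rintro rfl
    rw [zero_pow (NeZero.ne T)] at ha
    exact zero_ne_one ha
  have hn : ‖a‖ = 1 := Complex.norm_eq_one_of_pow_eq_one ha (NeZero.ne T)
  have h1 : a ^ (-i).val * a ^ i.val = 1 := by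
    rw [← pow_val_add ha]; simp
  have h2 : a ^ i.val * conj (a ^ i.val) = 1 := by
    rw [Complex.mul_conj, Complex.normSq_eq_norm_sq, norm_pow, hn]; simp
  calc a ^ (-i).val = a ^ (-i).val * (a ^ i.val * conj (a ^ i.val)) := by rw [h2, mul_one]
    _ = conj (a ^ i.val) := by rw [← mul_assoc, h1, one_mul]

lemma mobius_mul {ω : ℂ} (hω : ω ^ T = 1) (α β : DihedralGroup T) (x : OnePoint ℂ) :
    mobius ω (α * β) x = mobius ω α (mobius ω β x) := by
  induction x using OnePoint.rec with
  | infty => rcases α with i | i <;> rcases β with j | j <;> rfl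
  | coe z =>
    rcases α with i | i <;> rcases β with j | j
    · simp [mobius, DihedralGroup.r_mul_r, pow_val_add hω, mul_assoc]
    · simp only [DihedralGroup.r_mul_sr, mobius, OnePoint.map_some, sub_eq_add_neg,
        pow_val_add hω, pow_val_neg hω, map_mul, Complex.conj_conj]
      congr 1; ring
    · simp [mobius, DihedralGroup.sr_mul_r, pow_val_add hω, mul_assoc]
    · simp only [DihedralGroup.sr_mul_sr, mobius, OnePoint.map_some, sub_eq_add_neg,
        pow_val_add hω, pow_val_neg hω, map_mul, Complex.conj_conj]
      congr 1; ring

lemma mobius_one {ω : ℂ} (x : OnePoint ℂ) : mobius ω (1 : DihedralGroup T) x = x := by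
  change mobius ω (DihedralGroup.r 0) x = x
  induction x using OnePoint.rec with
  | infty => rfl
  | coe z => simp [mobius]

lemma mobius_mul_fixed_iff {ω : ℂ} (hω : ω ^ T = 1) {α : DihedralGroup T} {x : OnePoint ℂ}
    (h : mobius ω α x = x) (β : DihedralGroup T) :
    mobius ω (α * β) x = x ↔ mobius ω β x = x := by
  constructor
  · intro h'
    have h1 : mobius ω α⁻¹ x = x := by
      conv_lhs => rw [← h]
      rw [← mobius_mul hω, inv_mul_cancel, mobius_one]
    have h2 : β = α⁻¹ * (α * β) := by group
    rw [h2, mobius_mul hω, h', h1]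
  · intro h'
    rw [mobius_mul hω, h', h]

namespace DihedralLie

variable (𝔇 : DihedralLie T g)

/-- The scalar by which `s ^ k` acts on the `p`-th power of the local coordinate: `ω ^ (-k p)` at a
finite point and `ω ^ (k p)` at infinity. -/
def phase (x : OnePoint ℂ) (p : ℕ) (k : ZMod T) : ℂ :=
  if x = OnePoint.infty then 𝔇.ω ^ (k.val * p) else (𝔇.ω ^ (k.val * p))⁻¹

/-- The action of the dihedral group on `X ⊗ ε_x ^ p`; see `mobius` for the notation. -/
def slotAct (x : OnePoint ℂ) (p : ℕ) : DihedralGroup T → Aff g → Aff g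
  | .r k => fun X => 𝔇.phase x p k • (𝔇.affσ ^ k.val) X
  | .sr k => fun X => 𝔇.affτ (𝔇.phase x p k • (𝔇.affσ ^ k.val) X)

lemma phase_eq (x : OnePoint ℂ) (p : ℕ) (k : ZMod T) :
    𝔇.phase x p k = (if x = OnePoint.infty then 𝔇.ω ^ p else (𝔇.ω ^ p)⁻¹) ^ k.val := by
  unfold phase
  split_ifs
  · rw [← pow_mul, mul_comm]
  · rw [inv_pow, ← pow_mul, mul_comm]

lemma phase_pow_one (x : OnePoint ℂ) (p : ℕ) :
    (if x = OnePoint.infty then 𝔇.ω ^ p else (𝔇.ω ^ p)⁻¹) ^ T = 1 := by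
  have h := 𝔇.ω_prim.pow_eq_one
  split_ifs
  · rw [← pow_mul, mul_comm, pow_mul, h, one_pow]
  · rw [inv_pow, ← pow_mul, mul_comm, pow_mul, h, one_pow, inv_one]

lemma phase_add (x : OnePoint ℂ) (p : ℕ) (i j : ZMod T) :
    𝔇.phase x p (i + j) = 𝔇.phase x p i * 𝔇.phase x p j := by
  simp only [phase_eq]
  exact pow_val_add (𝔇.phase_pow_one x p) i j

lemma phase_neg (x : OnePoint ℂ) (p : ℕ) (i : ZMod T) :
    𝔇.phase x p (-i) = conj (𝔇.phase x p i) := by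
  simp only [phase_eq]
  exact pow_val_neg (𝔇.phase_pow_one x p) i

lemma phase_mul (x : OnePoint ℂ) (p q : ℕ) (k : ZMod T) :
    𝔇.phase x (p + q) k = 𝔇.phase x p k * 𝔇.phase x q k := by
  unfold phase
  split_ifs
  · rw [mul_add, pow_add]
  · rw [mul_add, pow_add, mul_inv]

lemma affσ_pow_affτ (n : ℕ) (X : Aff g) :
    (𝔇.affσ ^ n) (𝔇.affτ ((𝔇.affσ ^ n) X)) = 𝔇.affτ X := by
  induction n generalizing X with
  | zero => simp
  | succ n ih =>
    have h1 : (𝔇.affσ ^ (n + 1)) X = 𝔇.affσ ((𝔇.affσ ^ n) X) := by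
      rw [pow_succ', Module.End.mul_apply]
    rw [h1, pow_succ, Module.End.mul_apply, affσ_affτ_affσ, ih]

lemma affσ_affτ_comm (i j : ZMod T) (X : Aff g) :
    (𝔇.affσ ^ i.val) (𝔇.affτ ((𝔇.affσ ^ j.val) X)) = 𝔇.affτ ((𝔇.affσ ^ (j - i).val) X) := by
  have h : j = i + (j - i) := by ring
  conv_lhs => rw [h, pow_val_add 𝔇.affσ_pow_T, Module.End.mul_apply, affσ_pow_affτ]

lemma slotAct_mul (x : OnePoint ℂ) (p : ℕ) (α β : DihedralGroup T) (X : Aff g) :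
    𝔇.slotAct x p (α * β) X = 𝔇.slotAct x p α (𝔇.slotAct x p β X) := by
  rcases α with i | i <;> rcases β with j | j
  · simp only [DihedralGroup.r_mul_r, slotAct, map_smul, smul_smul, phase_add,
      pow_val_add 𝔇.affσ_pow_T, Module.End.mul_apply]
  · simp only [DihedralGroup.r_mul_sr, slotAct, map_smul, LinearMap.map_smulₛₗ, smul_smul,
      affσ_affτ_comm, sub_eq_add_neg, phase_add, phase_neg, map_mul, Complex.conj_conj]
    rw [mul_comm]
  · simp only [DihedralGroup.sr_mul_r, slotAct, map_smul, smul_smul, phase_add,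
      pow_val_add 𝔇.affσ_pow_T, Module.End.mul_apply]
  · simp only [DihedralGroup.sr_mul_sr, slotAct, map_smul, LinearMap.map_smulₛₗ, smul_smul,
      affσ_affτ_comm, affτ_affτ, sub_eq_add_neg, phase_add, phase_neg, map_mul,
      Complex.conj_conj]
    rw [mul_comm]

lemma slotAct_add (x : OnePoint ℂ) (p : ℕ) (α : DihedralGroup T) (X Y : Aff g) :
    𝔇.slotAct x p α (X + Y) = 𝔇.slotAct x p α X + 𝔇.slotAct x p α Y := by
  rcases α with i | i <;> simp [slotAct]

lemma slotAct_smul (x : OnePoint ℂ) (p : ℕ) (α : DihedralGroup T) (c : ℝ) (X : Aff g) :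
    𝔇.slotAct x p α (c • X) = c • 𝔇.slotAct x p α X := by
  have h : ∀ Y : Aff g, c • Y = (c : ℂ) • Y := fun Y => (Complex.coe_smul c Y).symm
  rcases α with i | i
  · simp only [slotAct, h, map_smul]
    exact smul_comm _ _ _
  · simp only [slotAct, h, map_smul]
    rw [smul_comm (𝔇.phase x p i) (c : ℂ), LinearMap.map_smulₛₗ]
    simp

/-- The action of one group element on `X ⊗ ε_x ^ p` as a real-linear map. -/
def slotActₗ (x : OnePoint ℂ) (p : ℕ) (α : DihedralGroup T) : Aff g →ₗ[ℝ] Aff g where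
  toFun := 𝔇.slotAct x p α
  map_add' := 𝔇.slotAct_add x p α
  map_smul' := 𝔇.slotAct_smul x p α

lemma slotAct_affBracket (x : OnePoint ℂ) (p q : ℕ) (α : DihedralGroup T) (X Y : Aff g) :
    𝔇.slotAct x (p + q) α (𝔇.affBracket X Y)
      = 𝔇.affBracket (𝔇.slotAct x p α X) (𝔇.slotAct x q α Y) := by
  have hp : ∀ (n : ℕ) (X Y : Aff g), (𝔇.affσ ^ n) (𝔇.affBracket X Y)
      = 𝔇.affBracket ((𝔇.affσ ^ n) X) ((𝔇.affσ ^ n) Y) := by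
    intro n
    induction n with
    | zero => intro X Y; simp
    | succ n ih =>
      intro X Y
      rw [pow_succ', Module.End.mul_apply, ih, affσ_affBracket]
      rfl
  rcases α with i | i
  · simp only [slotAct, hp, phase_mul, map_smul, LinearMap.smul_apply, smul_smul]
    rw [mul_comm]
  · simp only [slotAct, hp, phase_mul, ← affτ_affBracket, map_smul, LinearMap.smul_apply,
      smul_smul]
    rw [mul_comm]

lemma coefD_slotAct {x : OnePoint ℂ} {p : ℕ} {α : DihedralGroup T} {X : Aff g}
    (h : X.coefD = 0) : (𝔇.slotAct x p α X).coefD = 0 := by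
  have hs : ∀ (n : ℕ) (X : Aff g), ((𝔇.affσ ^ n) X).coefD = X.coefD := by
    intro n
    induction n with
    | zero => intro X; simp
    | succ n ih => intro X; rw [pow_succ', Module.End.mul_apply]; exact ih X
  have ht : ∀ X : Aff g, (𝔇.affτ X).coefD = -conj X.coefD := fun X => rfl
  rcases α with i | i <;> simp [slotAct, hs, ht, h]

/-- Dropping the `D`-component. -/
def dropD : Aff g →ₗ[ℂ] Aff g where
  toFun X := ((X.loopPart, X.coefK, 0) : (ℤ →₀ g) × ℂ × ℂ)
  map_add' X Y := by
    refine Prod.ext rfl (Prod.ext rfl ?_)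
    change (0 : ℂ) = 0 + 0
    simp
  map_smul' c X := by
    refine Prod.ext rfl (Prod.ext rfl ?_)
    change (0 : ℂ) = c * 0
    simp

lemma slotAct_dropD (x : OnePoint ℂ) (p : ℕ) (α : DihedralGroup T) (X : Aff g) :
    𝔇.slotAct x p α (dropD X) = dropD (𝔇.slotAct x p α X) := by
  have hs : ∀ (n : ℕ) (X : Aff g), (𝔇.affσ ^ n) (dropD X) = dropD ((𝔇.affσ ^ n) X) := by
    intro n
    induction n with
    | zero => intro X; simp
    | succ n ih =>
      intro X
      rw [pow_succ', Module.End.mul_apply, Module.End.mul_apply, ih]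
      rfl
  have ht : ∀ X : Aff g, 𝔇.affτ (dropD X) = dropD (𝔇.affτ X) := by
    intro X
    refine Prod.ext rfl (Prod.ext rfl ?_)
    change -conj (0 : ℂ) = 0
    simp
  rcases α with i | i
  · simp only [slotAct, hs, map_smul]
  · simp only [slotAct, hs, map_smul, ← ht]

end DihedralLie

end Dihedral

/-! ### Marked points, multiplicities and levels -/

open scoped Classical

/-- A complex point of the sphere: one with trivial stabiliser. -/
def IsComplexPt (T : ℕ) (ω : ℂ) (x : OnePoint ℂ) : Prop :=
  ∀ α : DihedralGroup T, mobius ω α x = x → α = 1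

/-- The marked points (the finite set `pts` together with infinity), the multiplicities and the
levels of a dihedral affine Gaudin model. -/
structure GaudinData (T : ℕ) (ω : ℂ) where
  /-- the finite marked points -/
  pts : Finset ℂ
  /-- the orbits of the marked points are disjoint -/
  orbits : ∀ x ∈ pts, ∀ y ∈ pts, ∀ α : DihedralGroup T, mobius ω α x = y → x = y
  /-- the multiplicity of a point in the invariant divisor on the orbits of the marked points -/
  mult : OnePoint ℂ → ℕ
  mult_mobius : ∀ (α : DihedralGroup T) (x : OnePoint ℂ), mult (mobius ω α x) = mult x
  mult_pos : ∀ x : OnePoint ℂ, 0 < mult x ↔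
    x = OnePoint.infty ∨ ∃ y ∈ pts, ∃ α : DihedralGroup T, x = mobius ω α (y : OnePoint ℂ)
  /-- the invariant divisor has degree at least two -/
  degree_ge : 2 ≤ mult OnePoint.infty ∨ pts.Nonempty
  /-- the levels; `level infty 0` plays no role -/
  level : OnePoint ℂ → ℕ → ℂ
  level_of_ge : ∀ x p, mult x ≤ p → level x p = 0
  level_zero : ∀ p, ¬ T ∣ p → level ((0 : ℂ) : OnePoint ℂ) p = 0
  level_infty : ∀ p, ¬ T ∣ p → level OnePoint.infty p = 0
  level_top : ∀ x ∈ pts, level x (mult x - 1) ≠ 0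
  level_top_infty : 2 ≤ mult OnePoint.infty →
    level OnePoint.infty (mult OnePoint.infty - 1) ≠ 0
  level_complex : ∀ x ∈ pts, IsComplexPt T ω x → ∀ p,
    conj (level x p) = level ((conj x : ℂ) : OnePoint ℂ) p
  level_real : ∀ x ∈ pts, x ≠ 0 → ∀ k : ℕ, ω ^ k * conj x = x → ∀ p,
    conj (level x p) = (ω ^ (k * p))⁻¹ * level x p
  level_real_zero : ∀ p, conj (level ((0 : ℂ) : OnePoint ℂ) p) = level ((0 : ℂ) : OnePoint ℂ) p
  level_real_infty : ∀ p, 1 ≤ p → conj (level OnePoint.infty p) = level OnePoint.infty p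

namespace GaudinData

variable {ω : ℂ} (G : GaudinData T ω)

/-- Membership in the set of all marked points, infinity included. -/
def Marked (x : OnePoint ℂ) : Prop := x = OnePoint.infty ∨ ∃ y ∈ G.pts, x = (y : OnePoint ℂ)

/-- The complex marked points. -/
def zc : Finset ℂ := G.pts.filter fun x => IsComplexPt T ω (x : OnePoint ℂ)

/-- The finite marked points together with the conjugates of the complex ones. -/
def allPts : Finset ℂ := G.pts ∪ G.zc.image conj

/-- The points at which the truncated polynomials are attached, with their exponents:
`0, …, n_x - 1` at a finite point and `1, …, n_∞ - 1` at infinity. -/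
def exps (x : OnePoint ℂ) : Finset ℕ :=
  Finset.Ico (if x = OnePoint.infty then 1 else 0) (G.mult x)

/-- The finite points of the orbits of the marked points. -/
def IsPole (z : ℂ) : Prop :=
  ∃ x ∈ G.pts, ∃ α : DihedralGroup T, (z : OnePoint ℂ) = mobius ω α (x : OnePoint ℂ)

end GaudinData

/-! ### The real Takiff algebra and its complexification -/

section Takiff

variable [NeZero T] (𝔇 : DihedralLie T g) (G : GaudinData T 𝔇.ω)

set_option linter.unusedSectionVars false

/-- The real Lie algebra `g̃^D`: the direct sum over the marked points `x` of the invariants, under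
the stabiliser of `x`, in `g̃ ⊗ ℂ[ε] / ε ^ n_x` (in `g̃ ⊗ ε ℂ[ε] / ε ^ n_∞` at infinity). An element
is recorded by the coefficient `f x p` of `ε_x ^ p`. -/
def takiff : Submodule ℝ (OnePoint ℂ → ℕ → Aff g) where
  carrier := {f | (∀ x p, ¬ (G.Marked x ∧ p ∈ G.exps x) → f x p = 0) ∧
    ∀ (x : OnePoint ℂ) (p : ℕ) (α : DihedralGroup T), mobius 𝔇.ω α x = x →
      𝔇.slotAct x p α (f x p) = f x p}
  zero_mem' := ⟨fun _ _ _ => rfl, fun x p α _ => map_zero (𝔇.slotActₗ x p α)⟩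
  add_mem' := by
    rintro f h ⟨hf, hf'⟩ ⟨hh, hh'⟩
    refine ⟨fun x p hx => ?_, fun x p α hα => ?_⟩
    · change f x p + h x p = 0
      rw [hf x p hx, hh x p hx, add_zero]
    · change 𝔇.slotAct x p α (f x p + h x p) = f x p + h x p
      rw [𝔇.slotAct_add, hf' x p α hα, hh' x p α hα]
  smul_mem' := by
    rintro c f ⟨hf, hf'⟩
    refine ⟨fun x p hx => ?_, fun x p α hα => ?_⟩
    · change c • f x p = 0
      rw [hf x p hx, smul_zero]
    · change 𝔇.slotAct x p α (c • f x p) = c • f x p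
      rw [𝔇.slotAct_smul, hf' x p α hα]

/-- The real Lie algebra `ĝ^D`, the subalgebra of `g̃^D` of the elements without `D`-component. -/
def takiffHat : Submodule ℝ (OnePoint ℂ → ℕ → Aff g) where
  carrier := {f | f ∈ takiff 𝔇 G ∧ ∀ x p, (f x p).coefD = 0}
  zero_mem' := ⟨Submodule.zero_mem _, fun _ _ => rfl⟩
  add_mem' := by
    rintro f h ⟨hf, hf'⟩ ⟨hh, hh'⟩
    refine ⟨Submodule.add_mem _ hf hh, fun x p => ?_⟩
    change (f x p + h x p).coefD = 0
    rw [map_add, hf', hh', add_zero]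
  smul_mem' := by
    rintro c f ⟨hf, hf'⟩
    refine ⟨Submodule.smul_mem _ c hf, fun x p => ?_⟩
    change (c • f x p).coefD = 0
    rw [← Complex.coe_smul, map_smul, hf', smul_zero]

/-- The bracket of coefficient functions, `[X ε ^ p, Y ε ^ q] = [X, Y] ε ^ (p + q)` at each marked
point. -/
def slotBracket (f h : OnePoint ℂ → ℕ → Aff g) : OnePoint ℂ → ℕ → Aff g := fun x r =>
  if G.Marked x ∧ r ∈ G.exps x then
    ∑ pq ∈ Finset.HasAntidiagonal.antidiagonal r, 𝔇.affBracket (f x pq.1) (h x pq.2) else 0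

lemma slotBracket_mem {f h : OnePoint ℂ → ℕ → Aff g} (hf : f ∈ takiffHat 𝔇 G)
    (hh : h ∈ takiffHat 𝔇 G) : slotBracket 𝔇 G f h ∈ takiffHat 𝔇 G := by
  refine ⟨⟨fun x p hx => if_neg hx, fun x p α hα => ?_⟩, fun x p => ?_⟩
  · unfold slotBracket
    split_ifs with hx
    · change 𝔇.slotActₗ x p α _ = _
      rw [map_sum]
      refine Finset.sum_congr rfl fun pq hpq => ?_
      change 𝔇.slotAct x p α _ = _
      rw [← Finset.HasAntidiagonal.mem_antidiagonal.1 hpq, 𝔇.slotAct_affBracket, hf.1.2 x _ α hα,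
        hh.1.2 x _ α hα]
    · exact map_zero (𝔇.slotActₗ x p α)
  · unfold slotBracket
    split_ifs with hx
    · rw [map_sum]
      exact Finset.sum_eq_zero fun pq _ => rfl
    · rfl

lemma slotBracket_add_left (f f' h : OnePoint ℂ → ℕ → Aff g) :
    slotBracket 𝔇 G (f + f') h = slotBracket 𝔇 G f h + slotBracket 𝔇 G f' h := by
  funext x r
  simp only [slotBracket, Pi.add_apply, map_add, LinearMap.add_apply, Finset.sum_add_distrib]
  split_ifs <;> simp

lemma slotBracket_add_right (f h h' : OnePoint ℂ → ℕ → Aff g) :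
    slotBracket 𝔇 G f (h + h') = slotBracket 𝔇 G f h + slotBracket 𝔇 G f h' := by
  funext x r
  simp only [slotBracket, Pi.add_apply, map_add, Finset.sum_add_distrib]
  split_ifs <;> simp

lemma slotBracket_smul_left (c : ℝ) (f h : OnePoint ℂ → ℕ → Aff g) :
    slotBracket 𝔇 G (c • f) h = c • slotBracket 𝔇 G f h := by
  funext x r
  simp only [slotBracket, Pi.smul_apply, ← Complex.coe_smul, map_smul, LinearMap.smul_apply,
    ← Finset.smul_sum]
  split_ifs <;> simp

lemma slotBracket_smul_right (c : ℝ) (f h : OnePoint ℂ → ℕ → Aff g) :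
    slotBracket 𝔇 G f (c • h) = c • slotBracket 𝔇 G f h := by
  funext x r
  simp only [slotBracket, Pi.smul_apply, ← Complex.coe_smul, map_smul, ← Finset.smul_sum]
  split_ifs <;> simp

/-- The Lie bracket of `ĝ^D`. -/
def hatBracket : takiffHat 𝔇 G →ₗ[ℝ] takiffHat 𝔇 G →ₗ[ℝ] takiffHat 𝔇 G :=
  LinearMap.mk₂ ℝ (fun f h => ⟨slotBracket 𝔇 G f h, slotBracket_mem 𝔇 G f.2 h.2⟩)
    (fun f f' h => Subtype.ext (slotBracket_add_left 𝔇 G f f' h))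
    (fun c f h => Subtype.ext (slotBracket_smul_left 𝔇 G c f h))
    (fun f h h' => Subtype.ext (slotBracket_add_right 𝔇 G f h h'))
    (fun c f h => Subtype.ext (slotBracket_smul_right 𝔇 G c f h))

/-- The complexification of `g̃^D`. -/
abbrev TakiffC : Type _ := ℂ ⊗[ℝ] takiff 𝔇 G

/-- The complexification of `ĝ^D`. -/
abbrev HatC : Type _ := ℂ ⊗[ℝ] takiffHat 𝔇 G

/-- The Lie bracket of the complexification of `ĝ^D`, extended bilinearly from `ĝ^D`. -/
def hatBracketC : HatC 𝔇 G →ₗ[ℂ] HatC 𝔇 G →ₗ[ℂ] HatC 𝔇 G :=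
  LinearMap.liftBaseChange ℂ
    ((LinearMap.baseChangeHom ℝ ℂ (takiffHat 𝔇 G) (takiffHat 𝔇 G)) ∘ₗ hatBracket 𝔇 G)

lemma hatBracketC_tmul (a b : ℂ) (f h : takiffHat 𝔇 G) :
    hatBracketC 𝔇 G (a ⊗ₜ f) (b ⊗ₜ h) = (a * b) ⊗ₜ hatBracket 𝔇 G f h := by
  simp [hatBracketC, LinearMap.baseChangeHom, TensorProduct.smul_tmul']

/-- Dropping the `D`-components. -/
def takiffDropD : takiff 𝔇 G →ₗ[ℝ] takiffHat 𝔇 G where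
  toFun f := ⟨fun x p => DihedralLie.dropD (f.1 x p),
    ⟨fun x p hx => by
        change DihedralLie.dropD (f.1 x p) = 0
        rw [f.2.1 x p hx, map_zero],
      fun x p α hα => by
        change 𝔇.slotAct x p α (DihedralLie.dropD (f.1 x p)) = DihedralLie.dropD (f.1 x p)
        rw [𝔇.slotAct_dropD, f.2.2 x p α hα]⟩, fun _ _ => rfl⟩
  map_add' f h := by ext1; funext x p; exact map_add _ _ _
  map_smul' c f := by
    ext1; funext x p
    change DihedralLie.dropD (c • f.1 x p) = c • DihedralLie.dropD (f.1 x p)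
    rw [← Complex.coe_smul, ← Complex.coe_smul, map_smul]

/-- The sum of `α (X ⊗ ε_x ^ p)` over the stabiliser `Π_x` of `x`, divided by twice the order of
`Π_x ∩ Γ`, where `Γ` is the cyclic subgroup. -/
def slotAverage (x : OnePoint ℂ) (p : ℕ) : Aff g →ₗ[ℝ] Aff g :=
  ((2 * (Finset.univ.filter fun k : ZMod T =>
      mobius 𝔇.ω (DihedralGroup.r k) x = x).card : ℝ)⁻¹) •
    ∑ α ∈ Finset.univ.filter (fun α : DihedralGroup T => mobius 𝔇.ω α x = x), 𝔇.slotActₗ x p α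

lemma slotAct_slotAverage {x : OnePoint ℂ} {α : DihedralGroup T} (h : mobius 𝔇.ω α x = x)
    (p : ℕ) (X : Aff g) : 𝔇.slotAct x p α (slotAverage 𝔇 x p X) = slotAverage 𝔇 x p X := by
  change 𝔇.slotActₗ x p α _ = _
  simp only [slotAverage, LinearMap.smul_apply, LinearMap.sum_apply, map_smul, map_sum]
  congr 1
  simp only [Finset.sum_filter]
  refine Fintype.sum_equiv (Equiv.mulLeft α) _ _ fun β => ?_
  simp only [Equiv.coe_mulLeft, mobius_mul_fixed_iff 𝔇.ω_prim.pow_eq_one h]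
  split_ifs
  · exact (𝔇.slotAct_mul x p α β X).symm
  · rfl

/-- The element of `g̃^D` with the single component `slotAverage 𝔇 x p X ⊗ ε_x ^ p` (zero unless
`x` is marked and `p` is one of its exponents). -/
def single (x : OnePoint ℂ) (p : ℕ) : Aff g →ₗ[ℝ] takiff 𝔇 G where
  toFun X := ⟨fun y q => if (y = x ∧ q = p) ∧ G.Marked x ∧ p ∈ G.exps x then
      slotAverage 𝔇 x p X else 0, by
    refine ⟨fun y q hyq => if_neg ?_, fun y q α hα => ?_⟩
    · rintro ⟨⟨rfl, rfl⟩, h⟩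
      exact hyq h
    · beta_reduce
      split_ifs with h
      · obtain ⟨⟨rfl, rfl⟩, -⟩ := h
        exact slotAct_slotAverage 𝔇 hα q X
      · exact map_zero (𝔇.slotActₗ y q α)⟩
  map_add' X Y := by
    ext1; funext y q
    simp only [Submodule.coe_add, Pi.add_apply, map_add]
    split_ifs <;> simp
  map_smul' c X := by
    ext1; funext y q
    simp only [Submodule.coe_smul, Pi.smul_apply, map_smul, RingHom.id_apply]
    split_ifs <;> simp

/-- The element `X^{(x)}_p` of the complexification of `g̃^D`. For a marked point `x` it is
`1 ⊗ P X ε_x ^ p - i ⊗ P (i X) ε_x ^ p` with `P` the averaging map `slotAverage`: this is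
`½ (1 ⊗ X ε_x ^ p - i ⊗ (i X) ε_x ^ p)` if `x` is complex, `1 ⊗ π⁺X ε_x ^ p - i ⊗ (i π⁻X) ε_x ^ p`
with `π^± = (1 ± ω ^ (-k p) σ ^ k τ) / 2` if `x` is real with stabiliser generated by `s ^ k t`, and
for the fixed points `0` and infinity it is the same with `k = 0` after projecting `X` to the
eigenspace of `σ` for the eigenvalue `ω ^ p`, respectively `ω ^ (-p)`. For the conjugate `x` of a
complex marked point `y` it is `½ (1 ⊗ X ε_y ^ p + i ⊗ (i X) ε_y ^ p)`. -/
def symb (x : OnePoint ℂ) (p : ℕ) (X : Aff g) : TakiffC 𝔇 G :=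
  if G.Marked x then
    (1 : ℂ) ⊗ₜ single 𝔇 G x p X - Complex.I ⊗ₜ single 𝔇 G x p (Complex.I • X)
  else
    (1 : ℂ) ⊗ₜ single 𝔇 G (x.map conj) p X + Complex.I ⊗ₜ single 𝔇 G (x.map conj) p (Complex.I • X)

/-- The element `X^{(x)}_p` of the complexification of `ĝ^D`, for `X` without `D`-component (in
general, the `D`-component of `X` is dropped). -/
def symbHat (x : OnePoint ℂ) (p : ℕ) (X : Aff g) : HatC 𝔇 G :=
  (takiffDropD 𝔇 G).baseChange ℂ (symb 𝔇 G x p X)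

end Takiff

/-! ### The algebra of observables -/

section Poisson

variable {L : Type*} [AddCommGroup L] [Module ℂ L]

local notation "𝕊" => SymmetricAlgebra ℂ L

/-- The extension of a linear map `f : L → S(L)` to an algebra map into the dual numbers, whose
second component is the derivation extending `f`. -/
def derivHom (f : L →ₗ[ℂ] 𝕊) : 𝕊 →ₐ[ℂ] TrivSqZeroExt 𝕊 𝕊 :=
  SymmetricAlgebra.lift
    ((TrivSqZeroExt.inlAlgHom ℂ 𝕊 𝕊).toLinearMap ∘ₗ SymmetricAlgebra.ι ℂ L
      + (TrivSqZeroExt.inrHom 𝕊 𝕊).restrictScalars ℂ ∘ₗ f)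

lemma derivHom_ι (f : L →ₗ[ℂ] 𝕊) (x : L) : derivHom f (SymmetricAlgebra.ι ℂ L x)
    = TrivSqZeroExt.inl (SymmetricAlgebra.ι ℂ L x) + TrivSqZeroExt.inr (f x) := by
  simp [derivHom]

lemma fst_derivHom (f : L →ₗ[ℂ] 𝕊) (a : 𝕊) : (derivHom f a).fst = a := by
  have h : (TrivSqZeroExt.fstHom ℂ 𝕊 𝕊).comp (derivHom f) = AlgHom.id ℂ 𝕊 := by
    apply SymmetricAlgebra.algHom_ext
    ext x
    simp [derivHom_ι]
  exact congrArg (fun F : 𝕊 →ₐ[ℂ] 𝕊 => F a) h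

/-- The derivation of the symmetric algebra extending a linear map `f : L → S(L)`. -/
def derivExt (f : L →ₗ[ℂ] 𝕊) : 𝕊 →ₗ[ℂ] 𝕊 :=
  (TrivSqZeroExt.sndHom 𝕊 𝕊).restrictScalars ℂ ∘ₗ (derivHom f).toLinearMap

lemma derivExt_ι (f : L →ₗ[ℂ] 𝕊) (x : L) : derivExt f (SymmetricAlgebra.ι ℂ L x) = f x := by
  simp [derivExt, derivHom_ι]

lemma derivExt_algebraMap (f : L →ₗ[ℂ] 𝕊) (c : ℂ) : derivExt f (algebraMap ℂ 𝕊 c) = 0 := by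
  simp [derivExt, TrivSqZeroExt.algebraMap_eq_inl']

lemma derivExt_mul (f : L →ₗ[ℂ] 𝕊) (a b : 𝕊) :
    derivExt f (a * b) = a * derivExt f b + b * derivExt f a := by
  simp [derivExt, fst_derivHom, mul_comm]

lemma derivExt_add (f f' : L →ₗ[ℂ] 𝕊) : derivExt (f + f') = derivExt f + derivExt f' := by
  ext a
  induction a using SymmetricAlgebra.induction with
  | algebraMap c => simp [derivExt_algebraMap]
  | ι x => simp [derivExt_ι]
  | mul a b ha hb =>
    rw [LinearMap.add_apply] at ha hb ⊢
    rw [derivExt_mul, derivExt_mul, derivExt_mul, ha, hb]; ring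
  | add a b ha hb => rw [map_add, map_add, ha, hb]

lemma derivExt_smul (c : ℂ) (f : L →ₗ[ℂ] 𝕊) : derivExt (c • f) = c • derivExt f := by
  ext a
  induction a using SymmetricAlgebra.induction with
  | algebraMap c => simp [derivExt_algebraMap]
  | ι x => simp [derivExt_ι]
  | mul a b ha hb =>
    rw [LinearMap.smul_apply] at ha hb ⊢
    rw [derivExt_mul, derivExt_mul, ha, hb, smul_add, mul_smul_comm, mul_smul_comm]
  | add a b ha hb => rw [map_add, map_add, ha, hb]

/-- `derivExt` as a linear map. -/
def derivExtₗ : (L →ₗ[ℂ] 𝕊) →ₗ[ℂ] 𝕊 →ₗ[ℂ] 𝕊 where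
  toFun := derivExt
  map_add' := derivExt_add
  map_smul' := derivExt_smul

/-- The map sending `x : L` to the derivation of `S(L)` extending the bracket with `x`. -/
def adDeriv (β : L →ₗ[ℂ] L →ₗ[ℂ] L) : L →ₗ[ℂ] 𝕊 →ₗ[ℂ] 𝕊 :=
  derivExtₗ ∘ₗ LinearMap.llcomp ℂ L L 𝕊 (SymmetricAlgebra.ι ℂ L) ∘ₗ β

lemma adDeriv_apply (β : L →ₗ[ℂ] L →ₗ[ℂ] L) (x : L) :
    adDeriv β x = derivExt (SymmetricAlgebra.ι ℂ L ∘ₗ β x) := rfl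

/-- The Poisson bracket of the symmetric algebra: the biderivation extending the bracket `β` of
`L`. -/
def poisson (β : L →ₗ[ℂ] L →ₗ[ℂ] L) : 𝕊 →ₗ[ℂ] 𝕊 →ₗ[ℂ] 𝕊 :=
  (derivExtₗ ∘ₗ (adDeriv β).flip).flip

lemma poisson_apply (β : L →ₗ[ℂ] L →ₗ[ℂ] L) (a b : 𝕊) :
    poisson β a b = derivExt ((adDeriv β).flip b) a := rfl

lemma poisson_ι_ι (β : L →ₗ[ℂ] L →ₗ[ℂ] L) (x y : L) :
    poisson β (SymmetricAlgebra.ι ℂ L x) (SymmetricAlgebra.ι ℂ L y)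
      = SymmetricAlgebra.ι ℂ L (β x y) := by
  rw [poisson_apply, derivExt_ι, LinearMap.flip_apply, adDeriv_apply, derivExt_ι,
    LinearMap.comp_apply]

lemma poisson_mul_left (β : L →ₗ[ℂ] L →ₗ[ℂ] L) (a b c : 𝕊) :
    poisson β (a * b) c = a * poisson β b c + b * poisson β a c := by
  rw [poisson_apply, poisson_apply, poisson_apply, derivExt_mul]

lemma poisson_mul_right (β : L →ₗ[ℂ] L →ₗ[ℂ] L) (a b c : 𝕊) :
    poisson β a (b * c) = b * poisson β a c + c * poisson β a b := by
  induction a using SymmetricAlgebra.induction with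
  | algebraMap r => simp [poisson_apply, derivExt_algebraMap]
  | ι x => simp [poisson_apply, derivExt_ι, adDeriv_apply, derivExt_mul]
  | mul a a' ha ha' => rw [poisson_mul_left, poisson_mul_left, poisson_mul_left, ha, ha']; ring
  | add a a' ha ha' =>
    rw [map_add, LinearMap.add_apply, LinearMap.add_apply, LinearMap.add_apply, ha, ha']; ring

/-- An ideal generated by Poisson-central elements is stable under bracketing from the left. -/
lemma poisson_mem_right (β : L →ₗ[ℂ] L →ₗ[ℂ] L) {E : Set 𝕊}
    (hE : ∀ e ∈ E, ∀ a, poisson β a e = 0) (a : 𝕊) {b : 𝕊} (hb : b ∈ Ideal.span E) :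
    poisson β a b ∈ Ideal.span E := by
  induction hb using Submodule.span_induction with
  | mem e he => rw [hE e he]; exact Submodule.zero_mem _
  | zero => rw [map_zero]; exact Submodule.zero_mem _
  | add b b' _ _ h h' => rw [map_add]; exact Submodule.add_mem _ h h'
  | smul c b hb h =>
    rw [smul_eq_mul, poisson_mul_right]
    exact Ideal.add_mem _ (Ideal.mul_mem_left _ _ h) (Ideal.mul_mem_right _ _ hb)

/-- An ideal generated by Poisson-central elements is stable under bracketing from the right. -/
lemma poisson_mem_left (β : L →ₗ[ℂ] L →ₗ[ℂ] L) {E : Set 𝕊}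
    (hE : ∀ e ∈ E, ∀ a, poisson β e a = 0) (a : 𝕊) {b : 𝕊} (hb : b ∈ Ideal.span E) :
    poisson β b a ∈ Ideal.span E := by
  induction hb using Submodule.span_induction with
  | mem e he => rw [hE e he]; exact Submodule.zero_mem _
  | zero => rw [map_zero]; exact Submodule.zero_mem _
  | add b b' _ _ h h' => rw [map_add]; exact Submodule.add_mem _ h h'
  | smul c b hb h =>
    rw [smul_eq_mul, poisson_mul_left]
    exact Ideal.add_mem _ (Ideal.mul_mem_left _ _ h) (Ideal.mul_mem_right _ _ hb)

/-- A central element of `L`, up to a scalar, is Poisson-central. -/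
lemma poisson_central_right (β : L →ₗ[ℂ] L →ₗ[ℂ] L) {x : L} (hx : ∀ y, β y x = 0) (c : ℂ)
    (a : 𝕊) : poisson β a (SymmetricAlgebra.ι ℂ L x - algebraMap ℂ 𝕊 c) = 0 := by
  have h : (adDeriv β).flip (SymmetricAlgebra.ι ℂ L x - algebraMap ℂ 𝕊 c) = 0 := by
    ext y
    simp [adDeriv_apply, derivExt_ι, derivExt_algebraMap, hx]
  rw [poisson_apply, h]
  exact congrArg (fun F : 𝕊 →ₗ[ℂ] 𝕊 => F a) (map_zero derivExtₗ)

lemma poisson_central_left (β : L →ₗ[ℂ] L →ₗ[ℂ] L) {x : L} (hx : ∀ y, β x y = 0) (c : ℂ)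
    (a : 𝕊) : poisson β (SymmetricAlgebra.ι ℂ L x - algebraMap ℂ 𝕊 c) a = 0 := by
  have h : adDeriv β x = 0 := by
    have h0 : β x = 0 := LinearMap.ext hx
    rw [adDeriv, LinearMap.comp_apply, LinearMap.comp_apply, h0, map_zero, map_zero]
  rw [poisson_apply, map_sub, derivExt_ι, derivExt_algebraMap, LinearMap.flip_apply, h]
  simp

end Poisson

section Observables

variable [NeZero T] (𝔇 : DihedralLie T g) (G : GaudinData T 𝔇.ω)

set_option linter.unusedSectionVars false

/-- The elements of `ℂ K`. -/
def lineK : Submodule ℝ (Aff g) where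
  carrier := {X | X.loopPart = 0 ∧ X.coefD = 0}
  zero_mem' := ⟨rfl, rfl⟩
  add_mem' := by
    rintro X Y ⟨h, h'⟩ ⟨k, k'⟩
    exact ⟨by rw [map_add, h, k, add_zero], by rw [map_add, h', k', add_zero]⟩
  smul_mem' := by
    rintro c X ⟨h, h'⟩
    rw [← Complex.coe_smul]
    exact ⟨by rw [map_smul, h, smul_zero], by rw [map_smul, h', smul_zero]⟩

lemma affBracket_lineK_left {X : Aff g} (h : X ∈ lineK) (Y : Aff g) : 𝔇.affBracket X Y = 0 := by
  refine Prod.ext ?_ (Prod.ext ?_ rfl)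
  · change DihedralLie.loopBracket X.loopPart Y.loopPart + X.coefD • DihedralLie.degree Y.loopPart
      - Y.coefD • DihedralLie.degree X.loopPart = 0
    rw [h.1, h.2]; simp
  · change 𝔇.cocycle X.loopPart Y.loopPart = 0
    rw [h.1]; simp

lemma affBracket_lineK_right {X : Aff g} (h : X ∈ lineK) (Y : Aff g) : 𝔇.affBracket Y X = 0 := by
  refine Prod.ext ?_ (Prod.ext ?_ rfl)
  · change DihedralLie.loopBracket Y.loopPart X.loopPart + Y.coefD • DihedralLie.degree X.loopPart
      - X.coefD • DihedralLie.degree Y.loopPart = 0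
    rw [h.1, h.2]; simp
  · change 𝔇.cocycle Y.loopPart X.loopPart = 0
    rw [h.1]; simp

lemma slotAct_lineK (x : OnePoint ℂ) (p : ℕ) (α : DihedralGroup T) {X : Aff g} (h : X ∈ lineK) :
    𝔇.slotAct x p α X ∈ lineK := by
  refine ⟨?_, 𝔇.coefD_slotAct h.2⟩
  have hs : ∀ (n : ℕ) (X : Aff g), X.loopPart = 0 → ((𝔇.affσ ^ n) X).loopPart = 0 := by
    intro n
    induction n with
    | zero => intro X hX; simpa using hX
    | succ n ih =>
      intro X hX
      rw [pow_succ', Module.End.mul_apply]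
      change Finsupp.mapRange.linearMap 𝔇.σ ((𝔇.affσ ^ n) X).loopPart = 0
      rw [ih X hX, map_zero]
  rcases α with i | i
  · change Aff.loopPart (_ • _) = 0
    rw [map_smul, hs _ _ h.1, smul_zero]
  · change 𝔇.loopτ (Aff.loopPart (_ • _)) = 0
    rw [map_smul, hs _ _ h.1, smul_zero, map_zero]

lemma slotAverage_lineK (x : OnePoint ℂ) (p : ℕ) {X : Aff g} (h : X ∈ lineK) :
    slotAverage 𝔇 x p X ∈ lineK := by
  rw [slotAverage, LinearMap.smul_apply, LinearMap.sum_apply]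
  exact Submodule.smul_mem _ _ (Submodule.sum_mem _ fun α _ => slotAct_lineK 𝔇 x p α h)

lemma single_lineK (x : OnePoint ℂ) (p : ℕ) {X : Aff g} (h : X ∈ lineK) (y : OnePoint ℂ) (q : ℕ) :
    (single 𝔇 G x p X).1 y q ∈ lineK := by
  change (if (y = x ∧ q = p) ∧ G.Marked x ∧ p ∈ G.exps x then slotAverage 𝔇 x p X else 0) ∈ lineK
  split_ifs
  · exact slotAverage_lineK 𝔇 x p h
  · exact Submodule.zero_mem _

lemma hatBracket_lineK_left {f : takiffHat 𝔇 G} (hf : ∀ x p, f.1 x p ∈ lineK)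
    (h : takiffHat 𝔇 G) : hatBracket 𝔇 G f h = 0 := by
  refine Subtype.ext (funext fun x => funext fun r => ?_)
  change slotBracket 𝔇 G f.1 h.1 x r = 0
  simp only [slotBracket, affBracket_lineK_left 𝔇 (hf x _), Finset.sum_const_zero, ite_self]

lemma hatBracket_lineK_right {f : takiffHat 𝔇 G} (hf : ∀ x p, f.1 x p ∈ lineK)
    (h : takiffHat 𝔇 G) : hatBracket 𝔇 G h f = 0 := by
  refine Subtype.ext (funext fun x => funext fun r => ?_)
  change slotBracket 𝔇 G h.1 f.1 x r = 0
  simp only [slotBracket, affBracket_lineK_right 𝔇 (hf x _), Finset.sum_const_zero, ite_self]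

lemma dropD_lineK {f : takiff 𝔇 G} (hf : ∀ x p, f.1 x p ∈ lineK) (x : OnePoint ℂ) (p : ℕ) :
    (takiffDropD 𝔇 G f).1 x p ∈ lineK :=
  ⟨(hf x p).1, rfl⟩

lemma K_mem_lineK (c : ℂ) : c • (Aff.K : Aff g) ∈ lineK :=
  ⟨by rw [map_smul]; exact smul_zero c, by rw [map_smul]; exact smul_zero c⟩

lemma symbHat_K (x : OnePoint ℂ) (p : ℕ) : ∃ (f h : takiffHat 𝔇 G) (c : ℂ),
    (∀ y q, f.1 y q ∈ lineK) ∧ (∀ y q, h.1 y q ∈ lineK) ∧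
      symbHat 𝔇 G x p Aff.K = (1 : ℂ) ⊗ₜ f + c ⊗ₜ h := by
  have h1 : (Aff.K : Aff g) ∈ lineK := by simpa using K_mem_lineK (g := g) 1
  unfold symbHat symb
  split_ifs
  · refine ⟨_, _, -Complex.I, dropD_lineK 𝔇 G (single_lineK 𝔇 G x p h1),
      dropD_lineK 𝔇 G (single_lineK 𝔇 G x p (K_mem_lineK Complex.I)), ?_⟩
    rw [map_sub, LinearMap.baseChange_tmul, LinearMap.baseChange_tmul, TensorProduct.neg_tmul,
      sub_eq_add_neg]
  · refine ⟨_, _, Complex.I, dropD_lineK 𝔇 G (single_lineK 𝔇 G (x.map conj) p h1),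
      dropD_lineK 𝔇 G (single_lineK 𝔇 G (x.map conj) p (K_mem_lineK Complex.I)), ?_⟩
    rw [map_add, LinearMap.baseChange_tmul, LinearMap.baseChange_tmul]

lemma hatBracketC_K_left (x : OnePoint ℂ) (p : ℕ) (Y : HatC 𝔇 G) :
    hatBracketC 𝔇 G (symbHat 𝔇 G x p Aff.K) Y = 0 := by
  obtain ⟨f, h, c, hf, hh, e⟩ := symbHat_K 𝔇 G x p
  rw [e]
  induction Y using TensorProduct.induction_on with
  | zero => rw [map_zero]
  | tmul b k =>
    rw [map_add, LinearMap.add_apply, hatBracketC_tmul, hatBracketC_tmul,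
      hatBracket_lineK_left 𝔇 G hf, hatBracket_lineK_left 𝔇 G hh, TensorProduct.tmul_zero,
      TensorProduct.tmul_zero, add_zero]
  | add Y Z hY hZ => rw [map_add, hY, hZ, add_zero]

lemma hatBracketC_K_right (x : OnePoint ℂ) (p : ℕ) (Y : HatC 𝔇 G) :
    hatBracketC 𝔇 G Y (symbHat 𝔇 G x p Aff.K) = 0 := by
  obtain ⟨f, h, c, hf, hh, e⟩ := symbHat_K 𝔇 G x p
  rw [e]
  induction Y using TensorProduct.induction_on with
  | zero => rw [map_zero, LinearMap.zero_apply]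
  | tmul b k =>
    rw [map_add, hatBracketC_tmul, hatBracketC_tmul,
      hatBracket_lineK_right 𝔇 G hf, hatBracket_lineK_right 𝔇 G hh, TensorProduct.tmul_zero,
      TensorProduct.tmul_zero, add_zero]
  | add Y Z hY hZ => rw [map_add (hatBracketC 𝔇 G), LinearMap.add_apply, hY, hZ, add_zero]

/-- Membership in the set of the marked points, infinity included, and of the conjugates of the
complex ones. -/
def GaudinData.AllMarked {ω : ℂ} (G : GaudinData T ω) (x : OnePoint ℂ) : Prop :=
  x = OnePoint.infty ∨ ∃ y ∈ G.allPts, x = (y : OnePoint ℂ)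

/-- The sign `1` at a marked point and `-1` at the conjugate of a complex marked point. -/
def GaudinData.sign {ω : ℂ} (G : GaudinData T ω) (x : OnePoint ℂ) : ℂ :=
  if G.Marked x then 1 else -1

/-- The elements `K^{(x)}_p - i ℓ^x_p` for marked `x`, and `K^{(x)}_p + i ℓ^x_p` for the conjugates
`x` of complex marked points. -/
def levelGens : Set (SymmetricAlgebra ℂ (HatC 𝔇 G)) :=
  {e | ∃ (x : OnePoint ℂ) (p : ℕ), G.AllMarked x ∧ p ∈ G.exps x ∧
    e = SymmetricAlgebra.ι ℂ (HatC 𝔇 G) (symbHat 𝔇 G x p Aff.K)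
      - algebraMap ℂ (SymmetricAlgebra ℂ (HatC 𝔇 G)) (G.sign x * Complex.I * G.level x p)}

/-- The ideal fixing the levels. -/
def levelIdeal : Ideal (SymmetricAlgebra ℂ (HatC 𝔇 G)) := Ideal.span (levelGens 𝔇 G)

/-- The algebra `S_ℓ`, the quotient of the symmetric algebra of the complexification of `ĝ^D` by
`levelIdeal`. -/
def LevelAlg : Type _ := SymmetricAlgebra ℂ (HatC 𝔇 G) ⧸ levelIdeal 𝔇 G

instance : CommRing (LevelAlg 𝔇 G) :=
  inferInstanceAs (CommRing (SymmetricAlgebra ℂ (HatC 𝔇 G) ⧸ levelIdeal 𝔇 G))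

instance : Algebra ℂ (LevelAlg 𝔇 G) :=
  inferInstanceAs (Algebra ℂ (SymmetricAlgebra ℂ (HatC 𝔇 G) ⧸ levelIdeal 𝔇 G))

/-- The quotient map. -/
def levelMk : SymmetricAlgebra ℂ (HatC 𝔇 G) →ₐ[ℂ] LevelAlg 𝔇 G :=
  Ideal.Quotient.mkₐ ℂ (levelIdeal 𝔇 G)

lemma levelMk_surjective : Function.Surjective (levelMk 𝔇 G) :=
  Ideal.Quotient.mkₐ_surjective ℂ (levelIdeal 𝔇 G)

lemma levelMk_eq_zero {a : SymmetricAlgebra ℂ (HatC 𝔇 G)} (h : a ∈ levelIdeal 𝔇 G) :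
    levelMk 𝔇 G a = 0 :=
  Ideal.Quotient.eq_zero_iff_mem.2 h

/-- The Poisson bracket of `S(ĝ^D_ℂ)`. -/
def hatPoisson : SymmetricAlgebra ℂ (HatC 𝔇 G) →ₗ[ℂ] SymmetricAlgebra ℂ (HatC 𝔇 G) →ₗ[ℂ]
    SymmetricAlgebra ℂ (HatC 𝔇 G) :=
  poisson (hatBracketC 𝔇 G)

lemma hatPoisson_mem_right (a : SymmetricAlgebra ℂ (HatC 𝔇 G))
    {b : SymmetricAlgebra ℂ (HatC 𝔇 G)} (hb : b ∈ levelIdeal 𝔇 G) :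
    hatPoisson 𝔇 G a b ∈ levelIdeal 𝔇 G := by
  refine poisson_mem_right _ ?_ a hb
  rintro _ ⟨x, p, -, -, rfl⟩ a
  exact poisson_central_right _ (hatBracketC_K_right 𝔇 G x p) _ a

lemma hatPoisson_mem_left (a : SymmetricAlgebra ℂ (HatC 𝔇 G))
    {b : SymmetricAlgebra ℂ (HatC 𝔇 G)} (hb : b ∈ levelIdeal 𝔇 G) :
    hatPoisson 𝔇 G b a ∈ levelIdeal 𝔇 G := by
  refine poisson_mem_left _ ?_ a hb
  rintro _ ⟨x, p, -, -, rfl⟩ a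
  exact poisson_central_left _ (hatBracketC_K_left 𝔇 G x p) _ a

/-- The Poisson bracket of `S_ℓ`, induced by that of `S(ĝ^D_ℂ)`. -/
def levelBracket : LevelAlg 𝔇 G →ₗ[ℂ] LevelAlg 𝔇 G →ₗ[ℂ] LevelAlg 𝔇 G :=
  ((levelIdeal 𝔇 G).restrictScalars ℂ).liftQ
    (((levelIdeal 𝔇 G).restrictScalars ℂ).liftQ
      ((hatPoisson 𝔇 G).compr₂ (levelMk 𝔇 G).toLinearMap).flip
      (fun b hb => by
        refine LinearMap.mem_ker.2 (LinearMap.ext fun a => ?_)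
        exact levelMk_eq_zero 𝔇 G (hatPoisson_mem_right 𝔇 G a hb))).flip
    (fun b hb => by
      refine LinearMap.mem_ker.2 (LinearMap.ext fun a => ?_)
      obtain ⟨a, rfl⟩ := levelMk_surjective 𝔇 G a
      exact levelMk_eq_zero 𝔇 G (hatPoisson_mem_left 𝔇 G a hb))

lemma levelBracket_mk (a b : SymmetricAlgebra ℂ (HatC 𝔇 G)) :
    levelBracket 𝔇 G (levelMk 𝔇 G a) (levelMk 𝔇 G b) = levelMk 𝔇 G (hatPoisson 𝔇 G a b) := rfl

/-- The class of `X^{(x)}_p` in `S_ℓ`, for `X` without `D`-component. -/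
def obs (x : OnePoint ℂ) (p : ℕ) (X : Aff g) : LevelAlg 𝔇 G :=
  levelMk 𝔇 G (SymmetricAlgebra.ι ℂ (HatC 𝔇 G) (symbHat 𝔇 G x p X))

end Observables

/-! ### The completion and the level-fixing map -/

section InverseLimit

variable {A : Type*} [CommRing A] [Algebra ℂ A] (I : ℕ → Ideal A) (hI : Antitone I)

/-- The inverse limit of the quotients of an algebra by a descending sequence of ideals. -/
def invLimit : Subalgebra ℂ (∀ n : ℕ, A ⧸ I n) where
  carrier := {v | ∀ (m n : ℕ) (h : n ≤ m), Ideal.Quotient.factor (hI h) (v m) = v n}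
  mul_mem' := by
    intro v w hv hw m n h
    rw [Pi.mul_apply, Pi.mul_apply, map_mul, hv m n h, hw m n h]
  add_mem' := by
    intro v w hv hw m n h
    rw [Pi.add_apply, Pi.add_apply, map_add, hv m n h, hw m n h]
  algebraMap_mem' := fun c m n h => rfl

/-- The canonical map of an algebra to the inverse limit. -/
def toInvLimit : A →ₐ[ℂ] invLimit I hI :=
  (AlgHom.pi fun n => Ideal.Quotient.mkₐ ℂ (I n)).codRestrict _ fun _ _ _ _ => rfl

/-- The element of the inverse limit represented by a compatible sequence. -/
def seqInvLimit (a : ℕ → A) (ha : ∀ m n : ℕ, n ≤ m → a m - a n ∈ I n) : invLimit I hI :=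
  ⟨fun n => Ideal.Quotient.mk (I n) (a n), fun m n h => by
    change Ideal.Quotient.mk (I n) (a m) = Ideal.Quotient.mk (I n) (a n)
    exact Ideal.Quotient.eq.2 (ha m n h)⟩

end InverseLimit

section Completion

variable [NeZero T] (𝔇 : DihedralLie T g) (G : GaudinData T 𝔇.ω)

set_option linter.unusedSectionVars false

/-- The subspace `F_n = g ⊗ t ^ n ℂ[t]`. -/
def loopGE (n : ℕ) : Set (Aff g) :=
  {X | X.coefK = 0 ∧ X.coefD = 0 ∧ ∀ m : ℤ, X.loopPart m ≠ 0 → (n : ℤ) ≤ m}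

/-- The conjugate subspace `g ⊗ t ^ (-n) ℂ[t⁻¹]`. -/
def loopLE (n : ℕ) : Set (Aff g) :=
  {X | X.coefK = 0 ∧ X.coefD = 0 ∧ ∀ m : ℤ, X.loopPart m ≠ 0 → m ≤ -(n : ℤ)}

/-- The elements `X^{(x)}_p` of `S_ℓ` with `X` in `F_n` if `x` is marked and in the conjugate
subspace if `x` is the conjugate of a complex marked point. -/
def filtPos (n : ℕ) : Set (LevelAlg 𝔇 G) :=
  {a | ∃ (x : OnePoint ℂ) (p : ℕ) (X : Aff g), G.AllMarked x ∧ p ∈ G.exps x ∧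
    X ∈ (if G.Marked x then loopGE n else loopLE n) ∧ a = obs 𝔇 G x p X}

/-- The complex conjugates of the elements of `filtPos`. -/
def filtNeg (n : ℕ) : Set (LevelAlg 𝔇 G) :=
  {a | ∃ (x : OnePoint ℂ) (p : ℕ) (X : Aff g), G.AllMarked x ∧ p ∈ G.exps x ∧
    X ∈ (if G.Marked x then loopLE n else loopGE n) ∧ a = obs 𝔇 G x p X}

/-- The descending filtration of `S_ℓ` by ideals. -/
def filtIdeal (n : ℕ) : Ideal (LevelAlg 𝔇 G) :=
  Ideal.span (filtPos 𝔇 G n) ⊓ Ideal.span (filtNeg 𝔇 G n)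

lemma loopGE_anti {m n : ℕ} (h : n ≤ m) : (loopGE m : Set (Aff g)) ⊆ loopGE n := by
  rintro X ⟨h1, h2, h3⟩
  exact ⟨h1, h2, fun j hj => by have := h3 j hj; omega⟩

lemma loopLE_anti {m n : ℕ} (h : n ≤ m) : (loopLE m : Set (Aff g)) ⊆ loopLE n := by
  rintro X ⟨h1, h2, h3⟩
  exact ⟨h1, h2, fun j hj => by have := h3 j hj; omega⟩

lemma filtIdeal_anti : Antitone (filtIdeal 𝔇 G) := by
  intro n m h
  refine inf_le_inf (Ideal.span_mono ?_) (Ideal.span_mono ?_)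
  · rintro _ ⟨x, p, X, h1, h2, h3, rfl⟩
    refine ⟨x, p, X, h1, h2, ?_, rfl⟩
    split_ifs at h3 ⊢
    exacts [loopGE_anti h h3, loopLE_anti h h3]
  · rintro _ ⟨x, p, X, h1, h2, h3, rfl⟩
    refine ⟨x, p, X, h1, h2, ?_, rfl⟩
    split_ifs at h3 ⊢
    exacts [loopLE_anti h h3, loopGE_anti h h3]

/-- The completion of `S_ℓ`: the inverse limit of the quotients by the ideals of the filtration. -/
def LevelHat : Type _ := invLimit (filtIdeal 𝔇 G) (filtIdeal_anti 𝔇 G)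

instance : CommRing (LevelHat 𝔇 G) :=
  inferInstanceAs (CommRing (invLimit (filtIdeal 𝔇 G) (filtIdeal_anti 𝔇 G)))

instance : Algebra ℂ (LevelHat 𝔇 G) :=
  inferInstanceAs (Algebra ℂ (invLimit (filtIdeal 𝔇 G) (filtIdeal_anti 𝔇 G)))

/-- The canonical map from `S_ℓ` to its completion. -/
def toHat : LevelAlg 𝔇 G →ₐ[ℂ] LevelHat 𝔇 G :=
  toInvLimit (filtIdeal 𝔇 G) (filtIdeal_anti 𝔇 G)

/-- The coefficients `κ_m (ℓ_0, …, ℓ_{n-1})`: the sum over the compositions `c` of `m - n + 1` of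
`(-1) ^ |c| (∏ j, ℓ_{n-1-c_j}) / ℓ_{n-1} ^ (|c| + 1)`. -/
def kappa (n : ℕ) (l : ℕ → ℂ) (m : ℤ) : ℂ :=
  if m < (n : ℤ) - 1 then 0
  else ∑ c : Composition (m - n + 1).toNat,
    (-1) ^ c.length * (c.blocks.map fun j => l (n - 1 - j)).prod / l (n - 1) ^ (c.length + 1)

variable {ι : Type*} [Fintype ι] [DecidableEq ι] (b : Module.Basis ι ℂ g)

/-- The dual basis `I_a` of a basis `I^a` of `g`. -/
def dualB : Module.Basis ι ℂ g := 𝔇.form.dualBasis 𝔇.form_nondeg b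

/-- The partial sums, over `|n| < k`, of the series
`± (i / 2) ∑ p q n, κ^x_{p+q-r} I_{a,-n,p}^{(x)} I^{a,(x)}_{n,q}`, with sign `+` at a marked point
and `-` at the conjugate of a complex marked point. -/
def quadSum (x : OnePoint ℂ) (r : ℕ) (k : ℕ) : LevelAlg 𝔇 G :=
  ∑ p ∈ G.exps x, ∑ q ∈ G.exps x, ∑ n ∈ Finset.Ioo (-(k : ℤ)) k, ∑ a : ι,
    (G.sign x * (Complex.I / 2) * kappa (G.mult x) (G.level x) ((p : ℤ) + q - r)) •
      (obs 𝔇 G x p (Aff.loop (-n) (dualB 𝔇 b a)) * obs 𝔇 G x q (Aff.loop n (b a)))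

lemma loop_mem_GE {n : ℕ} {j : ℤ} (h : (n : ℤ) ≤ j) (X : g) : Aff.loop j X ∈ loopGE n := by
  refine ⟨rfl, rfl, fun m hm => ?_⟩
  by_contra hc
  exact hm (Finsupp.single_eq_of_ne (by omega))

lemma loop_mem_LE {n : ℕ} {j : ℤ} (h : j ≤ -(n : ℤ)) (X : g) : Aff.loop j X ∈ loopLE n := by
  refine ⟨rfl, rfl, fun m hm => ?_⟩
  by_contra hc
  exact hm (Finsupp.single_eq_of_ne (by omega))

lemma quad_mem {x : OnePoint ℂ} (hx : G.AllMarked x) {p q : ℕ} (hp : p ∈ G.exps x)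
    (hq : q ∈ G.exps x) {n : ℕ} {j : ℤ} (hj : (n : ℤ) ≤ j ∨ j ≤ -(n : ℤ)) (X Y : g) :
    obs 𝔇 G x p (Aff.loop (-j) X) * obs 𝔇 G x q (Aff.loop j Y) ∈ filtIdeal 𝔇 G n := by
  by_cases hm : G.Marked x
  · rcases hj with hj | hj
    · refine ⟨Ideal.mul_mem_left _ _ (Ideal.subset_span ⟨x, q, _, hx, hq, ?_, rfl⟩),
        Ideal.mul_mem_right _ _ (Ideal.subset_span ⟨x, p, _, hx, hp, ?_, rfl⟩)⟩
      · rw [if_pos hm]; exact loop_mem_GE hj Y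
      · rw [if_pos hm]; exact loop_mem_LE (by omega) X
    · refine ⟨Ideal.mul_mem_right _ _ (Ideal.subset_span ⟨x, p, _, hx, hp, ?_, rfl⟩),
        Ideal.mul_mem_left _ _ (Ideal.subset_span ⟨x, q, _, hx, hq, ?_, rfl⟩)⟩
      · rw [if_pos hm]; exact loop_mem_GE (by omega) X
      · rw [if_pos hm]; exact loop_mem_LE hj Y
  · rcases hj with hj | hj
    · refine ⟨Ideal.mul_mem_right _ _ (Ideal.subset_span ⟨x, p, _, hx, hp, ?_, rfl⟩),
        Ideal.mul_mem_left _ _ (Ideal.subset_span ⟨x, q, _, hx, hq, ?_, rfl⟩)⟩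
      · rw [if_neg hm]; exact loop_mem_LE (by omega) X
      · rw [if_neg hm]; exact loop_mem_GE hj Y
    · refine ⟨Ideal.mul_mem_left _ _ (Ideal.subset_span ⟨x, q, _, hx, hq, ?_, rfl⟩),
        Ideal.mul_mem_right _ _ (Ideal.subset_span ⟨x, p, _, hx, hp, ?_, rfl⟩)⟩
      · rw [if_neg hm]; exact loop_mem_LE hj Y
      · rw [if_neg hm]; exact loop_mem_GE (by omega) X

lemma quadSum_compat {x : OnePoint ℂ} (hx : G.AllMarked x) (r : ℕ) {m n : ℕ} (h : n ≤ m) :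
    quadSum 𝔇 G b x r m - quadSum 𝔇 G b x r n ∈ filtIdeal 𝔇 G n := by
  simp only [quadSum, ← Finset.sum_sub_distrib]
  refine Ideal.sum_mem _ fun p hp => Ideal.sum_mem _ fun q hq => ?_
  have hsub : Finset.Ioo (-(n : ℤ)) n ⊆ Finset.Ioo (-(m : ℤ)) m :=
    Finset.Ioo_subset_Ioo (by omega) (by omega)
  rw [← Finset.sum_sdiff hsub, add_sub_cancel_right]
  refine Ideal.sum_mem _ fun j hj => Ideal.sum_mem _ fun a _ => ?_
  rw [Finset.mem_sdiff, Finset.mem_Ioo, Finset.mem_Ioo] at hj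
  exact Submodule.smul_of_tower_mem _ _ (quad_mem 𝔇 G hx hp hq (by omega) _ _)

/-- The image of `D^{(x)}_r` under the level-fixing map, an element of the completion. -/
def quad (x : OnePoint ℂ) (r : ℕ) : LevelHat 𝔇 G :=
  if hx : G.AllMarked x then
    seqInvLimit (filtIdeal 𝔇 G) (filtIdeal_anti 𝔇 G) (quadSum 𝔇 G b x r)
      fun _ _ h => quadSum_compat 𝔇 G b hx r h
  else 0

/-- The coefficient of `D ⊗ ε_x ^ r`. -/
def coefDAt (x : OnePoint ℂ) (r : ℕ) : takiff 𝔇 G →ₗ[ℝ] ℂ where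
  toFun f := (f.1 x r).coefD
  map_add' f h := map_add Aff.coefD _ _
  map_smul' c f := by
    change (c • f.1 x r).coefD = c • (f.1 x r).coefD
    rw [← Complex.coe_smul, ← Complex.coe_smul, map_smul]

/-- The contribution of the `D`-components at the marked point `x` to the level-fixing map. For
complex `x` one has `1 ⊗ d D ε_x ^ r = d D^{(x)}_r + conj d D^{(conj x)}_r`, for the other marked
points `1 ⊗ d D ε_x ^ r = d D^{(x)}_r`. -/
def piD (x : OnePoint ℂ) (r : ℕ) : takiff 𝔇 G →ₗ[ℝ] LevelHat 𝔇 G :=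
  (LinearMap.toSpanSingleton ℂ (LevelHat 𝔇 G) (quad 𝔇 G b x r)).restrictScalars ℝ
      ∘ₗ coefDAt 𝔇 G x r
    + if IsComplexPt T 𝔇.ω x then
        (LinearMap.toSpanSingleton ℂ (LevelHat 𝔇 G) (quad 𝔇 G b (x.map conj) r)).restrictScalars ℝ
          ∘ₗ Complex.conjAe.toLinearMap ∘ₗ coefDAt 𝔇 G x r
      else 0

/-- The marked points, infinity included. -/
def GaudinData.markedPts {ω : ℂ} (G : GaudinData T ω) : Finset (OnePoint ℂ) :=
  insert OnePoint.infty (G.pts.image fun y => (y : OnePoint ℂ))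

/-- The map from the complexification of `ĝ^D` to `S_ℓ`. -/
def hatToLevel : HatC 𝔇 G →ₗ[ℂ] LevelAlg 𝔇 G :=
  (levelMk 𝔇 G).toLinearMap ∘ₗ SymmetricAlgebra.ι ℂ (HatC 𝔇 G)

/-- The level-fixing map `π_ℓ`: it sends `X ∈ ĝ^D_ℂ` to its class (so that `K^{(x)}_p ↦ ± i ℓ^x_p`)
and `D^{(x)}_r` to `quad 𝔇 G b x r`. -/
def piLevel : TakiffC 𝔇 G →ₗ[ℂ] LevelHat 𝔇 G :=
  (toHat 𝔇 G).toLinearMap ∘ₗ hatToLevel 𝔇 G ∘ₗ (takiffDropD 𝔇 G).baseChange ℂ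
    + LinearMap.liftBaseChange ℂ (∑ x ∈ G.markedPts, ∑ r ∈ G.exps x, piD 𝔇 G b x r)

end Completion

/-! ### Formal Fourier series, fields and Lax matrices -/

section Series

/-- Formal series with values in `g̃ ⊗ V`: the triple `(A, k, d)` stands for
`∑ m, A m t ^ m + K ⊗ k + D ⊗ d`. -/
abbrev AffSeries (g V : Type*) [LieRing g] [LieAlgebra ℂ g] [AddCommGroup V] [Module ℂ V] : Type _ :=
  (ℤ → g ⊗[ℂ] V) × V × V

/-- Formal connections on the circle with coefficients in `V`: the pair `(A, c)` stands for
`∂ ⊗ c + ∑ m, A m e_m`, where `e_m` is the function `θ ↦ exp (i m θ)`. -/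
abbrev ConnSeries (g V : Type*) [LieRing g] [LieAlgebra ℂ g] [AddCommGroup V] [Module ℂ V] :
    Type _ :=
  (ℤ → g ⊗[ℂ] V) × V

variable {V W : Type*} [AddCommGroup V] [Module ℂ V] [AddCommGroup W] [Module ℂ W]

/-- The map `ϱ ⊗ π`, where `ϱ` is the representation of `g̃` on connections,
`x_n ↦ x ⊗ e_n`, `K ↦ 0`, `D ↦ -i ∂`. -/
def rhoTensor (π : V →ₗ[ℂ] W) : AffSeries g V →ₗ[ℂ] ConnSeries g W :=
  LinearMap.prodMap ((π.lTensor g).compLeft ℤ) ((-Complex.I) • π ∘ₗ LinearMap.snd ℂ V V)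

variable (𝔇 : DihedralLie T g)

/-- The action of `σ` on the first tensor factor of a series of loops. -/
def seriesσ : Module.End ℂ (ℤ → g ⊗[ℂ] V) := (𝔇.σ.rTensor V).compLeft ℤ

/-- The action of `σ` on the first tensor factor of a series with values in `g̃ ⊗ V`. -/
def affSeriesσ : Module.End ℂ (AffSeries g V) := LinearMap.prodMap (seriesσ 𝔇) LinearMap.id

/-- Rational combinations of fields:
`(1/T) ∑ k x p, ω^{-k} s^k F^x_p / (ω^{-k} z - x)^{p+1} + ∑ p, F^0_p z^{-p-1} - ∑ q, F^∞_{q+1} z^q`,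
where `x` runs over the non-zero finite marked points and the conjugates of the complex ones. -/
def laxSum (G : GaudinData T 𝔇.ω) {M : Type*} [AddCommGroup M] [Module ℂ M] (s : Module.End ℂ M)
    (F : OnePoint ℂ → ℕ → M) (z : ℂ) : M :=
  (T : ℂ)⁻¹ • (∑ k ∈ Finset.range T, ∑ x ∈ G.allPts.erase 0,
      ∑ p ∈ Finset.range (G.mult (x : OnePoint ℂ)),
        ((𝔇.ω ^ k)⁻¹ / ((𝔇.ω ^ k)⁻¹ * z - x) ^ (p + 1)) • (s ^ k) (F (x : OnePoint ℂ) p))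
    + ∑ p ∈ Finset.range (G.mult ((0 : ℂ) : OnePoint ℂ)),
        (z ^ (p + 1))⁻¹ • F ((0 : ℂ) : OnePoint ℂ) p
    - ∑ q ∈ Finset.range (G.mult OnePoint.infty - 1), z ^ q • F OnePoint.infty (q + 1)

/-- The twist function. -/
def twist (G : GaudinData T 𝔇.ω) (z : ℂ) : ℂ := laxSum 𝔇 G 1 G.level z

end Series

section Lax

variable [NeZero T] (𝔇 : DihedralLie T g) (G : GaudinData T 𝔇.ω)
  {ι : Type*} [Fintype ι] [DecidableEq ι] (b : Module.Basis ι ℂ g)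

/-- The formal field `I_ã ⊗ I^{ã (x)}_p` at a marked point `x`, respectively
`τ I_ã ⊗ I^{ã (x)}_p` at the conjugate `x` of a complex marked point, where the dual bases of `g̃`
are `I^a_n, K, D` and `I_{a,-n}, D, K`. -/
def formalField (x : OnePoint ℂ) (p : ℕ) : AffSeries g (TakiffC 𝔇 G) :=
  if G.Marked x then
    (fun m => ∑ a, dualB 𝔇 b a ⊗ₜ symb 𝔇 G x p (Aff.loop (-m) (b a)),
      symb 𝔇 G x p Aff.D, symb 𝔇 G x p Aff.K)
  else
    (fun m => ∑ a, 𝔇.τ (dualB 𝔇 b a) ⊗ₜ symb 𝔇 G x p (Aff.loop m (b a)),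
      -symb 𝔇 G x p Aff.D, -symb 𝔇 G x p Aff.K)

/-- The formal Lax matrix. -/
def formalLax (z : ℂ) : AffSeries g (TakiffC 𝔇 G) :=
  laxSum 𝔇 G (affSeriesσ 𝔇) (formalField 𝔇 G b) z

/-- The `g`-valued classical field `A^x_p`, that is `∑ n, (I_a ⊗ e_{-n}) ⊗ I^{a (x)}_{n,p}` at a
marked point `x` and `∑ n, (I_a ⊗ e_n) ⊗ I^{a (x)}_{n,p}` at the conjugate of a complex one. -/
def classicalField (x : OnePoint ℂ) (p : ℕ) : ℤ → g ⊗[ℂ] LevelAlg 𝔇 G := fun m =>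
  ∑ a, dualB 𝔇 b a ⊗ₜ obs 𝔇 G x p (Aff.loop (if G.Marked x then -m else m) (b a))

/-- The Lax matrix `L(z)`: the rational combination of the classical fields divided by the twist
function. -/
def lax (z : ℂ) : ℤ → g ⊗[ℂ] LevelAlg 𝔇 G :=
  (twist 𝔇 G z)⁻¹ • laxSum 𝔇 G (seriesσ 𝔇) (classicalField 𝔇 G b) z

/-- The connection `∂ + L(z)` with coefficients in the completion of `S_ℓ`. -/
def laxConn (z : ℂ) : ConnSeries g (LevelHat 𝔇 G) :=
  (fun m => (toHat 𝔇 G).toLinearMap.lTensor g (lax 𝔇 G b z m), 1)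

/-- The projection of `g` to the eigenspace of `σ` for the eigenvalue `ω ^ j`. -/
def gradeProj (j : ℤ) : Module.End ℂ g :=
  (T : ℂ)⁻¹ • ∑ k ∈ Finset.range T, (𝔇.ω ^ (j * k))⁻¹ • 𝔇.σ ^ k

/-- The canonical element `C = I_a ⊗ I^a`. -/
def casimir : g ⊗[ℂ] g := ∑ a, dualB 𝔇 b a ⊗ₜ b a

/-- The component of `C` in the tensor product of the eigenspaces for `ω ^ (-j)` and `ω ^ j`. -/
def casimirGr (j : ℤ) : g ⊗[ℂ] g := (gradeProj 𝔇 j).lTensor g (casimir 𝔇 b)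

/-- The matrix `R⁰(z, z')`. -/
def Rzero (z z' : ℂ) : g ⊗[ℂ] g :=
  (z' ^ T - z ^ T)⁻¹ • ∑ k ∈ Finset.range T, (z ^ k * z' ^ (T - 1 - k)) • casimirGr 𝔇 b (-k)

/-- The matrix `R(z, z') = R⁰(z, z') φ(z')⁻¹`, which is `R_{12}(z, z')`. -/
def Rmat (z z' : ℂ) : g ⊗[ℂ] g := (twist 𝔇 G z')⁻¹ • Rzero 𝔇 b z z'

/-- The matrix `R_{21}(z', z)`: the element `R(z', z)` with its tensor factors exchanged. -/
def Rswap (z' z : ℂ) : g ⊗[ℂ] g := TensorProduct.comm ℂ g g (Rmat 𝔇 G b z' z)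

/-- The matrix `r(z, z')`, the skew-symmetric part of `R`. -/
def rmat (z z' : ℂ) : g ⊗[ℂ] g := (2 : ℂ)⁻¹ • (Rmat 𝔇 G b z z' - Rswap 𝔇 G b z' z)

/-- The matrix `s(z, z')`, the symmetric part of `R`. -/
def smat (z z' : ℂ) : g ⊗[ℂ] g := (2 : ℂ)⁻¹ • (Rmat 𝔇 G b z z' + Rswap 𝔇 G b z' z)

end Lax

section Brackets

variable {V : Type*} [AddCommGroup V] [Module ℂ V]

/-- The bilinear map `(x ⊗ y, u) ↦ [x, u] ⊗ y`. -/
def brk₁ : g ⊗[ℂ] g →ₗ[ℂ] g →ₗ[ℂ] g ⊗[ℂ] g :=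
  (LinearMap.rTensorHom g ∘ₗ (LieModule.toEnd ℂ g g : g →ₗ[ℂ] Module.End ℂ g).flip).flip

/-- The bilinear map `(x ⊗ y, u) ↦ x ⊗ [y, u]`. -/
def brk₂ : g ⊗[ℂ] g →ₗ[ℂ] g →ₗ[ℂ] g ⊗[ℂ] g :=
  (LinearMap.lTensorHom g ∘ₗ (LieModule.toEnd ℂ g g : g →ₗ[ℂ] Module.End ℂ g).flip).flip

/-- The coefficients of `[X_{12}, A_1]`: `[x ⊗ y, u ⊗ v] = [x, u] ⊗ y ⊗ v`. -/
def comm₁ (X : g ⊗[ℂ] g) (A : ℤ → g ⊗[ℂ] V) : ℤ → (g ⊗[ℂ] g) ⊗[ℂ] V := fun m =>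
  (brk₁ X).rTensor V (A m)

/-- The coefficients of `[X_{12}, A_2]`: `[x ⊗ y, u ⊗ v] = x ⊗ [y, u] ⊗ v`. -/
def comm₂ (X : g ⊗[ℂ] g) (A : ℤ → g ⊗[ℂ] V) : ℤ → (g ⊗[ℂ] g) ⊗[ℂ] V := fun m =>
  (brk₂ X).rTensor V (A m)

/-- The coefficients of `{A_1(θ), B_2(θ')}`: `{x ⊗ u, y ⊗ v} = x ⊗ y ⊗ {u, v}`. -/
def fieldBracket (β : V →ₗ[ℂ] V →ₗ[ℂ] V) (A B : ℤ → g ⊗[ℂ] V) :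
    ℤ → ℤ → (g ⊗[ℂ] g) ⊗[ℂ] V := fun m n =>
  (TensorProduct.lift β).lTensor (g ⊗[ℂ] g)
    (TensorProduct.tensorTensorTensorComm ℂ g V g V (A m ⊗ₜ B n))

/-- The Fourier coefficients of `δ(θ, θ') = ∑ n, e_n(θ) e_{-n}(θ')`. -/
def dirac (m n : ℤ) : ℂ := if m + n = 0 then 1 else 0

/-- The Fourier coefficients of `δ'(θ, θ') = ∑ n, i n e_n(θ) e_{-n}(θ')`. -/
def diracDeriv (m n : ℤ) : ℂ := if m + n = 0 then Complex.I * m else 0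

variable {M : Type*} [AddCommGroup M] [Module ℂ M]

/-- The Fourier coefficients of the product `A(θ) κ(θ, θ')`. -/
def distMul₁ (A : ℤ → M) (κ : ℤ → ℤ → ℂ) : ℤ → ℤ → M := fun m n => ∑ᶠ k, κ (m - k) n • A k

/-- The Fourier coefficients of the product `A(θ') κ(θ, θ')`. -/
def distMul₂ (A : ℤ → M) (κ : ℤ → ℤ → ℂ) : ℤ → ℤ → M := fun m n => ∑ᶠ k, κ m (n - k) • A k

/-- The Fourier coefficients of `X κ(θ, θ')` for a constant `X`. -/
def distConst (X : M) (κ : ℤ → ℤ → ℂ) : ℤ → ℤ → M := fun m n => κ m n • X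

end Brackets

end AffineGaudin

end

noncomputable section

namespace AffineGaudin

open scoped Classical

set_option linter.unusedSectionVars false

variable {T : ℕ} [NeZero T] {g : Type*} [LieRing g] [LieAlgebra ℂ g]

/-! ### Averages over stabilisers -/

/-! Up to the factor φ(z), the Lax matrix is the generating series of the linear observables.
Dualising its factor in g turns it into one linear map Λ_z = `laxObs 𝔇 G z` from the affine algebra
to S_ℓ. This map is a sum over points x, exponents p and rotations k of the maps X ↦ (1/T) ζ_k
c_p(ζ_k z) (σ^k X)^{(x)}_p, where ζ_k = ω^k and c_p is the Cauchy kernel (u - x)^{-p-1}, replaced by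
-u^{p-1} at infinity; at the conjugate of a complex point, τ is inserted to keep it linear. The
coefficient of e_m in φ(z) L(z) is ∑ I_a ⊗ Λ_z(I^a_{-m}), so the bracket relation is a statement
about {Λ_z X, Λ_{z'} Y}.

Three facts compute this bracket. Observables at different points Poisson commute, a complex point
and its conjugate counting as different (`levelBracket_obsLin_ne`). At one point {X_p, Y_q} = [X,
π_q Y]_{p+q}, with π_q the average over the rotations fixing the point; the reflections are
antilinear and cancel in the complexification (`levelBracket_obsLin`). Finally, the sum of c_p(u)
c_q(v) over p + q = r is (c_r(u) - c_r(v)) / (v - u) (`sum_cauchyKer`). The factor 1 / (v - u) does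
not depend on the point, so for u = ζ_k z and v = ζ_j z' the sums over points and exponents rebuild
the generating function: {Λ_z X, Λ_{z'} Y} = Λ_z [X, R Y] + Λ_{z'} [R' X, Y], where R = (1/T) ∑ ζ_l
(ζ_l z' - z)⁻¹ σ^l and R' is R with z and z' exchanged (`levelBracket_laxObs`).

Since Λ_z K = i φ(z) (`laxObs_K`), the cocycle of the affine algebra produces the δ' term with the
twist function as coefficient. A discrete Fourier transform over the rotations identifies R with the
matrix R⁰ (`sum_gradeProj`, `Rzero_eq`), invariance of the form turns brackets of arguments into
commutators with matrices (`brk₁_gen`, `brk₂_gen`), and division by φ(z) φ(z') leaves R⁰ weighted by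
one inverse twist function in every term (`fieldBracket_lax`).

For the level-fixing map, ϱ kills the component K ⊗ D^{(x)}, so the quadratic images of the D^{(x)}
never enter; D ⊗ K^{(x)} goes to -i∂ ⊗ iℓ, up to two cancelling signs at conjugate points, and the
levels add up to φ. The zeros of φ are finite in number because φ is rational and not identically
zero: it has a true pole at every finite marked point, and if there are none it is a non-zero
polynomial. -/

lemma sum_dihedralGroup {M : Type*} [AddCommMonoid M] (f : DihedralGroup T → M) :
    ∑ α, f α = ∑ k : ZMod T, f (.r k) + ∑ k : ZMod T, f (.sr k) := by
  rw [← Fintype.sum_sumElim]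
  refine Fintype.sum_equiv
    ⟨fun | .r k => .inl k | .sr k => .inr k, fun | .inl k => .r k | .inr k => .sr k, ?_, ?_⟩ _ _ ?_
  all_goals rintro (k | k) <;> rfl

section Average

variable (𝔇 : DihedralLie T g)

/-- The average of `X ⊗ ε_x ^ p` over the rotations in the stabiliser of `x`. -/
def rotAverage (x : OnePoint ℂ) (p : ℕ) : Module.End ℂ (Aff g) :=
  (((Finset.univ.filter fun k : ZMod T => mobius 𝔇.ω (.r k) x = x).card : ℂ)⁻¹) •
    ∑ k ∈ Finset.univ.filter (fun k : ZMod T => mobius 𝔇.ω (.r k) x = x),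
      𝔇.phase x p k • 𝔇.affσ ^ k.val

lemma slotAct_I_smul_r (x : OnePoint ℂ) (p : ℕ) (k : ZMod T) (X : Aff g) :
    𝔇.slotAct x p (.r k) (Complex.I • X) = Complex.I • 𝔇.slotAct x p (.r k) X := by
  simp only [DihedralLie.slotAct, map_smul]
  exact smul_comm _ _ _

lemma slotAct_I_smul_sr (x : OnePoint ℂ) (p : ℕ) (k : ZMod T) (X : Aff g) :
    𝔇.slotAct x p (.sr k) (Complex.I • X) = -(Complex.I • 𝔇.slotAct x p (.sr k) X) := by
  simp only [DihedralLie.slotAct, map_smul]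
  rw [smul_comm, LinearMap.map_smulₛₗ]
  simp

lemma slotAverage_apply (x : OnePoint ℂ) (p : ℕ) (X : Aff g) :
    slotAverage 𝔇 x p X = ((2 * (Finset.univ.filter fun k : ZMod T =>
      mobius 𝔇.ω (DihedralGroup.r k) x = x).card : ℂ)⁻¹) •
      (∑ k ∈ Finset.univ.filter (fun k : ZMod T => mobius 𝔇.ω (.r k) x = x),
        𝔇.slotAct x p (.r k) X +
      ∑ k ∈ Finset.univ.filter (fun k : ZMod T => mobius 𝔇.ω (.sr k) x = x),
        𝔇.slotAct x p (.sr k) X) := by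
  simp only [slotAverage, LinearMap.smul_apply, LinearMap.sum_apply]
  rw [← Complex.coe_smul]
  congr 1
  · push_cast; rfl
  · simp only [Finset.sum_filter, sum_dihedralGroup]
    rfl

/-- Rotations commute with multiplication by i and reflections anticommute with it. In the
difference the reflections cancel and the rotations are doubled, which the 2 in the normalisation of
P compensates. For this reason brackets of the X^{(x)}_p see only the cyclic part of the stabiliser.
-/
lemma slotAverage_sub (x : OnePoint ℂ) (p : ℕ) (X : Aff g) :
    slotAverage 𝔇 x p X - Complex.I • slotAverage 𝔇 x p (Complex.I • X) = rotAverage 𝔇 x p X := by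
  simp only [slotAverage_apply, slotAct_I_smul_r, slotAct_I_smul_sr, Finset.sum_neg_distrib,
    ← Finset.smul_sum]
  rw [smul_comm Complex.I, ← smul_sub, rotAverage, LinearMap.smul_apply, LinearMap.sum_apply,
    smul_add, smul_neg, smul_smul, smul_smul, Complex.I_mul_I, mul_inv, mul_comm, mul_smul]
  congr 1
  simp only [neg_smul, one_smul, neg_neg]
  rw [sub_eq_add_neg, neg_add, neg_neg, add_add_add_comm, add_neg_cancel, add_zero, ← two_smul ℂ,
    smul_smul, inv_mul_cancel₀ two_ne_zero, one_smul]
  rfl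

lemma slotAverage_complex {x : OnePoint ℂ} (hx : IsComplexPt T 𝔇.ω x) (p : ℕ) (X : Aff g) :
    slotAverage 𝔇 x p X = (2 : ℂ)⁻¹ • X := by
  have h1 : Finset.univ.filter (fun k : ZMod T => mobius 𝔇.ω (.r k) x = x) = {0} := by
    ext k
    simp only [Finset.mem_filter, Finset.mem_univ, true_and, Finset.mem_singleton]
    refine ⟨fun h => ?_, fun h => ?_⟩
    · have := hx _ h
      rw [DihedralGroup.one_def] at this
      exact DihedralGroup.r.inj this
    · rw [h]; exact mobius_one x
  have h2 : Finset.univ.filter (fun k : ZMod T => mobius 𝔇.ω (.sr k) x = x) = ∅ := by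
    refine Finset.filter_eq_empty_iff.2 fun k _ h => ?_
    have := hx _ h
    rw [DihedralGroup.one_def] at this
    cases this
  rw [slotAverage_apply, h1, h2]
  simp [DihedralLie.slotAct, DihedralLie.phase]

/-- Right translation by `α` permutes the stabiliser; this complements the left invariance
`slotAct_slotAverage`. -/
lemma slotAverage_slotAct {x : OnePoint ℂ} {α : DihedralGroup T} (h : mobius 𝔇.ω α x = x)
    (p : ℕ) (X : Aff g) : slotAverage 𝔇 x p (𝔇.slotAct x p α X) = slotAverage 𝔇 x p X := by
  simp only [slotAverage, LinearMap.smul_apply, LinearMap.sum_apply]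
  congr 1
  simp only [Finset.sum_filter]
  refine Fintype.sum_equiv (Equiv.mulRight α) _ _ fun β => ?_
  simp only [Equiv.coe_mulRight, mobius_mul 𝔇.ω_prim.pow_eq_one, h]
  split_ifs
  · exact (𝔇.slotAct_mul x p β α X).symm
  · rfl

/-- Every α in the stabiliser fixes P Y, so [α X, P Y] = α [X, P Y], and summing over α gives the
identity. Idempotency of P is not involved; indeed P is half the identity at complex points. -/
lemma affBracket_slotAverage (x : OnePoint ℂ) (p q : ℕ) (X Y : Aff g) :
    𝔇.affBracket (slotAverage 𝔇 x p X) (slotAverage 𝔇 x q Y)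
      = slotAverage 𝔇 x (p + q) (𝔇.affBracket X (slotAverage 𝔇 x q Y)) := by
  conv_lhs => rw [slotAverage]
  conv_rhs => rw [slotAverage]
  simp only [LinearMap.smul_apply, LinearMap.sum_apply]
  rw [← Complex.coe_smul, ← Complex.coe_smul, map_smul, LinearMap.smul_apply, map_sum,
    LinearMap.sum_apply]
  congr 1
  refine Finset.sum_congr rfl fun α hα => ?_
  change 𝔇.affBracket (𝔇.slotAct x p α X) _ = 𝔇.slotAct x (p + q) α _
  rw [𝔇.slotAct_affBracket, slotAct_slotAverage 𝔇 (Finset.mem_filter.1 hα).2]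

lemma rotAverage_coe {x : ℂ} (hx : x ≠ 0) (p : ℕ) : rotAverage 𝔇 (x : OnePoint ℂ) p = 1 := by
  have h1 : Finset.univ.filter (fun k : ZMod T => mobius 𝔇.ω (.r k) (x : OnePoint ℂ) = x)
      = {0} := by
    ext k
    simp only [Finset.mem_filter, Finset.mem_univ, true_and, Finset.mem_singleton, mobius,
      OnePoint.map_some, OnePoint.coe_eq_coe, mul_eq_right₀ hx]
    refine ⟨fun h => ?_, fun h => by simp [h]⟩
    by_contra hk
    exact 𝔇.ω_prim.pow_ne_one_of_pos_of_lt ((ZMod.val_ne_zero k).2 hk) (ZMod.val_lt k) h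
  rw [rotAverage, h1]
  simp [DihedralLie.phase]

lemma rotAverage_fixed {x : OnePoint ℂ} (hx : ∀ k : ZMod T, mobius 𝔇.ω (.r k) x = x) (p : ℕ) :
    rotAverage 𝔇 x p = (T : ℂ)⁻¹ • ∑ k : ZMod T, 𝔇.phase x p k • 𝔇.affσ ^ k.val := by
  rw [rotAverage]
  simp [hx, ZMod.card]

end Average

/-! ### Brackets of the elements X^{(x)}_p in the complexified algebra -/

section Symb

variable (𝔇 : DihedralLie T g) (G : GaudinData T 𝔇.ω)

/-- The marked point at which `X^{(x)}_p` lives: `x` itself if it is marked, else its conjugate. -/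
def basePt (x : OnePoint ℂ) : OnePoint ℂ := if G.Marked x then x else x.map conj

/-- With the sign ε_x the two cases of the definition merge, and one computation serves marked
points and conjugates alike. -/
lemma symb_eq (x : OnePoint ℂ) (p : ℕ) (X : Aff g) :
    symb 𝔇 G x p X = (1 : ℂ) ⊗ₜ single 𝔇 G (basePt 𝔇 G x) p X
      - (G.sign x * Complex.I) ⊗ₜ single 𝔇 G (basePt 𝔇 G x) p (Complex.I • X) := by
  unfold symb basePt GaudinData.sign
  split_ifs
  · rw [one_mul]
  · rw [neg_mul, one_mul, TensorProduct.neg_tmul, sub_neg_eq_add]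

lemma single_apply (x y : OnePoint ℂ) (p q : ℕ) (X : Aff g) :
    (single 𝔇 G x p X).1 y q = if (y = x ∧ q = p) ∧ G.Marked x ∧ p ∈ G.exps x then
      slotAverage 𝔇 x p X else 0 := rfl

lemma coefD_slotAverage (x : OnePoint ℂ) (p : ℕ) {X : Aff g} (h : X.coefD = 0) :
    (slotAverage 𝔇 x p X).coefD = 0 := by
  rw [slotAverage_apply, map_smul, map_add, map_sum, map_sum]
  simp [𝔇.coefD_slotAct h]

lemma dropD_of_coefD {X : Aff g} (h : X.coefD = 0) : DihedralLie.dropD X = X :=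
  Prod.ext rfl (Prod.ext rfl h.symm)

lemma takiffDropD_single (x y : OnePoint ℂ) (p q : ℕ) {X : Aff g} (h : X.coefD = 0) :
    (takiffDropD 𝔇 G (single 𝔇 G x p X)).1 y q = (single 𝔇 G x p X).1 y q := by
  change DihedralLie.dropD _ = _
  rw [single_apply]
  split_ifs
  · exact dropD_of_coefD (coefD_slotAverage 𝔇 x p h)
  · exact map_zero _

/-- Both sides live in the single slot (x, p + q). If p + q is not an exponent at x, the truncation
of the polynomials makes both of them vanish. -/
lemma hatBracket_single {x : OnePoint ℂ} {p q : ℕ} (hx : G.Marked x)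
    (hp : p ∈ G.exps x) (hq : q ∈ G.exps x) {X Y : Aff g} (hX : X.coefD = 0) (hY : Y.coefD = 0) :
    hatBracket 𝔇 G (takiffDropD 𝔇 G (single 𝔇 G x p X)) (takiffDropD 𝔇 G (single 𝔇 G x q Y))
      = takiffDropD 𝔇 G (single 𝔇 G x (p + q) (𝔇.affBracket X (slotAverage 𝔇 x q Y))) := by
  refine Subtype.ext (funext fun y => funext fun r => ?_)
  rw [takiffDropD_single 𝔇 G _ _ _ _ rfl]
  change slotBracket 𝔇 G _ _ y r = _
  unfold slotBracket
  simp only [takiffDropD_single 𝔇 G _ _ _ _ hX, takiffDropD_single 𝔇 G _ _ _ _ hY, single_apply,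
    hx, hp, hq, and_self, and_true, true_and]
  by_cases hy : y = x
  · subst hy
    simp only [true_and, hx]
    by_cases hr : r = p + q
    · subst hr
      simp only [true_and]
      split_ifs with h
      · rw [Finset.sum_eq_single (p, q)]
        · simp [affBracket_slotAverage]
        · rintro ⟨a, c⟩ h1 h2
          by_cases ha : a = p
          · have hc : c ≠ q := fun hc => h2 (by rw [ha, hc])
            simp [hc]
          · simp [ha]
        · intro h1
          simp at h1
      · rfl
    · rw [if_neg (c := r = p + q ∧ _) (fun h => hr h.1)]
      split_ifs with h
      · refine Finset.sum_eq_zero ?_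
        rintro ⟨a, c⟩ h1
        have h1 := Finset.HasAntidiagonal.mem_antidiagonal.1 h1
        dsimp only at h1 ⊢
        by_cases ha : a = p
        · have hc : c ≠ q := by rintro rfl; exact hr (by omega)
          simp [hc]
        · simp [ha]
      · rfl
  · simp [hy]

lemma hatBracket_single_ne {x y : OnePoint ℂ} (hxy : x ≠ y) (p q : ℕ) {X Y : Aff g}
    (hX : X.coefD = 0) (hY : Y.coefD = 0) :
    hatBracket 𝔇 G (takiffDropD 𝔇 G (single 𝔇 G x p X)) (takiffDropD 𝔇 G (single 𝔇 G y q Y))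
      = 0 := by
  refine Subtype.ext (funext fun w => funext fun r => ?_)
  change slotBracket 𝔇 G _ _ w r = 0
  unfold slotBracket
  split_ifs
  · refine Finset.sum_eq_zero fun pq _ => ?_
    rw [takiffDropD_single 𝔇 G _ _ _ _ hX, takiffDropD_single 𝔇 G _ _ _ _ hY, single_apply,
      single_apply]
    by_cases hw : w = x
    · rw [if_neg (c := (w = y ∧ _) ∧ _) (fun h => hxy (hw.symm.trans h.1.1)), map_zero]
    · rw [if_neg (fun h => hw h.1.1), map_zero, LinearMap.zero_apply]
  · rfl

lemma symbHat_eq (x : OnePoint ℂ) (p : ℕ) (X : Aff g) :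
    symbHat 𝔇 G x p X = (1 : ℂ) ⊗ₜ takiffDropD 𝔇 G (single 𝔇 G (basePt 𝔇 G x) p X)
      - (G.sign x * Complex.I) ⊗ₜ
        takiffDropD 𝔇 G (single 𝔇 G (basePt 𝔇 G x) p (Complex.I • X)) := by
  rw [symbHat, symb_eq, map_sub, LinearMap.baseChange_tmul, LinearMap.baseChange_tmul]

lemma sign_mul_self (x : OnePoint ℂ) : G.sign x * G.sign x = 1 := by
  unfold GaudinData.sign; split_ifs <;> norm_num

lemma coefD_I_smul {X : Aff g} (h : X.coefD = 0) : (Complex.I • X).coefD = 0 := by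
  rw [map_smul, h, smul_zero]

lemma hatBracketC_symbHat_ne {x y : OnePoint ℂ} (hxy : basePt 𝔇 G x ≠ basePt 𝔇 G y) (p q : ℕ)
    {X Y : Aff g} (hX : X.coefD = 0) (hY : Y.coefD = 0) :
    hatBracketC 𝔇 G (symbHat 𝔇 G x p X) (symbHat 𝔇 G y q Y) = 0 := by
  simp only [symbHat_eq, map_sub, LinearMap.sub_apply, hatBracketC_tmul,
    hatBracket_single_ne 𝔇 G hxy p q hX hY,
    hatBracket_single_ne 𝔇 G hxy p q hX (coefD_I_smul hY),
    hatBracket_single_ne 𝔇 G hxy p q (coefD_I_smul hX) hY,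
    hatBracket_single_ne 𝔇 G hxy p q (coefD_I_smul hX) (coefD_I_smul hY), TensorProduct.tmul_zero,
    sub_zero]

/-- Expanding gives four brackets, which (ε_x i)² = -1 groups in pairs. In the second argument this
produces the combination P Y - i P(i Y), the rotation average by `slotAverage_sub`. -/
lemma hatBracketC_symbHat {x : OnePoint ℂ} {p q : ℕ} (hx : G.Marked (basePt 𝔇 G x))
    (hp : p ∈ G.exps (basePt 𝔇 G x)) (hq : q ∈ G.exps (basePt 𝔇 G x)) {X Y : Aff g}
    (hX : X.coefD = 0) (hY : Y.coefD = 0) :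
    hatBracketC 𝔇 G (symbHat 𝔇 G x p X) (symbHat 𝔇 G x q Y)
      = symbHat 𝔇 G x (p + q) (𝔇.affBracket X (rotAverage 𝔇 (basePt 𝔇 G x) q Y)) := by
  have hs : G.sign x * Complex.I * (G.sign x * Complex.I) = -1 := by
    rw [mul_mul_mul_comm, sign_mul_self, Complex.I_mul_I, one_mul]
  simp only [symbHat_eq, map_sub, LinearMap.sub_apply, hatBracketC_tmul,
    hatBracket_single 𝔇 G hx hp hq hX hY,
    hatBracket_single 𝔇 G hx hp hq hX (coefD_I_smul hY),
    hatBracket_single 𝔇 G hx hp hq (coefD_I_smul hX) hY,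
    hatBracket_single 𝔇 G hx hp hq (coefD_I_smul hX) (coefD_I_smul hY), hs, one_mul, mul_one,
    ← slotAverage_sub, smul_sub, smul_smul, Complex.I_mul_I, map_smul, LinearMap.smul_apply,
    TensorProduct.tmul_sub, TensorProduct.neg_tmul, neg_smul, one_smul, map_neg,
    TensorProduct.tmul_neg]
  abel

/-- At a complex point P is scalar. The complexification of a complex Lie algebra regarded as real
splits into two commuting ideals, where the two multiplications by i agree or are opposite. The two
arguments lie in different ideals. -/
lemma hatBracketC_symbHat_conj {x y : OnePoint ℂ} {p q : ℕ} (hxy : basePt 𝔇 G x = basePt 𝔇 G y)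
    (hs : G.sign x = -G.sign y) (hx : G.Marked (basePt 𝔇 G y))
    (hc : IsComplexPt T 𝔇.ω (basePt 𝔇 G y))
    (hp : p ∈ G.exps (basePt 𝔇 G y)) (hq : q ∈ G.exps (basePt 𝔇 G y)) {X Y : Aff g}
    (hX : X.coefD = 0) (hY : Y.coefD = 0) :
    hatBracketC 𝔇 G (symbHat 𝔇 G x p X) (symbHat 𝔇 G y q Y) = 0 := by
  have hs' : G.sign y * Complex.I * (G.sign y * Complex.I) = -1 := by
    rw [mul_mul_mul_comm, sign_mul_self, Complex.I_mul_I, one_mul]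
  simp only [symbHat_eq, hxy, hs, map_sub, LinearMap.sub_apply, hatBracketC_tmul,
    hatBracket_single 𝔇 G hx hp hq hX hY,
    hatBracket_single 𝔇 G hx hp hq hX (coefD_I_smul hY),
    hatBracket_single 𝔇 G hx hp hq (coefD_I_smul hX) hY,
    hatBracket_single 𝔇 G hx hp hq (coefD_I_smul hX) (coefD_I_smul hY), one_mul, mul_one,
    slotAverage_complex 𝔇 hc, map_smul, LinearMap.smul_apply]
  simp only [neg_mul, hs', neg_neg, TensorProduct.neg_tmul]
  have h : ((2 : ℂ)⁻¹ • Complex.I • Complex.I • 𝔇.affBracket X Y)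
      = -((2 : ℂ)⁻¹ • 𝔇.affBracket X Y) := by
    rw [smul_smul Complex.I, Complex.I_mul_I, neg_smul, one_smul, smul_neg]
  rw [h, map_neg, map_neg, TensorProduct.tmul_neg]
  abel

end Symb

/-! ### Linear observables -/

section Obs

variable (𝔇 : DihedralLie T g) (G : GaudinData T 𝔇.ω)

lemma symb_add (x : OnePoint ℂ) (p : ℕ) (X Y : Aff g) :
    symb 𝔇 G x p (X + Y) = symb 𝔇 G x p X + symb 𝔇 G x p Y := by
  simp only [symb_eq, smul_add, map_add, TensorProduct.tmul_add]
  abel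

lemma symb_real_smul (x : OnePoint ℂ) (p : ℕ) (c : ℝ) (X : Aff g) :
    symb 𝔇 G x p ((c : ℂ) • X) = (c : ℂ) • symb 𝔇 G x p X := by
  rw [symb_eq, symb_eq, smul_comm Complex.I, Complex.coe_smul, Complex.coe_smul, map_smul,
    map_smul, Complex.coe_smul, TensorProduct.tmul_smul, TensorProduct.tmul_smul]
  exact (smul_sub _ _ _).symm

lemma symb_I_smul (x : OnePoint ℂ) (p : ℕ) (X : Aff g) :
    symb 𝔇 G x p (Complex.I • X) = (G.sign x * Complex.I) • symb 𝔇 G x p X := by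
  have hs : G.sign x * Complex.I * (G.sign x * Complex.I) = -1 := by
    rw [mul_mul_mul_comm, sign_mul_self, Complex.I_mul_I, one_mul]
  rw [symb_eq, symb_eq, smul_smul, Complex.I_mul_I, neg_smul, one_smul, map_neg, smul_sub,
    TensorProduct.smul_tmul', TensorProduct.smul_tmul', smul_eq_mul, smul_eq_mul, mul_one, hs,
    TensorProduct.tmul_neg, TensorProduct.neg_tmul]
  abel

lemma obs_add (x : OnePoint ℂ) (p : ℕ) (X Y : Aff g) :
    obs 𝔇 G x p (X + Y) = obs 𝔇 G x p X + obs 𝔇 G x p Y := by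
  simp only [obs, symbHat, symb_add, map_add]

lemma obs_smul (x : OnePoint ℂ) (p : ℕ) (c : ℂ) (X : Aff g) :
    obs 𝔇 G x p (c • X) = ((c.re : ℂ) + c.im * (G.sign x * Complex.I)) • obs 𝔇 G x p X := by
  conv_lhs => rw [← Complex.re_add_im c]
  simp only [obs, symbHat, add_smul, mul_smul (c.im : ℂ), symb_add, symb_real_smul, symb_I_smul,
    map_add, map_smul]

lemma obs_smul_marked {x : OnePoint ℂ} (hx : G.Marked x) (p : ℕ) (c : ℂ) (X : Aff g) :
    obs 𝔇 G x p (c • X) = c • obs 𝔇 G x p X := by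
  rw [obs_smul, GaudinData.sign, if_pos hx, one_mul, Complex.re_add_im]

lemma obs_smul_not_marked {x : OnePoint ℂ} (hx : ¬ G.Marked x) (p : ℕ) (c : ℂ) (X : Aff g) :
    obs 𝔇 G x p (c • X) = conj c • obs 𝔇 G x p X := by
  rw [obs_smul, GaudinData.sign, if_neg hx]
  congr 1
  apply Complex.ext <;> simp

/-- The complex-linear map `X ↦ X^{(x)}_p` at a marked point and `X ↦ (τ X)^{(x)}_p` at the
conjugate of a complex marked point. -/
def obsLin (x : OnePoint ℂ) (p : ℕ) : Aff g →ₗ[ℂ] LevelAlg 𝔇 G where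
  toFun X := obs 𝔇 G x p (if G.Marked x then X else 𝔇.affτ X)
  map_add' X Y := by split_ifs <;> simp [obs_add]
  map_smul' c X := by
    split_ifs with h
    · exact obs_smul_marked 𝔇 G h p c X
    · rw [LinearMap.map_smulₛₗ, obs_smul_not_marked 𝔇 G h, Complex.conj_conj, RingHom.id_apply]

lemma obsLin_apply (x : OnePoint ℂ) (p : ℕ) (X : Aff g) :
    obsLin 𝔇 G x p X = obs 𝔇 G x p (if G.Marked x then X else 𝔇.affτ X) := rfl

variable {𝔇 G}

lemma basePt_of_marked {x : OnePoint ℂ} (hx : G.Marked x) : basePt 𝔇 G x = x := if_pos hx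

lemma exists_of_not_marked {x : OnePoint ℂ} (hx : G.AllMarked x) (h : ¬ G.Marked x) :
    ∃ y ∈ G.zc, x = ((conj y : ℂ) : OnePoint ℂ) ∧ basePt 𝔇 G x = (y : OnePoint ℂ) := by
  rcases hx with rfl | ⟨y, hy, rfl⟩
  · exact absurd (Or.inl rfl) h
  · rcases Finset.mem_union.1 hy with hy | hy
    · exact absurd (Or.inr ⟨y, hy, rfl⟩) h
    · obtain ⟨w, hw, rfl⟩ := Finset.mem_image.1 hy
      exact ⟨w, hw, rfl, by rw [basePt, if_neg h, OnePoint.map_some, Complex.conj_conj]⟩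

lemma marked_basePt {x : OnePoint ℂ} (hx : G.AllMarked x) : G.Marked (basePt 𝔇 G x) := by
  by_cases h : G.Marked x
  · rwa [basePt_of_marked h]
  · obtain ⟨y, hy, -, h2⟩ := exists_of_not_marked hx h
    rw [h2]
    exact Or.inr ⟨y, (Finset.mem_filter.1 hy).1, rfl⟩

lemma mult_conj (x : OnePoint ℂ) : G.mult (x.map conj) = G.mult x := by
  have h := G.mult_mobius (.sr 0) x
  simpa [mobius] using h

lemma map_conj_eq_infty {x : OnePoint ℂ} : x.map conj = OnePoint.infty ↔ x = OnePoint.infty := by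
  induction x using OnePoint.rec with
  | infty => simp
  | coe z => simp

lemma exps_basePt (x : OnePoint ℂ) : G.exps (basePt 𝔇 G x) = G.exps x := by
  unfold basePt
  split_ifs
  · rfl
  · simp only [GaudinData.exps, mult_conj, map_conj_eq_infty]

lemma isComplexPt_basePt {x : OnePoint ℂ} (hx : G.AllMarked x) (h : ¬ G.Marked x) :
    IsComplexPt T 𝔇.ω (basePt 𝔇 G x) := by
  obtain ⟨y, hy, -, h2⟩ := exists_of_not_marked (𝔇 := 𝔇) hx h
  rw [h2]
  exact (Finset.mem_filter.1 hy).2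

lemma IsComplexPt.ne_zero {y : ℂ} (h : IsComplexPt T 𝔇.ω (y : OnePoint ℂ)) : y ≠ 0 := by
  rintro rfl
  have := h (.sr 0) (by simp [mobius])
  rw [DihedralGroup.one_def] at this
  cases this

lemma rotAverage_basePt {x : OnePoint ℂ} (hx : G.AllMarked x) (q : ℕ) :
    rotAverage 𝔇 (basePt 𝔇 G x) q = rotAverage 𝔇 x q := by
  by_cases h : G.Marked x
  · rw [basePt_of_marked h]
  · obtain ⟨y, hy, h1, h2⟩ := exists_of_not_marked (𝔇 := 𝔇) hx h
    have hy0 : y ≠ 0 := (Finset.mem_filter.1 hy).2.ne_zero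
    rw [h2, h1, rotAverage_coe 𝔇 hy0, rotAverage_coe 𝔇 (by simpa using hy0)]

lemma rotAverage_of_not_marked {x : OnePoint ℂ} (hx : G.AllMarked x) (h : ¬ G.Marked x) (q : ℕ) :
    rotAverage 𝔇 x q = 1 := by
  obtain ⟨y, hy, h1, -⟩ := exists_of_not_marked (𝔇 := 𝔇) hx h
  have hy0 : y ≠ 0 := (Finset.mem_filter.1 hy).2.ne_zero
  rw [h1, rotAverage_coe 𝔇 (by simpa using hy0)]

variable (𝔇 G)

lemma levelBracket_obs (x y : OnePoint ℂ) (p q : ℕ) (X Y : Aff g) :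
    levelBracket 𝔇 G (obs 𝔇 G x p X) (obs 𝔇 G y q Y) = levelMk 𝔇 G (SymmetricAlgebra.ι ℂ (HatC 𝔇 G)
      (hatBracketC 𝔇 G (symbHat 𝔇 G x p X) (symbHat 𝔇 G y q Y))) := by
  rw [obs, obs, levelBracket_mk, hatPoisson, poisson_ι_ι]

lemma coefD_affτ {X : Aff g} (h : X.coefD = 0) : (𝔇.affτ X).coefD = 0 := by
  change -conj X.coefD = 0
  rw [h, map_zero, neg_zero]

/-- At a conjugate point the rotation average is trivial and τ is an automorphism of the affine
bracket, so the τ built into `obsLin` passes through and the formula is the same as at a marked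
point. Beyond this lemma, `obsLin_K` and `levelBracket_obsLin_ne`, the generating function treats
both kinds of points alike. -/
lemma levelBracket_obsLin {x : OnePoint ℂ} (hx : G.AllMarked x) {p q : ℕ} (hp : p ∈ G.exps x)
    (hq : q ∈ G.exps x) {X Y : Aff g} (hX : X.coefD = 0) (hY : Y.coefD = 0) :
    levelBracket 𝔇 G (obsLin 𝔇 G x p X) (obsLin 𝔇 G x q Y)
      = obsLin 𝔇 G x (p + q) (𝔇.affBracket X (rotAverage 𝔇 x q Y)) := by
  rw [← exps_basePt (𝔇 := 𝔇)] at hp hq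
  simp only [obsLin_apply, levelBracket_obs]
  by_cases h : G.Marked x
  · simp only [if_pos h]
    rw [hatBracketC_symbHat 𝔇 G (marked_basePt hx) hp hq hX hY, rotAverage_basePt hx]
    rfl
  · simp only [if_neg h]
    rw [hatBracketC_symbHat 𝔇 G (marked_basePt hx) hp hq (coefD_affτ 𝔇 hX) (coefD_affτ 𝔇 hY),
      rotAverage_basePt hx, rotAverage_of_not_marked hx h, Module.End.one_apply,
      Module.End.one_apply, 𝔇.affτ_affBracket]
    rfl

/-- Different points either lie over different marked points, hence in different direct summands, or
are a complex marked point and its conjugate, where the two ideals of the complexification commute.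
-/
lemma levelBracket_obsLin_ne {x y : OnePoint ℂ} (hx : G.AllMarked x) (hy : G.AllMarked y)
    (hxy : x ≠ y) {p q : ℕ} (hp : p ∈ G.exps x) (hq : q ∈ G.exps y) {X Y : Aff g}
    (hX : X.coefD = 0) (hY : Y.coefD = 0) :
    levelBracket 𝔇 G (obsLin 𝔇 G x p X) (obsLin 𝔇 G y q Y) = 0 := by
  have key : ∀ X Y : Aff g, X.coefD = 0 → Y.coefD = 0 →
      hatBracketC 𝔇 G (symbHat 𝔇 G x p X) (symbHat 𝔇 G y q Y) = 0 := by
    intro X Y hX hY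
    by_cases hb : basePt 𝔇 G x = basePt 𝔇 G y
    · rw [← exps_basePt (𝔇 := 𝔇)] at hp hq
      by_cases h1 : G.Marked x <;> by_cases h2 : G.Marked y
      · rw [basePt_of_marked h1, basePt_of_marked h2] at hb
        exact absurd hb hxy
      · refine hatBracketC_symbHat_conj 𝔇 G hb ?_ (marked_basePt hy) (isComplexPt_basePt hy h2)
          (hb ▸ hp) hq hX hY
        simp [GaudinData.sign, h1, h2]
      · refine hatBracketC_symbHat_conj 𝔇 G hb ?_ (marked_basePt hy) (hb ▸ isComplexPt_basePt hx h1)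
          (hb ▸ hp) hq hX hY
        simp [GaudinData.sign, h1, h2]
      -- Two conjugates lying over the same marked point coincide.
      · obtain ⟨a, -, ha, ha'⟩ := exists_of_not_marked (𝔇 := 𝔇) hx h1
        obtain ⟨c, -, hc, hc'⟩ := exists_of_not_marked (𝔇 := 𝔇) hy h2
        rw [ha', hc'] at hb
        exact absurd (by rw [ha, hc, OnePoint.coe_eq_coe.1 hb]) hxy
    · exact hatBracketC_symbHat_ne 𝔇 G hb p q hX hY
  simp only [obsLin_apply, levelBracket_obs]
  rw [key, map_zero, map_zero]
  · split_ifs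
    exacts [hX, coefD_affτ 𝔇 hX]
  · split_ifs
    exacts [hY, coefD_affτ 𝔇 hY]

lemma obs_eq_zero {x : OnePoint ℂ} {p : ℕ} (hp : p ∉ G.exps x) (X : Aff g) :
    obs 𝔇 G x p X = 0 := by
  rw [← exps_basePt (𝔇 := 𝔇)] at hp
  have h : ∀ X : Aff g, single 𝔇 G (basePt 𝔇 G x) p X = 0 := fun X =>
    Subtype.ext (funext fun y => funext fun q => if_neg fun h => hp h.2.2)
  simp only [obs, symbHat, symb_eq, h, TensorProduct.tmul_zero, sub_zero, map_zero]

lemma obsLin_eq_zero {x : OnePoint ℂ} {p : ℕ} (hp : p ∉ G.exps x) : obsLin 𝔇 G x p = 0 :=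
  LinearMap.ext fun _ => obs_eq_zero 𝔇 G hp _

lemma obs_K {x : OnePoint ℂ} (hx : G.AllMarked x) {p : ℕ} (hp : p ∈ G.exps x) :
    obs 𝔇 G x p Aff.K
      = algebraMap ℂ (LevelAlg 𝔇 G) (G.sign x * Complex.I * G.level x p) := by
  rw [obs, ← AlgHom.commutes (levelMk 𝔇 G), ← sub_eq_zero, ← map_sub]
  exact levelMk_eq_zero 𝔇 G (Ideal.subset_span ⟨x, p, hx, hp, rfl⟩)

lemma affτ_K : 𝔇.affτ Aff.K = -Aff.K := by
  refine Prod.ext ?_ (Prod.ext ?_ ?_)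
  · change 𝔇.loopτ 0 = -0
    rw [map_zero, neg_zero]
  · change -conj (1 : ℂ) = -1
    rw [map_one]
  · change -conj (0 : ℂ) = -0
    rw [map_zero]

/-- The sign ε_x in the level condition cancels against τ K = -K, so i ℓ^x_p appears at all points.
-/
lemma obsLin_K {x : OnePoint ℂ} (hx : G.AllMarked x) {p : ℕ} (hp : p ∈ G.exps x) :
    obsLin 𝔇 G x p Aff.K = (Complex.I * G.level x p) • 1 := by
  have h := obs_K 𝔇 G hx hp
  rw [Algebra.algebraMap_eq_smul_one] at h
  rw [obsLin_apply]
  split_ifs with hm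
  · rw [h, GaudinData.sign, if_pos hm, one_mul]
  · rw [affτ_K, ← neg_one_smul ℂ, obs_smul_not_marked 𝔇 G hm, h, GaudinData.sign, if_neg hm,
      smul_smul]
    simp

/-- P absorbs elements of the stabiliser. This matters at 0 and infinity, where every rotation fixes
the point and an average over rotations can be inserted freely. -/
lemma obsLin_rot {x : OnePoint ℂ} (hm : G.Marked x) {k : ZMod T} (h : mobius 𝔇.ω (.r k) x = x)
    (p : ℕ) (X : Aff g) :
    obsLin 𝔇 G x p (𝔇.phase x p k • (𝔇.affσ ^ k.val) X) = obsLin 𝔇 G x p X := by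
  have hs : ∀ X : Aff g, single 𝔇 G x p (𝔇.slotAct x p (.r k) X) = single 𝔇 G x p X := fun X => by
    refine Subtype.ext (funext fun y => funext fun q => ?_)
    rw [single_apply, single_apply, slotAverage_slotAct 𝔇 h]
  simp only [obsLin_apply, if_pos hm, obs, symbHat]
  change levelMk 𝔇 G (SymmetricAlgebra.ι ℂ _ 
    ((takiffDropD 𝔇 G).baseChange ℂ (symb 𝔇 G x p (𝔇.slotAct x p (.r k) X)))) = _
  congr 3
  simp only [symb_eq, basePt_of_marked hm, ← slotAct_I_smul_r, hs]

end Obs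

/-! ### Rotations -/

namespace DihedralLie

variable (𝔇 : DihedralLie T g)

/-- The roots of unity `ω ^ k`. -/
def zeta (k : ZMod T) : ℂ := 𝔇.ω ^ k.val

/-- The powers of the automorphism `σ` of the affine algebra. -/
def rotσ (k : ZMod T) : Module.End ℂ (Aff g) := 𝔇.affσ ^ k.val

lemma zeta_add (k l : ZMod T) : 𝔇.zeta (k + l) = 𝔇.zeta k * 𝔇.zeta l :=
  pow_val_add 𝔇.ω_prim.pow_eq_one k l

lemma zeta_zero : 𝔇.zeta 0 = 1 := by simp [zeta]

lemma zeta_ne_zero (k : ZMod T) : 𝔇.zeta k ≠ 0 := pow_ne_zero _ 𝔇.ω_ne_zero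

lemma zeta_pow (k : ZMod T) : 𝔇.zeta k ^ T = 1 := by
  rw [zeta, ← pow_mul, mul_comm, pow_mul, 𝔇.ω_prim.pow_eq_one, one_pow]

lemma zeta_neg (k : ZMod T) : 𝔇.zeta (-k) = (𝔇.zeta k)⁻¹ := by
  refine eq_inv_of_mul_eq_one_left ?_
  rw [← zeta_add, neg_add_cancel, zeta_zero]

lemma rotσ_add (k l : ZMod T) : 𝔇.rotσ (k + l) = 𝔇.rotσ k * 𝔇.rotσ l :=
  pow_val_add 𝔇.affσ_pow_T k l

lemma rotσ_add_apply (k l : ZMod T) (X : Aff g) :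
    𝔇.rotσ (k + l) X = 𝔇.rotσ k (𝔇.rotσ l X) := by
  rw [rotσ_add, Module.End.mul_apply]

lemma rotσ_affBracket (k : ZMod T) (X Y : Aff g) :
    𝔇.rotσ k (𝔇.affBracket X Y) = 𝔇.affBracket (𝔇.rotσ k X) (𝔇.rotσ k Y) := by
  unfold rotσ
  generalize k.val = n
  induction n with
  | zero => simp
  | succ n ih => rw [pow_succ', Module.End.mul_apply, ih, affσ_affBracket]; rfl

lemma coefD_rotσ (k : ZMod T) (X : Aff g) : (𝔇.rotσ k X).coefD = X.coefD := by
  unfold rotσ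
  generalize k.val = n
  induction n with
  | zero => simp
  | succ n ih => rw [pow_succ', Module.End.mul_apply]; exact ih

/-- A ^ (T - 1) serves as the inverse of A, which lets endomorphisms be treated without passing to
units. -/
lemma pow_mul_pred_val {M : Type*} [Monoid M] {A : M} (hA : A ^ T = 1) (k : ZMod T) :
    (A ^ (T - 1)) ^ k.val = A ^ (-k).val := by
  have h1 : (A ^ (T - 1)) ^ k.val * A ^ k.val = 1 := by
    rw [← pow_mul, ← pow_add, ← Nat.succ_mul, Nat.succ_eq_add_one,
      Nat.sub_add_cancel (Nat.one_le_iff_ne_zero.2 (NeZero.ne T)), pow_mul, hA, one_pow]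
  have h2 : A ^ k.val * A ^ (-k).val = 1 := by
    rw [← pow_val_add hA, add_neg_cancel, ZMod.val_zero, pow_zero]
  exact left_inv_eq_right_inv h1 h2

lemma sum_range_eq_sum_zmod {M : Type*} [AddCommMonoid M] (f : ℕ → M) :
    ∑ k ∈ Finset.range T, f k = ∑ k : ZMod T, f k.val := by
  cases T with
  | zero => exact absurd rfl (NeZero.ne 0)
  -- For T = n + 1 the type `ZMod T` is `Fin (n + 1)` by definition.
  | succ n => exact (Fin.sum_univ_eq_sum_range f (n + 1)).symm

end DihedralLie

/-! ### Cauchy kernels -/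

/-- The kernels `(u - x) ^ (-p - 1)` at a finite point `x` and `-u ^ (p - 1)`, for `p ≥ 1`, at
infinity. -/
def cauchyKer (x : OnePoint ℂ) (p : ℕ) (u : ℂ) : ℂ :=
  x.elim (if p = 0 then 0 else -u ^ (p - 1)) fun x => ((u - x) ^ (p + 1))⁻¹

lemma cauchyKer_coe (x : ℂ) (p : ℕ) (u : ℂ) : cauchyKer x p u = ((u - x) ^ (p + 1))⁻¹ := rfl

lemma cauchyKer_infty_zero (u : ℂ) : cauchyKer OnePoint.infty 0 u = 0 := rfl

lemma cauchyKer_infty_succ (p : ℕ) (u : ℂ) : cauchyKer OnePoint.infty (p + 1) u = -u ^ p := rfl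

/-- The kernels are powers, of (u - x)⁻¹ at a finite point and of u up to sign at infinity, so the
sum is geometric. The minus sign in the kernel at infinity is what gives both cases the same
right-hand side. -/
lemma sum_cauchyKer {x : OnePoint ℂ} {u v : ℂ} (hu : (u : OnePoint ℂ) ≠ x)
    (hv : (v : OnePoint ℂ) ≠ x) (huv : u ≠ v) (r : ℕ) :
    ∑ k ∈ Finset.range (r + 1), cauchyKer x k u * cauchyKer x (r - k) v
      = (v - u)⁻¹ * (cauchyKer x r u - cauchyKer x r v) := by
  have huv' : v - u ≠ 0 := sub_ne_zero.2 huv.symm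
  rw [eq_inv_mul_iff_mul_eq₀ huv']
  induction x using OnePoint.rec with
  | infty =>
    rcases r with _ | r
    · simp [cauchyKer_infty_zero]
    -- The first and the last summand contain the exponent 0, whose kernel at infinity is zero.
    · rw [Finset.sum_range_succ', cauchyKer_infty_zero, zero_mul, add_zero,
        Finset.sum_range_succ, Nat.sub_self, cauchyKer_infty_zero, mul_zero, add_zero,
        cauchyKer_infty_succ, cauchyKer_infty_succ]
      have h := geom_sum₂_mul u v r
      have h2 : ∑ k ∈ Finset.range r, cauchyKer OnePoint.infty (k + 1) u
          * cauchyKer OnePoint.infty (r + 1 - (k + 1)) v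
          = ∑ k ∈ Finset.range r, u ^ k * v ^ (r - 1 - k) := by
        refine Finset.sum_congr rfl fun k hk => ?_
        have hk := Finset.mem_range.1 hk
        rw [show r + 1 - (k + 1) = (r - 1 - k) + 1 by omega, cauchyKer_infty_succ,
          cauchyKer_infty_succ, neg_mul_neg]
      rw [h2]
      linear_combination -h
  | coe x =>
    have hu' : u - x ≠ 0 := sub_ne_zero.2 fun h => hu (by rw [h])
    have hv' : v - x ≠ 0 := sub_ne_zero.2 fun h => hv (by rw [h])
    have h := geom_sum₂_mul (u - x)⁻¹ (v - x)⁻¹ (r + 1)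
    have h2 : ∑ k ∈ Finset.range (r + 1), cauchyKer x k u * cauchyKer x (r - k) v
        = (u - x)⁻¹ * (v - x)⁻¹ *
          ∑ k ∈ Finset.range (r + 1), (u - x)⁻¹ ^ k * (v - x)⁻¹ ^ (r + 1 - 1 - k) := by
      rw [Finset.mul_sum]
      refine Finset.sum_congr rfl fun k hk => ?_
      rw [cauchyKer_coe, cauchyKer_coe, Nat.add_sub_cancel, ← inv_pow, ← inv_pow]
      ring
    have h3 : (v - u) * ((u - x)⁻¹ * (v - x)⁻¹) = (u - x)⁻¹ - (v - x)⁻¹ := by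
      field_simp
      ring
    rw [h2, ← mul_assoc, h3, mul_comm, h, cauchyKer_coe, cauchyKer_coe, inv_pow, inv_pow]

/-- Since f vanishes from degree n on, as truncated polynomials do, the sum over the square reduces
to the triangle p + q < n, which is then summed along its diagonals. -/
lemma sum_cauchyKer_smul {V : Type*} [AddCommGroup V] [Module ℂ V] {x : OnePoint ℂ} {u v : ℂ}
    (hu : (u : OnePoint ℂ) ≠ x) (hv : (v : OnePoint ℂ) ≠ x) (huv : u ≠ v) (n : ℕ) (f : ℕ → V)
    (hf : ∀ r, n ≤ r → f r = 0) :
    ∑ p ∈ Finset.Ico (if x = OnePoint.infty then 1 else 0) n,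
      ∑ q ∈ Finset.Ico (if x = OnePoint.infty then 1 else 0) n,
        (cauchyKer x p u * cauchyKer x q v) • f (p + q)
      = ∑ r ∈ Finset.Ico (if x = OnePoint.infty then 1 else 0) n,
        ((v - u)⁻¹ * (cauchyKer x r u - cauchyKer x r v)) • f r := by
  -- Only the exponent 0 at infinity is left out of the interval, and its kernel is zero; hence all
  -- sums may start at 0.
  have hz : ∀ p ∈ Finset.range n,
      p ∉ Finset.Ico (if x = OnePoint.infty then 1 else 0) n → ∀ u, cauchyKer x p u = 0 := by
    intro p hp hp' u
    rw [Finset.mem_range] at hp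
    rw [Finset.mem_Ico] at hp'
    split_ifs at hp' with hx
    · have : p = 0 := by omega
      rw [this, hx, cauchyKer_infty_zero]
    · omega
  have hsub : Finset.Ico (if x = OnePoint.infty then 1 else 0) n ⊆ Finset.range n := by
    intro p hp
    exact Finset.mem_range.2 (Finset.mem_Ico.1 hp).2
  have e1 : ∀ h : ℕ → V, (∀ p ∈ Finset.range n,
      p ∉ Finset.Ico (if x = OnePoint.infty then 1 else 0) n → h p = 0) →
      ∑ p ∈ Finset.Ico (if x = OnePoint.infty then 1 else 0) n, h p = ∑ p ∈ Finset.range n, h p :=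
    fun h hh => Finset.sum_subset hsub hh
  rw [e1 _ fun p hp hp' => ?_, e1 _ fun p hp hp' => ?_]
  · calc _ = ∑ p ∈ Finset.range n, ∑ q ∈ Finset.range (n - p),
        (cauchyKer x p u * cauchyKer x q v) • f (p + q) := by
          refine Finset.sum_congr rfl fun p hp => ?_
          rw [e1 _ fun q hq hq' => by rw [hz q hq hq', mul_zero, zero_smul]]
          refine (Finset.sum_subset (Finset.range_subset_range.2 (Nat.sub_le n p))
            fun q _ hq => ?_).symm
          rw [Finset.mem_range] at hq
          rw [hf _ (by omega), smul_zero]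
      _ = _ := by
          rw [← Finset.sum_range_diag_flip n
            fun p q => (cauchyKer x p u * cauchyKer x q v) • f (p + q)]
          refine Finset.sum_congr rfl fun r _ => ?_
          rw [← sum_cauchyKer hu hv huv, Finset.sum_smul]
          refine Finset.sum_congr rfl fun k hk => ?_
          rw [Finset.mem_range] at hk
          rw [Nat.add_sub_cancel' (by omega)]
  · rw [hz p hp hp', hz p hp hp', sub_zero, mul_zero, zero_smul]
  · simp [hz p hp hp']

/-! ### The generating function of the observables -/

section LaxObs

variable (𝔇 : DihedralLie T g) (G : GaudinData T 𝔇.ω)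

/-- This transports identities between the incarnations of the sum: numbers, series, connections and
linear maps into S_ℓ. -/
lemma map_laxSum {M N : Type*} [AddCommGroup M] [Module ℂ M] [AddCommGroup N] [Module ℂ N]
    (h : M →ₗ[ℂ] N) {s : Module.End ℂ M} {s' : Module.End ℂ N} (hs : ∀ v, h (s v) = s' (h v))
    (F : OnePoint ℂ → ℕ → M) (z : ℂ) :
    h (laxSum 𝔇 G s F z) = laxSum 𝔇 G s' (fun x p => h (F x p)) z := by
  have hp : ∀ (k : ℕ) (v : M), h ((s ^ k) v) = (s' ^ k) (h v) := by
    intro k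
    induction k with
    | zero => intro v; simp
    | succ k ih => intro v; rw [pow_succ, pow_succ, Module.End.mul_apply, ih, hs]; rfl
  simp only [laxSum, map_sub, map_add, map_smul, map_sum, hp]

/-- The orbit of 0 is {0}, so a positive multiplicity there forces 0 itself to be a marked point. -/
lemma mult_zero_pos (h : 0 < G.mult ((0 : ℂ) : OnePoint ℂ)) : (0 : ℂ) ∈ G.pts := by
  rcases (G.mult_pos _).1 h with h | ⟨y, hy, α, h⟩
  · exact absurd h (OnePoint.coe_ne_infty _)
  · have h0 : y = 0 := by
      rcases α with k | k
      · simp only [mobius, OnePoint.map_some, OnePoint.coe_eq_coe, zero_eq_mul] at h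
        exact h.resolve_left (pow_ne_zero _ 𝔇.ω_ne_zero)
      · simp only [mobius, OnePoint.map_some, OnePoint.coe_eq_coe, map_mul, zero_eq_mul,
          map_eq_zero] at h
        exact h.resolve_left (pow_ne_zero _ 𝔇.ω_ne_zero)
    rwa [← h0]

lemma laxSum_congr {M : Type*} [AddCommGroup M] [Module ℂ M] (s : Module.End ℂ M)
    {F F' : OnePoint ℂ → ℕ → M} (h : ∀ x p, G.AllMarked x → p ∈ G.exps x → F x p = F' x p)
    (z : ℂ) : laxSum 𝔇 G s F z = laxSum 𝔇 G s F' z := by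
  unfold laxSum
  congr 1
  · congr 1
    · congr 1
      refine Finset.sum_congr rfl fun k _ => Finset.sum_congr rfl fun x hx =>
        Finset.sum_congr rfl fun p hp => ?_
      rw [h x p (Or.inr ⟨x, Finset.mem_of_mem_erase hx, rfl⟩)]
      simpa [GaudinData.exps] using hp
    · refine Finset.sum_congr rfl fun p hp => ?_
      have hm := mult_zero_pos 𝔇 G (Nat.zero_lt_of_lt (Finset.mem_range.1 hp))
      rw [h _ p (Or.inr ⟨0, Finset.mem_union_left _ hm, rfl⟩)]
      simpa [GaudinData.exps] using hp
  · refine Finset.sum_congr rfl fun p hp => ?_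
    rw [h _ _ (Or.inl rfl)]
    rw [Finset.mem_range] at hp
    simp only [GaudinData.exps, if_true, Finset.mem_Ico]
    omega

/-- The operator `(1/T) ∑ k, ω ^ k c_p (ω ^ k z) σ ^ k`, where `c_p` is the kernel `cauchyKer`. -/
def rotOp (x : OnePoint ℂ) (p : ℕ) (z : ℂ) : Module.End ℂ (Aff g) :=
  (T : ℂ)⁻¹ • ∑ k : ZMod T, (𝔇.zeta k * cauchyKer x p (𝔇.zeta k * z)) • 𝔇.rotσ k

/-- The contribution of the point `x` to the generating function of the observables. -/
def rotSum (x : OnePoint ℂ) (z : ℂ) : Aff g →ₗ[ℂ] LevelAlg 𝔇 G :=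
  ∑ p ∈ G.exps x, obsLin 𝔇 G x p ∘ₗ rotOp 𝔇 x p z

/-- The generating function of the observables. -/
def laxObs (z : ℂ) : Aff g →ₗ[ℂ] LevelAlg 𝔇 G :=
  laxSum 𝔇 G (LinearMap.lcomp ℂ (LevelAlg 𝔇 G) (𝔇.affσ ^ (T - 1))) (obsLin 𝔇 G) z

lemma rotFixed_zero (k : ZMod T) :
    mobius 𝔇.ω (.r k) ((0 : ℂ) : OnePoint ℂ) = ((0 : ℂ) : OnePoint ℂ) := by
  simp [mobius]

lemma rotFixed_infty (k : ZMod T) : mobius 𝔇.ω (.r k) OnePoint.infty = OnePoint.infty := rfl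

lemma zeta_mul_cauchyKer_zero (k : ZMod T) (p : ℕ) (z : ℂ) :
    𝔇.zeta k * cauchyKer ((0 : ℂ) : OnePoint ℂ) p (𝔇.zeta k * z)
      = cauchyKer ((0 : ℂ) : OnePoint ℂ) p z * 𝔇.phase ((0 : ℂ) : OnePoint ℂ) p k := by
  have h := 𝔇.zeta_ne_zero k
  rw [cauchyKer_coe, cauchyKer_coe, sub_zero, sub_zero, DihedralLie.phase,
    if_neg (OnePoint.coe_ne_infty _), pow_mul, ← DihedralLie.zeta, mul_pow, mul_inv,
    pow_succ (𝔇.zeta k), mul_inv]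
  field_simp

lemma zeta_mul_cauchyKer_infty (k : ZMod T) {p : ℕ} (hp : 1 ≤ p) (z : ℂ) :
    𝔇.zeta k * cauchyKer OnePoint.infty p (𝔇.zeta k * z)
      = cauchyKer OnePoint.infty p z * 𝔇.phase OnePoint.infty p k := by
  obtain ⟨p, rfl⟩ := Nat.exists_eq_add_of_le' hp
  rw [cauchyKer_infty_succ, cauchyKer_infty_succ, DihedralLie.phase, if_pos rfl, pow_mul,
    ← DihedralLie.zeta]
  ring

/-- At zero and infinity, the points fixed by all rotations, the kernel factors out. -/
lemma rotOp_fixed {x : OnePoint ℂ} (hx : x = ((0 : ℂ) : OnePoint ℂ) ∨ x = OnePoint.infty) {p : ℕ}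
    (hp : p ∈ G.exps x) (z : ℂ) : rotOp 𝔇 x p z = cauchyKer x p z • rotAverage 𝔇 x p := by
  rcases hx with rfl | rfl
  · rw [rotAverage_fixed 𝔇 (rotFixed_zero 𝔇), smul_comm, Finset.smul_sum, rotOp]
    simp only [zeta_mul_cauchyKer_zero, mul_smul]
    rfl
  · rw [rotAverage_fixed 𝔇 (rotFixed_infty 𝔇), smul_comm, Finset.smul_sum, rotOp]
    have : 1 ≤ p := by simpa using (Finset.mem_Ico.1 hp).1
    simp only [zeta_mul_cauchyKer_infty 𝔇 _ this, mul_smul]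
    rfl

lemma rotAverage_mul_self {x : OnePoint ℂ} (hx : ∀ k : ZMod T, mobius 𝔇.ω (.r k) x = x) (p : ℕ) :
    rotAverage 𝔇 x p * rotAverage 𝔇 x p = rotAverage 𝔇 x p := by
  have hT : (T : ℂ) ≠ 0 := Nat.cast_ne_zero.2 (NeZero.ne T)
  rw [rotAverage_fixed 𝔇 hx, smul_mul_smul_comm, Finset.sum_mul_sum]
  have h : ∀ k : ZMod T, ∑ l : ZMod T, (𝔇.phase x p k • 𝔇.affσ ^ k.val)
      * (𝔇.phase x p l • 𝔇.affσ ^ l.val) = ∑ l : ZMod T, 𝔇.phase x p l • 𝔇.affσ ^ l.val := by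
    intro k
    refine Fintype.sum_equiv (Equiv.addLeft k) _ _ fun l => ?_
    rw [Equiv.coe_addLeft, smul_mul_smul_comm, 𝔇.phase_add, pow_val_add 𝔇.affσ_pow_T]
  simp only [h, Finset.sum_const, Finset.card_univ, ZMod.card]
  rw [← Nat.cast_smul_eq_nsmul ℂ, smul_smul, mul_assoc, inv_mul_cancel₀ hT, mul_one]

/-- The range of `rotOp` already consists of vectors invariant under the rotations fixing x. The
average in `levelBracket_obsLin` therefore disappears inside the generating function. -/
lemma rotAverage_mul_rotOp {x : OnePoint ℂ} {p : ℕ} (hp : p ∈ G.exps x) (z : ℂ) :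
    rotAverage 𝔇 x p * rotOp 𝔇 x p z = rotOp 𝔇 x p z := by
  by_cases hx : x = ((0 : ℂ) : OnePoint ℂ) ∨ x = OnePoint.infty
  · rw [rotOp_fixed 𝔇 G hx hp, mul_smul_comm, rotAverage_mul_self]
    rcases hx with rfl | rfl
    · exact rotFixed_zero 𝔇
    · exact rotFixed_infty 𝔇
  · push Not at hx
    induction x using OnePoint.rec with
    | infty => exact absurd rfl hx.2
    | coe x => rw [rotAverage_coe 𝔇 (fun h => hx.1 (by rw [h])), one_mul]

lemma obsLin_comp_rotAverage {x : OnePoint ℂ} (hm : G.Marked x)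
    (hx : ∀ k : ZMod T, mobius 𝔇.ω (.r k) x = x) (p : ℕ) :
    obsLin 𝔇 G x p ∘ₗ rotAverage 𝔇 x p = obsLin 𝔇 G x p := by
  have hT : (T : ℂ) ≠ 0 := Nat.cast_ne_zero.2 (NeZero.ne T)
  ext1 X
  rw [rotAverage_fixed 𝔇 hx, LinearMap.comp_apply, LinearMap.smul_apply, LinearMap.sum_apply,
    map_smul, map_sum]
  simp only [LinearMap.smul_apply, obsLin_rot 𝔇 G hm (hx _), Finset.sum_const, Finset.card_univ,
    ZMod.card]
  rw [← Nat.cast_smul_eq_nsmul ℂ, smul_smul, inv_mul_cancel₀ hT, one_smul]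

lemma rotSum_fixed {x : OnePoint ℂ} (hm : G.Marked x)
    (hx : x = ((0 : ℂ) : OnePoint ℂ) ∨ x = OnePoint.infty) (z : ℂ) :
    rotSum 𝔇 G x z = ∑ p ∈ G.exps x, cauchyKer x p z • obsLin 𝔇 G x p := by
  refine Finset.sum_congr rfl fun p hp => ?_
  rw [rotOp_fixed 𝔇 G hx hp, LinearMap.comp_smul, obsLin_comp_rotAverage 𝔇 G hm]
  rcases hx with rfl | rfl
  · exact rotFixed_zero 𝔇
  · exact rotFixed_infty 𝔇

/-- All the marked points and the conjugates of the complex ones. -/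
def allMarkedPts : Finset (OnePoint ℂ) :=
  insert OnePoint.infty (G.allPts.image fun y : ℂ => (y : OnePoint ℂ))

variable {𝔇 G} in
lemma mem_allMarkedPts {x : OnePoint ℂ} : x ∈ allMarkedPts 𝔇 G ↔ G.AllMarked x := by
  simp [allMarkedPts, GaudinData.AllMarked, eq_comm]

lemma zero_mem_pts (h : (0 : ℂ) ∈ G.allPts) : (0 : ℂ) ∈ G.pts := by
  rcases Finset.mem_union.1 h with h | h
  · exact h
  · obtain ⟨y, hy, hy0⟩ := Finset.mem_image.1 h
    exact absurd ((map_eq_zero _).1 hy0) (Finset.mem_filter.1 hy).2.ne_zero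

/-- This puts all points on the same footing. At 0 and infinity the defining sum has no average over
rotations, but inserting one changes nothing, by `rotSum_fixed`. -/
lemma laxObs_eq (z : ℂ) : laxObs 𝔇 G z = ∑ x ∈ allMarkedPts 𝔇 G, rotSum 𝔇 G x z := by
  rw [allMarkedPts, Finset.sum_insert (by simp), Finset.sum_image (by simp), laxObs, laxSum]
  have hinf : rotSum 𝔇 G OnePoint.infty z = -∑ q ∈ Finset.range (G.mult OnePoint.infty - 1),
      z ^ q • obsLin 𝔇 G OnePoint.infty (q + 1) := by
    rw [rotSum_fixed 𝔇 G (Or.inl rfl) (Or.inr rfl), GaudinData.exps, if_pos rfl,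
      Finset.sum_Ico_eq_sum_range, ← Finset.sum_neg_distrib]
    refine Finset.sum_congr rfl fun q _ => ?_
    rw [add_comm 1 q, cauchyKer_infty_succ]
    exact neg_smul (z ^ q) (obsLin 𝔇 G OnePoint.infty (q + 1))
  have hzero : ∑ p ∈ Finset.range (G.mult ((0 : ℂ) : OnePoint ℂ)),
      (z ^ (p + 1))⁻¹ • obsLin 𝔇 G ((0 : ℂ) : OnePoint ℂ) p
      = if (0 : ℂ) ∈ G.allPts then rotSum 𝔇 G ((0 : ℂ) : OnePoint ℂ) z else 0 := by
    split_ifs with h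
    · rw [rotSum_fixed 𝔇 G (Or.inr ⟨0, zero_mem_pts 𝔇 G h, rfl⟩) (Or.inl rfl), GaudinData.exps,
        if_neg (OnePoint.coe_ne_infty _), Finset.range_eq_Ico]
      simp only [cauchyKer_coe, sub_zero]
    · refine Finset.sum_eq_zero fun p hp => absurd (Finset.mem_union_left _ ?_) h
      exact mult_zero_pos 𝔇 G (Nat.zero_lt_of_lt (Finset.mem_range.1 hp))
  have hcoe : (T : ℂ)⁻¹ • ∑ k ∈ Finset.range T, ∑ x ∈ G.allPts.erase 0,
      ∑ p ∈ Finset.range (G.mult (x : OnePoint ℂ)),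
        ((𝔇.ω ^ k)⁻¹ / ((𝔇.ω ^ k)⁻¹ * z - x) ^ (p + 1)) •
          ((LinearMap.lcomp ℂ (LevelAlg 𝔇 G) (𝔇.affσ ^ (T - 1))) ^ k) (obsLin 𝔇 G x p)
      = ∑ x ∈ G.allPts.erase 0, rotSum 𝔇 G (x : OnePoint ℂ) z := by
    have hl : ∀ (k : ℕ) (f : Aff g →ₗ[ℂ] LevelAlg 𝔇 G),
        ((LinearMap.lcomp ℂ (LevelAlg 𝔇 G) (𝔇.affσ ^ (T - 1))) ^ k) f
          = f ∘ₗ ((𝔇.affσ ^ (T - 1)) ^ k) := by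
      intro k
      induction k with
      | zero => intro f; rfl
      | succ k ih => intro f; rw [pow_succ, Module.End.mul_apply, ih, pow_succ']; rfl
    rw [Finset.sum_comm, Finset.smul_sum]
    refine Finset.sum_congr rfl fun x _ => ?_
    rw [Finset.sum_comm, Finset.smul_sum, rotSum, GaudinData.exps,
      if_neg (OnePoint.coe_ne_infty _), ← Finset.range_eq_Ico]
    refine Finset.sum_congr rfl fun p _ => ?_
    rw [rotOp, LinearMap.comp_smul, DihedralLie.sum_range_eq_sum_zmod]
    congr 1
    have hsum : obsLin 𝔇 G (x : OnePoint ℂ) p ∘ₗ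
        (∑ k : ZMod T, (𝔇.zeta k * cauchyKer (x : OnePoint ℂ) p (𝔇.zeta k * z)) • 𝔇.rotσ k)
        = ∑ k : ZMod T, (𝔇.zeta k * cauchyKer (x : OnePoint ℂ) p (𝔇.zeta k * z)) •
          (obsLin 𝔇 G (x : OnePoint ℂ) p ∘ₗ 𝔇.rotσ k) := by
      ext1 X
      simp only [LinearMap.comp_apply, LinearMap.sum_apply, map_sum, LinearMap.smul_apply, map_smul]
    rw [hsum]
    -- The definition of the sum uses ω^{-k} and, through σ^(T-1), the inverse rotation; the
    -- substitution k ↦ -k turns both into ζ_k and σ^k.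
    refine Fintype.sum_equiv (Equiv.neg (ZMod T)) _ _ fun k => ?_
    rw [hl, DihedralLie.pow_mul_pred_val 𝔇.affσ_pow_T, Equiv.neg_apply, 𝔇.zeta_neg, cauchyKer_coe,
      ← div_eq_mul_inv]
    rfl
  rw [hinf, hzero, hcoe, sub_eq_neg_add]
  congr 1
  split_ifs with h
  · exact Finset.sum_erase_add _ (fun x : ℂ => rotSum 𝔇 G (x : OnePoint ℂ) z) h
  · rw [Finset.erase_eq_of_notMem h, add_zero]

end LaxObs

/-! ### The Poisson bracket of the generating function -/

lemma sum_comm_four {ι₁ ι₂ M : Type*} [AddCommMonoid M] (s : Finset ι₁) (t : Finset ι₂)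
    (f : ι₁ → ι₁ → ι₂ → ι₂ → M) :
    ∑ k ∈ s, ∑ j ∈ s, ∑ p ∈ t, ∑ q ∈ t, f k j p q
      = ∑ p ∈ t, ∑ q ∈ t, ∑ k ∈ s, ∑ j ∈ s, f k j p q := by
  calc _ = ∑ k ∈ s, ∑ p ∈ t, ∑ q ∈ t, ∑ j ∈ s, f k j p q :=
        Finset.sum_congr rfl fun k _ => Finset.sum_comm.trans
          (Finset.sum_congr rfl fun p _ => Finset.sum_comm)
    _ = _ := Finset.sum_comm.trans (Finset.sum_congr rfl fun p _ => Finset.sum_comm)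

section LaxBracket

variable (𝔇 : DihedralLie T g) (G : GaudinData T 𝔇.ω)

/-- The operator `(1/T) ∑ l, ω ^ l (ω ^ l z' - z)⁻¹ σ ^ l` on the affine algebra. -/
def affRop (z z' : ℂ) : Module.End ℂ (Aff g) :=
  (T : ℂ)⁻¹ • ∑ l : ZMod T, (𝔇.zeta l * (𝔇.zeta l * z' - z)⁻¹) • 𝔇.rotσ l

lemma coefD_rotOp (x : OnePoint ℂ) (p : ℕ) (z : ℂ) {X : Aff g} (hX : X.coefD = 0) :
    (rotOp 𝔇 x p z X).coefD = 0 := by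
  rw [rotOp, LinearMap.smul_apply, LinearMap.sum_apply, map_smul, map_sum]
  simp [𝔇.coefD_rotσ, hX]

/-- A double sum over the cyclic group which is the common shape of both sides of the bracket
relation. -/
def doubleSum (x : OnePoint ℂ) (c : ZMod T → ZMod T → ℕ → ℂ) (X Y : Aff g) : LevelAlg 𝔇 G :=
  ((T : ℂ)⁻¹ * (T : ℂ)⁻¹) • ∑ k : ZMod T, ∑ j : ZMod T, ∑ r ∈ G.exps x,
    (𝔇.zeta k * 𝔇.zeta j * c k j r) •
      obsLin 𝔇 G x r (𝔇.affBracket (𝔇.rotσ k X) (𝔇.rotσ j Y))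

lemma rotOp_apply (x : OnePoint ℂ) (p : ℕ) (z : ℂ) (X : Aff g) :
    rotOp 𝔇 x p z X = (T : ℂ)⁻¹ • ∑ k : ZMod T,
      (𝔇.zeta k * cauchyKer x p (𝔇.zeta k * z)) • 𝔇.rotσ k X := by
  simp only [rotOp, LinearMap.smul_apply, LinearMap.sum_apply]

lemma affRop_apply (z z' : ℂ) (X : Aff g) :
    affRop 𝔇 z z' X = (T : ℂ)⁻¹ • ∑ l : ZMod T,
      (𝔇.zeta l * (𝔇.zeta l * z' - z)⁻¹) • 𝔇.rotσ l X := by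
  simp only [affRop, LinearMap.smul_apply, LinearMap.sum_apply]

lemma rotSum_apply (x : OnePoint ℂ) (z : ℂ) (X : Aff g) :
    rotSum 𝔇 G x z X = ∑ p ∈ G.exps x, obsLin 𝔇 G x p (rotOp 𝔇 x p z X) := by
  simp only [rotSum, LinearMap.sum_apply, LinearMap.comp_apply]

/-- Because σ^k [X, σ^l Y] = [σ^k X, σ^{k+l} Y], the substitution j = k + l gives the common shape.
The weight ζ_l / (ζ_l z' - z) equals ζ_j / (ζ_j z' - ζ_k z). -/
lemma rotSum_affBracket_right (x : OnePoint ℂ) (z z' : ℂ) (X Y : Aff g) :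
    rotSum 𝔇 G x z (𝔇.affBracket X (affRop 𝔇 z z' Y)) = doubleSum 𝔇 G x
      (fun k j r => (𝔇.zeta j * z' - 𝔇.zeta k * z)⁻¹ * cauchyKer x r (𝔇.zeta k * z)) X Y := by
  rw [rotSum_apply, doubleSum]
  simp only [rotOp_apply, affRop_apply, map_smul, map_sum, 𝔇.rotσ_affBracket,
    ← 𝔇.rotσ_add_apply, Finset.smul_sum, smul_smul]
  refine (Finset.sum_congr rfl fun r _ => Finset.sum_comm).trans (Finset.sum_comm.trans ?_)
  refine Finset.sum_congr rfl fun k _ => ?_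
  rw [Finset.sum_comm]
  refine Fintype.sum_equiv (Equiv.addLeft k) _ _ fun l => ?_
  refine Finset.sum_congr rfl fun r _ => ?_
  rw [Equiv.coe_addLeft]
  congr 1
  have h : 𝔇.zeta (k + l) * z' - 𝔇.zeta k * z = 𝔇.zeta k * (𝔇.zeta l * z' - z) := by
    rw [𝔇.zeta_add]; ring
  have hk := 𝔇.zeta_ne_zero k
  rw [h, 𝔇.zeta_add, mul_inv]
  field_simp

lemma rotSum_affBracket_left (x : OnePoint ℂ) (z z' : ℂ) (X Y : Aff g) :
    rotSum 𝔇 G x z' (𝔇.affBracket (affRop 𝔇 z' z X) Y) = doubleSum 𝔇 G x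
      (fun k j r => (𝔇.zeta k * z - 𝔇.zeta j * z')⁻¹ * cauchyKer x r (𝔇.zeta j * z')) X Y := by
  rw [rotSum_apply, doubleSum]
  simp only [rotOp_apply, affRop_apply, map_smul, map_sum, 𝔇.rotσ_affBracket,
    ← 𝔇.rotσ_add_apply, LinearMap.smul_apply, LinearMap.sum_apply, Finset.smul_sum, smul_smul]
  refine (Finset.sum_congr rfl fun r _ => Finset.sum_comm).trans (Finset.sum_comm.trans ?_)
  conv_rhs => rw [Finset.sum_comm]
  refine Finset.sum_congr rfl fun k _ => ?_
  rw [Finset.sum_comm]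
  refine Fintype.sum_equiv (Equiv.addLeft k) _ _ fun l => ?_
  refine Finset.sum_congr rfl fun r _ => ?_
  rw [Equiv.coe_addLeft]
  congr 1
  have h : 𝔇.zeta (k + l) * z - 𝔇.zeta k * z' = 𝔇.zeta k * (𝔇.zeta l * z - z') := by
    rw [𝔇.zeta_add]; ring
  have hk := 𝔇.zeta_ne_zero k
  rw [h, 𝔇.zeta_add, mul_inv]
  field_simp

/-- The condition on T-th powers keeps all rotated evaluation points apart, as the denominators of
`sum_cauchyKer` require. -/
lemma zeta_mul_ne {z z' : ℂ} (h : z ^ T ≠ z' ^ T) (k j : ZMod T) :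
    𝔇.zeta k * z ≠ 𝔇.zeta j * z' := by
  intro he
  apply h
  have := congrArg (· ^ T) he
  simpa [mul_pow, 𝔇.zeta_pow] using this

/-- The kernels are singular only on orbits of marked points: a conjugate point is reached from its
marked point by a reflection. -/
lemma isPole_of_zeta_mul {z : ℂ} {x : OnePoint ℂ} (hx : G.AllMarked x) (k : ZMod T)
    (h : ((𝔇.zeta k * z : ℂ) : OnePoint ℂ) = x) : G.IsPole z := by
  subst h
  rcases hx with h | ⟨y, hy, h⟩
  · exact absurd h (OnePoint.coe_ne_infty _)
  · rw [OnePoint.coe_eq_coe] at h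
    have hz : z = 𝔇.zeta (-k) * y := by
      rw [← h, 𝔇.zeta_neg, ← mul_assoc, inv_mul_cancel₀ (𝔇.zeta_ne_zero k), one_mul]
    rcases Finset.mem_union.1 hy with hy | hy
    · exact ⟨y, hy, .r (-k), by rw [hz]; rfl⟩
    · obtain ⟨w, hw, rfl⟩ := Finset.mem_image.1 hy
      refine ⟨w, (Finset.mem_filter.1 hw).1, .sr k, ?_⟩
      rw [hz, DihedralLie.zeta, pow_val_neg 𝔇.ω_prim.pow_eq_one, ← map_mul]
      rfl

/-- The local form of the bracket relation. For each pair of rotations, `sum_cauchyKer_smul` splits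
the product of two kernels into a part with a kernel at z and a part with a kernel at z', and these
are the two terms on the right. -/
lemma levelBracket_rotSum {x : OnePoint ℂ} (hx : G.AllMarked x) {z z' : ℂ} (hz : ¬ G.IsPole z)
    (hz' : ¬ G.IsPole z') (hzz' : z ^ T ≠ z' ^ T) {X Y : Aff g} (hX : X.coefD = 0)
    (hY : Y.coefD = 0) :
    levelBracket 𝔇 G (rotSum 𝔇 G x z X) (rotSum 𝔇 G x z' Y)
      = rotSum 𝔇 G x z (𝔇.affBracket X (affRop 𝔇 z z' Y))
        + rotSum 𝔇 G x z' (𝔇.affBracket (affRop 𝔇 z' z X) Y) := by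
  have h1 : levelBracket 𝔇 G (rotSum 𝔇 G x z X) (rotSum 𝔇 G x z' Y)
      = ∑ p ∈ G.exps x, ∑ q ∈ G.exps x,
        obsLin 𝔇 G x (p + q) (𝔇.affBracket (rotOp 𝔇 x p z X) (rotOp 𝔇 x q z' Y)) := by
    simp only [rotSum_apply, map_sum, LinearMap.sum_apply]
    refine Finset.sum_comm.trans (Finset.sum_congr rfl fun p hp =>
      Finset.sum_congr rfl fun q hq => ?_)
    rw [levelBracket_obsLin 𝔇 G hx hp hq (coefD_rotOp 𝔇 x p z hX) (coefD_rotOp 𝔇 x q z' hY),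
      show rotAverage 𝔇 x q (rotOp 𝔇 x q z' Y) = rotOp 𝔇 x q z' Y from
        LinearMap.congr_fun (rotAverage_mul_rotOp 𝔇 G hq z') Y]
  have h2 : levelBracket 𝔇 G (rotSum 𝔇 G x z X) (rotSum 𝔇 G x z' Y) = doubleSum 𝔇 G x
      (fun k j r => (𝔇.zeta j * z' - 𝔇.zeta k * z)⁻¹ *
        (cauchyKer x r (𝔇.zeta k * z) - cauchyKer x r (𝔇.zeta j * z'))) X Y := by
    rw [h1, doubleSum]
    have hkj : ∀ k j : ZMod T, ∑ r ∈ G.exps x, (𝔇.zeta k * 𝔇.zeta j *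
        ((𝔇.zeta j * z' - 𝔇.zeta k * z)⁻¹ *
          (cauchyKer x r (𝔇.zeta k * z) - cauchyKer x r (𝔇.zeta j * z')))) •
        obsLin 𝔇 G x r (𝔇.affBracket (𝔇.rotσ k X) (𝔇.rotσ j Y))
        = ∑ p ∈ G.exps x, ∑ q ∈ G.exps x, (𝔇.zeta k * 𝔇.zeta j *
          (cauchyKer x p (𝔇.zeta k * z) * cauchyKer x q (𝔇.zeta j * z'))) •
            obsLin 𝔇 G x (p + q) (𝔇.affBracket (𝔇.rotσ k X) (𝔇.rotσ j Y)) := by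
      intro k j
      have h := sum_cauchyKer_smul (x := x) (u := 𝔇.zeta k * z) (v := 𝔇.zeta j * z')
        (fun h => hz (isPole_of_zeta_mul 𝔇 G hx k h))
        (fun h => hz' (isPole_of_zeta_mul 𝔇 G hx j h)) (zeta_mul_ne 𝔇 hzz' k j) (G.mult x)
        (fun r => obsLin 𝔇 G x r (𝔇.affBracket (𝔇.rotσ k X) (𝔇.rotσ j Y)))
        (fun r hr => by
          rw [obsLin_eq_zero 𝔇 G (fun h => absurd (Finset.mem_Ico.1 h).2 (not_lt.2 hr)),
            LinearMap.zero_apply])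
      simp only [mul_smul (𝔇.zeta k * 𝔇.zeta j), ← Finset.smul_sum]
      congr 1
      exact h.symm
    simp only [hkj]
    rw [sum_comm_four, Finset.smul_sum]
    refine Finset.sum_congr rfl fun p _ => ?_
    rw [Finset.smul_sum]
    refine Finset.sum_congr rfl fun q _ => ?_
    simp only [rotOp_apply, map_smul, map_sum, LinearMap.smul_apply, LinearMap.sum_apply,
      Finset.smul_sum]
    rw [Finset.sum_comm]
    refine Finset.sum_congr rfl fun k _ => Finset.sum_congr rfl fun j _ => ?_
    simp only [smul_smul]
    congr 1
    ring
  rw [h2, rotSum_affBracket_right, rotSum_affBracket_left, doubleSum, doubleSum, doubleSum,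
    ← smul_add, ← Finset.sum_add_distrib]
  congr 1
  refine Finset.sum_congr rfl fun k _ => ?_
  rw [← Finset.sum_add_distrib]
  refine Finset.sum_congr rfl fun j _ => ?_
  rw [← Finset.sum_add_distrib]
  refine Finset.sum_congr rfl fun r _ => ?_
  -- The two denominators are opposite, which makes the sum of the two terms a difference of
  -- kernels.
  rw [← add_smul, ← neg_sub (𝔇.zeta j * z'), inv_neg]
  congr 1
  ring

lemma levelBracket_rotSum_ne {x y : OnePoint ℂ} (hx : G.AllMarked x) (hy : G.AllMarked y)
    (hxy : x ≠ y) (z z' : ℂ) {X Y : Aff g} (hX : X.coefD = 0) (hY : Y.coefD = 0) :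
    levelBracket 𝔇 G (rotSum 𝔇 G x z X) (rotSum 𝔇 G y z' Y) = 0 := by
  simp only [rotSum_apply, map_sum, LinearMap.sum_apply]
  refine Finset.sum_eq_zero fun q hq => Finset.sum_eq_zero fun p hp => ?_
  exact levelBracket_obsLin_ne 𝔇 G hx hy hxy hp hq (coefD_rotOp 𝔇 x p z hX)
    (coefD_rotOp 𝔇 y q z' hY)

/-- The off-diagonal terms vanish, and `affRop` does not depend on the point, so the diagonal terms
add up to values of the generating function itself. -/
lemma levelBracket_laxObs {z z' : ℂ} (hz : ¬ G.IsPole z) (hz' : ¬ G.IsPole z')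
    (hzz' : z ^ T ≠ z' ^ T) {X Y : Aff g} (hX : X.coefD = 0) (hY : Y.coefD = 0) :
    levelBracket 𝔇 G (laxObs 𝔇 G z X) (laxObs 𝔇 G z' Y)
      = laxObs 𝔇 G z (𝔇.affBracket X (affRop 𝔇 z z' Y))
        + laxObs 𝔇 G z' (𝔇.affBracket (affRop 𝔇 z' z X) Y) := by
  simp only [laxObs_eq, LinearMap.sum_apply, map_sum]
  rw [← Finset.sum_add_distrib]
  refine Finset.sum_congr rfl fun x hx => ?_
  rw [Finset.sum_eq_single x]
  · exact levelBracket_rotSum 𝔇 G (mem_allMarkedPts.1 hx) hz hz' hzz' hX hY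
  · intro y hy hyx
    exact levelBracket_rotSum_ne 𝔇 G (mem_allMarkedPts.1 hy) (mem_allMarkedPts.1 hx) hyx z z' hX hY
  · exact fun h => absurd hx h

/-- K is fixed by σ and its image at every point is i times the level. Evaluation at K therefore
gives the same rational sum as the twist function. -/
lemma laxObs_K (z : ℂ) : laxObs 𝔇 G z Aff.K = (Complex.I * twist 𝔇 G z) • 1 := by
  have hK : ∀ n : ℕ, (𝔇.affσ ^ n) Aff.K = Aff.K := by
    intro n
    induction n with
    | zero => rfl
    | succ n ih =>
      rw [pow_succ', Module.End.mul_apply, ih]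
      refine Prod.ext ?_ rfl
      exact map_zero (Finsupp.mapRange.linearMap 𝔇.σ)
  have h1 := map_laxSum 𝔇 G (LinearMap.applyₗ (Aff.K : Aff g) :
    (Aff g →ₗ[ℂ] LevelAlg 𝔇 G) →ₗ[ℂ] LevelAlg 𝔇 G) (s' := 1)
    (s := LinearMap.lcomp ℂ (LevelAlg 𝔇 G) (𝔇.affσ ^ (T - 1)))
    (fun f => by simp [hK]) (obsLin 𝔇 G) z
  have h2 := map_laxSum 𝔇 G (LinearMap.toSpanSingleton ℂ (LevelAlg 𝔇 G) (Complex.I • 1))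
    (s := 1) (s' := 1) (fun f => rfl) G.level z
  refine h1.trans ((laxSum_congr 𝔇 G 1 (fun x p hx hp => ?_) z).trans h2.symm |>.trans ?_)
  · rw [LinearMap.applyₗ_apply_apply, obsLin_K 𝔇 G hx hp, LinearMap.toSpanSingleton_apply,
      smul_smul, mul_comm]
  · rw [LinearMap.toSpanSingleton_apply, smul_smul, mul_comm]
    rfl

end LaxBracket

/-! ### The canonical element -/

section Casimir

variable (𝔇 : DihedralLie T g) {ι : Type*} [Fintype ι] [DecidableEq ι] (b : Module.Basis ι ℂ g)
  {V : Type*} [AddCommGroup V] [Module ℂ V]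

lemma sum_form_smul_dualB (x : g) : ∑ a, 𝔇.form x (b a) • dualB 𝔇 b a = x := by
  conv_rhs => rw [← (dualB 𝔇 b).sum_repr x]
  exact Finset.sum_congr rfl fun a _ => by
    rw [dualB, LinearMap.BilinForm.dualBasis_repr_apply]

lemma form_dualB (a c : ι) : 𝔇.form (dualB 𝔇 b a) (b c) = if c = a then 1 else 0 :=
  LinearMap.BilinForm.apply_dualBasis_left 𝔇.form_nondeg b a c

lemma sum_form_smul_basis (x : g) : ∑ a, 𝔇.form (dualB 𝔇 b a) x • b a = x := by
  have h : ∑ a, (𝔇.form (dualB 𝔇 b a)).smulRight (b a) = LinearMap.id := by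
    refine b.ext fun c => ?_
    simp [form_dualB]
  simpa using LinearMap.congr_fun h x

/-- Moving an operator from the first to the second factor of the canonical element. -/
lemma sum_adjoint_tmul {A A' : Module.End ℂ g} (hA : ∀ x y, 𝔇.form (A x) y = 𝔇.form x (A' y))
    (f : g →ₗ[ℂ] V) :
    ∑ a, A (dualB 𝔇 b a) ⊗ₜ[ℂ] f (b a) = ∑ a, dualB 𝔇 b a ⊗ₜ[ℂ] f (A' (b a)) := by
  have h1 : ∀ a, A (dualB 𝔇 b a) ⊗ₜ[ℂ] f (b a)
      = ∑ c, dualB 𝔇 b c ⊗ₜ[ℂ] (𝔇.form (dualB 𝔇 b a) (A' (b c)) • f (b a)) := by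
    intro a
    conv_lhs => rw [← sum_form_smul_dualB 𝔇 b (A (dualB 𝔇 b a)), TensorProduct.sum_tmul]
    exact Finset.sum_congr rfl fun c _ => by rw [hA, TensorProduct.smul_tmul]
  simp only [h1]
  rw [Finset.sum_comm]
  refine Finset.sum_congr rfl fun c _ => ?_
  rw [← TensorProduct.tmul_sum]
  conv_rhs => rw [← sum_form_smul_basis 𝔇 b (A' (b c))]
  simp only [map_sum, map_smul]

lemma sum_basis_tmul_dualB :
    ∑ a, b a ⊗ₜ[ℂ] dualB 𝔇 b a = ∑ a, dualB 𝔇 b a ⊗ₜ[ℂ] b a := by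
  have h1 : ∀ a, b a ⊗ₜ[ℂ] dualB 𝔇 b a
      = ∑ c, dualB 𝔇 b c ⊗ₜ[ℂ] (𝔇.form (b c) (b a) • dualB 𝔇 b a) := by
    intro a
    conv_lhs => rw [← sum_form_smul_dualB 𝔇 b (b a), TensorProduct.sum_tmul]
    exact Finset.sum_congr rfl fun c _ => by rw [𝔇.form_symm, TensorProduct.smul_tmul]
  simp only [h1]
  rw [Finset.sum_comm]
  refine Finset.sum_congr rfl fun c _ => ?_
  rw [← TensorProduct.tmul_sum, sum_form_smul_dualB]

/-- The adjoint of `ad x` is `-ad x`. -/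
lemma sum_lie_tmul (x : g) (f : g →ₗ[ℂ] V) :
    ∑ a, ⁅x, dualB 𝔇 b a⁆ ⊗ₜ[ℂ] f (b a) = ∑ a, dualB 𝔇 b a ⊗ₜ[ℂ] f ⁅b a, x⁆ := by
  have h := sum_adjoint_tmul 𝔇 b (A := LieModule.toEnd ℂ g g x) (A' := -LieModule.toEnd ℂ g g x)
    (fun y w => by
      rw [LieModule.toEnd_apply_apply, LinearMap.neg_apply, LieModule.toEnd_apply_apply,
        map_neg, ← lie_skew, map_neg, LinearMap.neg_apply, 𝔇.form_inv]) f
  simpa using h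

/-- The element `∑ a c, (I_a ⊗ I_c) ⊗ ψ a c`. -/
def pairGen (ψ : ι → ι → V) : (g ⊗[ℂ] g) ⊗[ℂ] V :=
  ∑ a, ∑ c, (dualB 𝔇 b a ⊗ₜ[ℂ] dualB 𝔇 b c) ⊗ₜ[ℂ] ψ a c

lemma pairGen_add (ψ ψ' : ι → ι → V) :
    pairGen 𝔇 b (fun a c => ψ a c + ψ' a c) = pairGen 𝔇 b ψ + pairGen 𝔇 b ψ' := by
  simp only [pairGen, TensorProduct.tmul_add, Finset.sum_add_distrib]

lemma pairGen_smul (r : ℂ) (ψ : ι → ι → V) :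
    pairGen 𝔇 b (fun a c => r • ψ a c) = r • pairGen 𝔇 b ψ := by
  simp only [pairGen, TensorProduct.tmul_smul, Finset.smul_sum]

/-- The series `∑ a, I_a ⊗ f (I^a)`. -/
def gen (f : g →ₗ[ℂ] V) : g ⊗[ℂ] V := ∑ a, dualB 𝔇 b a ⊗ₜ[ℂ] f (b a)

/-- All terms of the bracket relation will be brought to the form `pairGen`, so that it can be
checked in V for each pair of basis vectors. -/
lemma fieldBracket_gen (β : V →ₗ[ℂ] V →ₗ[ℂ] V) (f h : ℤ → g →ₗ[ℂ] V) (m n : ℤ) :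
    fieldBracket β (fun m => gen 𝔇 b (f m)) (fun n => gen 𝔇 b (h n)) m n
      = pairGen 𝔇 b fun a c => β (f m (b a)) (h n (b c)) := by
  simp only [fieldBracket, gen, pairGen, TensorProduct.sum_tmul, TensorProduct.tmul_sum, map_sum,
    TensorProduct.tensorTensorTensorComm_tmul, LinearMap.lTensor_tmul, TensorProduct.lift.tmul]
  exact Finset.sum_comm

/-- Invariance of the form moves the bracket with R(I^c) from the dual basis vector I_a to the
argument I^a of f. -/
lemma brk₁_gen (R : Module.End ℂ g) (f : g →ₗ[ℂ] V) :
    (brk₁ (∑ a, R (b a) ⊗ₜ[ℂ] dualB 𝔇 b a)).rTensor V (gen 𝔇 b f)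
      = pairGen 𝔇 b fun a c => f ⁅b a, R (b c)⁆ := by
  have h1 : ∀ c, ∑ a, ⁅R (b c), dualB 𝔇 b a⁆ ⊗ₜ[ℂ] (dualB 𝔇 b c ⊗ₜ[ℂ] f (b a))
      = ∑ a, dualB 𝔇 b a ⊗ₜ[ℂ] (dualB 𝔇 b c ⊗ₜ[ℂ] f ⁅b a, R (b c)⁆) := fun c =>
    sum_lie_tmul 𝔇 b (R (b c)) (TensorProduct.mk ℂ g V (dualB 𝔇 b c) ∘ₗ f)
  have h2 : ∀ c, ∑ a, (⁅R (b c), dualB 𝔇 b a⁆ ⊗ₜ[ℂ] dualB 𝔇 b c) ⊗ₜ[ℂ] f (b a)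
      = ∑ a, (dualB 𝔇 b a ⊗ₜ[ℂ] dualB 𝔇 b c) ⊗ₜ[ℂ] f ⁅b a, R (b c)⁆ := by
    intro c
    have := congrArg (TensorProduct.assoc ℂ g g V).symm (h1 c)
    simpa only [map_sum, TensorProduct.assoc_symm_tmul] using this
  have hb : ∀ x y u : g, brk₁ (x ⊗ₜ[ℂ] y) u = ⁅x, u⁆ ⊗ₜ[ℂ] y := fun x y u => rfl
  simp only [gen, pairGen, map_sum, LinearMap.rTensor_tmul, LinearMap.sum_apply, hb,
    TensorProduct.sum_tmul]
  rw [Finset.sum_comm]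
  simp only [h2]
  rw [Finset.sum_comm]

/-- The same move in the second factor. Antisymmetry restores the order of the arguments and
accounts for the sign. -/
lemma brk₂_gen (R : Module.End ℂ g) (f : g →ₗ[ℂ] V) :
    (brk₂ (∑ a, dualB 𝔇 b a ⊗ₜ[ℂ] R (b a))).rTensor V (gen 𝔇 b f)
      = -pairGen 𝔇 b fun a c => f ⁅R (b a), b c⁆ := by
  have h2 : ∀ a, ∑ c, (dualB 𝔇 b a ⊗ₜ[ℂ] ⁅R (b a), dualB 𝔇 b c⁆) ⊗ₜ[ℂ] f (b c)
      = ∑ c, (dualB 𝔇 b a ⊗ₜ[ℂ] dualB 𝔇 b c) ⊗ₜ[ℂ] f ⁅b c, R (b a)⁆ := by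
    intro a
    have := congrArg (fun v => (TensorProduct.assoc ℂ g g V).symm (dualB 𝔇 b a ⊗ₜ[ℂ] v))
      (sum_lie_tmul 𝔇 b (R (b a)) f)
    simpa only [TensorProduct.tmul_sum, map_sum, TensorProduct.assoc_symm_tmul] using this
  have hb : ∀ x y u : g, brk₂ (x ⊗ₜ[ℂ] y) u = x ⊗ₜ[ℂ] ⁅y, u⁆ := fun x y u => rfl
  simp only [gen, pairGen, map_sum, LinearMap.rTensor_tmul, LinearMap.sum_apply, hb,
    TensorProduct.sum_tmul]
  rw [Finset.sum_comm]
  simp only [h2, ← Finset.sum_neg_distrib]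
  refine Finset.sum_congr rfl fun a _ => Finset.sum_congr rfl fun c _ => ?_
  rw [← lie_skew, map_neg, TensorProduct.tmul_neg]

/-- The coordinates of a vector in the dual basis are its pairings with the basis. This serves the
δ' term, where `v` is the unit of S_ℓ. -/
lemma tmul_one_eq_pairGen₁ (R : Module.End ℂ g) (v : V) :
    (∑ a, R (b a) ⊗ₜ[ℂ] dualB 𝔇 b a) ⊗ₜ[ℂ] v
      = pairGen 𝔇 b fun a c => 𝔇.form (b a) (R (b c)) • v := by
  rw [pairGen, Finset.sum_comm, TensorProduct.sum_tmul]
  refine Finset.sum_congr rfl fun c _ => ?_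
  conv_lhs => rw [← sum_form_smul_dualB 𝔇 b (R (b c))]
  simp only [TensorProduct.sum_tmul, TensorProduct.tmul_smul, TensorProduct.smul_tmul',
    𝔇.form_symm (R (b c))]

lemma tmul_one_eq_pairGen₂ (R : Module.End ℂ g) (v : V) :
    (∑ a, dualB 𝔇 b a ⊗ₜ[ℂ] R (b a)) ⊗ₜ[ℂ] v
      = pairGen 𝔇 b fun a c => 𝔇.form (R (b a)) (b c) • v := by
  rw [pairGen, TensorProduct.sum_tmul]
  refine Finset.sum_congr rfl fun a _ => ?_
  conv_lhs => rw [← sum_form_smul_dualB 𝔇 b (R (b a))]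
  simp only [TensorProduct.tmul_sum, TensorProduct.sum_tmul, TensorProduct.tmul_smul,
    TensorProduct.smul_tmul']

end Casimir

/-! ### The matrix `R⁰` as an operator -/

section Rop

variable (𝔇 : DihedralLie T g) {ι : Type*} [Fintype ι] [DecidableEq ι] (b : Module.Basis ι ℂ g)

/-- The operator `(1/T) ∑ l, ω ^ l (ω ^ l z' - z)⁻¹ σ ^ l` on `g`. -/
def finRop (z z' : ℂ) : Module.End ℂ g :=
  (T : ℂ)⁻¹ • ∑ l : ZMod T, (𝔇.zeta l * (𝔇.zeta l * z' - z)⁻¹) • 𝔇.σ ^ l.val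

lemma form_σ_pow (n : ℕ) (x y : g) : 𝔇.form ((𝔇.σ ^ n) x) ((𝔇.σ ^ n) y) = 𝔇.form x y := by
  induction n with
  | zero => simp
  | succ n ih => rw [pow_succ', Module.End.mul_apply, Module.End.mul_apply, 𝔇.form_σ, ih]

lemma form_σ_pow_left (l : ZMod T) (x y : g) :
    𝔇.form ((𝔇.σ ^ l.val) x) y = 𝔇.form x ((𝔇.σ ^ (-l).val) y) := by
  conv_rhs => rw [← form_σ_pow 𝔇 l.val]
  rw [← Module.End.mul_apply, ← pow_val_add 𝔇.σ_pow, add_neg_cancel, ZMod.val_zero, pow_zero,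
    Module.End.one_apply]

/-- A discrete Fourier transform: the coefficient of σ^l contains ∑ (ζ_l z)^k z'^{T-1-k}, a
geometric sum equal to (z'^T - z^T) / (z' - ζ_l z) because ζ_l^T = 1. -/
lemma sum_gradeProj {z z' : ℂ} (h : z ^ T ≠ z' ^ T) :
    (z' ^ T - z ^ T)⁻¹ • ∑ k ∈ Finset.range T, (z ^ k * z' ^ (T - 1 - k)) • gradeProj 𝔇 (-k)
      = (T : ℂ)⁻¹ • ∑ l : ZMod T, (z' - 𝔇.zeta l * z)⁻¹ • 𝔇.σ ^ l.val := by
  have hne : z' ^ T - z ^ T ≠ 0 := sub_ne_zero.2 h.symm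
  simp only [gradeProj, smul_smul, Finset.smul_sum, DihedralLie.sum_range_eq_sum_zmod]
  rw [Finset.sum_comm]
  refine Finset.sum_congr rfl fun l _ => ?_
  rw [← Finset.sum_smul]
  congr 1
  rw [← DihedralLie.sum_range_eq_sum_zmod fun k => (z' ^ T - z ^ T)⁻¹ *
    (z ^ k * z' ^ (T - 1 - k) * ((T : ℂ)⁻¹ * (𝔇.ω ^ (-(k : ℤ) * (l.val : ℤ)))⁻¹))]
  have hg := geom_sum₂_mul (𝔇.zeta l * z) z' T
  rw [mul_pow, 𝔇.zeta_pow, one_mul] at hg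
  have hd : z' - 𝔇.zeta l * z ≠ 0 := by
    intro h0
    have h0' : 𝔇.zeta l * z = z' := (sub_eq_zero.1 h0).symm
    rw [h0', sub_self, mul_zero] at hg
    exact h (sub_eq_zero.1 hg.symm)
  have hs : ∑ k ∈ Finset.range T, (𝔇.zeta l * z) ^ k * z' ^ (T - 1 - k)
      = (z' ^ T - z ^ T) * (z' - 𝔇.zeta l * z)⁻¹ := by
    rw [eq_mul_inv_iff_mul_eq₀ hd]
    linear_combination -hg
  calc _ = ∑ k ∈ Finset.range T, ((z' ^ T - z ^ T)⁻¹ * (T : ℂ)⁻¹) *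
        ((𝔇.zeta l * z) ^ k * z' ^ (T - 1 - k)) := by
        refine Finset.sum_congr rfl fun k _ => ?_
        have he : (𝔇.ω ^ (-(k : ℤ) * (l.val : ℤ)))⁻¹ = 𝔇.zeta l ^ k := by
          rw [neg_mul, zpow_neg, inv_inv, DihedralLie.zeta, ← pow_mul, mul_comm, ← Nat.cast_mul,
            zpow_natCast]
        rw [he, mul_pow]
        ring
    _ = _ := by
        rw [← Finset.mul_sum, hs]
        field_simp

/-- σ preserves the form, so the adjoint of σ^l is σ^{-l}; after l ↦ -l the numerator ζ_l is
absorbed into the denominator. -/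
lemma form_finRop_left (z z' : ℂ) (x y : g) :
    𝔇.form (finRop 𝔇 z z' x) y
      = 𝔇.form x (((T : ℂ)⁻¹ • ∑ l : ZMod T, (z' - 𝔇.zeta l * z)⁻¹ • 𝔇.σ ^ l.val) y) := by
  simp only [finRop, LinearMap.smul_apply, LinearMap.sum_apply, map_smul, map_sum]
  congr 1
  refine Fintype.sum_equiv (Equiv.neg (ZMod T)) _ _ fun l => ?_
  rw [form_σ_pow_left, Equiv.neg_apply, 𝔇.zeta_neg]
  congr 1
  have hl := 𝔇.zeta_ne_zero l
  have : z' - (𝔇.zeta l)⁻¹ * z = (𝔇.zeta l)⁻¹ * (𝔇.zeta l * z' - z) := by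
    field_simp
  rw [this, mul_inv, inv_inv]

/-- The projections in R⁰ act on the second factor of the canonical element. Symmetry of that
element and passage to the adjoint move them to the first, where they form the operator occurring in
the bracket of the generating function. -/
lemma Rzero_eq {z z' : ℂ} (h : z ^ T ≠ z' ^ T) :
    Rzero 𝔇 b z z' = ∑ a, finRop 𝔇 z z' (b a) ⊗ₜ[ℂ] dualB 𝔇 b a := by
  have h1 := congrArg ((finRop 𝔇 z z').rTensor g) (sum_basis_tmul_dualB 𝔇 b)
  simp only [map_sum, LinearMap.rTensor_tmul] at h1
  have h2 := sum_adjoint_tmul 𝔇 b (form_finRop_left 𝔇 z z') LinearMap.id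
  simp only [LinearMap.id_apply] at h2
  rw [h1, h2, ← sum_gradeProj 𝔇 h]
  simp only [Rzero, casimirGr, casimir, map_sum, LinearMap.lTensor_tmul,
    LinearMap.smul_apply, LinearMap.sum_apply, TensorProduct.tmul_smul, TensorProduct.tmul_sum,
    Finset.smul_sum]
  rw [Finset.sum_comm]

end Rop

/-! ### The Fourier modes of the Lax matrix -/

section Modes

variable (𝔇 : DihedralLie T g) (G : GaudinData T 𝔇.ω)

/-- The map `x ↦ x_n` as a linear map. -/
def loopLin (n : ℤ) : g →ₗ[ℂ] Aff g := LinearMap.inl ℂ (ℤ →₀ g) (ℂ × ℂ) ∘ₗ Finsupp.lsingle n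

lemma loopLin_apply (n : ℤ) (x : g) : loopLin n x = Aff.loop n x := rfl

lemma affσ_loop (n : ℤ) (x : g) : 𝔇.affσ (Aff.loop n x) = Aff.loop n (𝔇.σ x) := by
  refine Prod.ext ?_ rfl
  exact Finsupp.mapRange_single (hf := map_zero 𝔇.σ)

lemma affσ_pow_loop (k : ℕ) (n : ℤ) (x : g) :
    (𝔇.affσ ^ k) (Aff.loop n x) = Aff.loop n ((𝔇.σ ^ k) x) := by
  induction k with
  | zero => simp
  | succ k ih => rw [pow_succ', pow_succ', Module.End.mul_apply, ih, affσ_loop]; rfl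

lemma affRop_loop (z z' : ℂ) (n : ℤ) (x : g) :
    affRop 𝔇 z z' (Aff.loop n x) = Aff.loop n (finRop 𝔇 z z' x) := by
  have h : ∀ k : ℕ, (𝔇.affσ ^ k) (loopLin n x) = loopLin n ((𝔇.σ ^ k) x) := fun k =>
    affσ_pow_loop 𝔇 k n x
  rw [affRop_apply]
  simp only [DihedralLie.rotσ, ← loopLin_apply, h, finRop, LinearMap.smul_apply,
    LinearMap.sum_apply, map_sum, map_smul]

lemma affBracket_loop (m n : ℤ) (x y : g) :
    𝔇.affBracket (Aff.loop m x) (Aff.loop n y) = Aff.loop (m + n) ⁅x, y⁆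
      + (if m + n = 0 then (m : ℂ) * 𝔇.form x y else 0) • Aff.K := by
  refine Prod.ext ?_ (Prod.ext ?_ ?_)
  · change DihedralLie.loopBracket (Finsupp.single m x) (Finsupp.single n y)
      + (0 : ℂ) • DihedralLie.degree (Finsupp.single n y)
      - (0 : ℂ) • DihedralLie.degree (Finsupp.single m x)
      = Finsupp.single (m + n) ⁅x, y⁆ + _ • (0 : ℤ →₀ g)
    simp [DihedralLie.loopBracket, DihedralLie.pairSum_single]
  · change 𝔇.cocycle (Finsupp.single m x) (Finsupp.single n y)
      = 0 + (if m + n = 0 then (m : ℂ) * 𝔇.form x y else 0) * 1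
    rw [DihedralLie.cocycle, DihedralLie.pairSum_single]
    split_ifs <;> simp
  · change (0 : ℂ) = 0 + _ * 0
    simp

/-- The Fourier modes of the generating function of the observables. -/
def laxMode (z : ℂ) (n : ℤ) : g →ₗ[ℂ] LevelAlg 𝔇 G := laxObs 𝔇 G z ∘ₗ loopLin n

/-- The cocycle gives m δ_{m+n,0} ⟨x, y⟩ K, and K becomes i φ(z); the product i m δ_{m+n,0} is the
Fourier coefficient of δ'. -/
lemma laxObs_affBracket_loop (z : ℂ) (m n : ℤ) (x y : g) :
    laxObs 𝔇 G z (𝔇.affBracket (Aff.loop m x) (Aff.loop n y))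
      = laxMode 𝔇 G z (m + n) ⁅x, y⁆ + (diracDeriv m n * twist 𝔇 G z) • 𝔇.form x y • 1 := by
  rw [affBracket_loop, map_add, map_smul, laxObs_K, smul_smul, smul_smul]
  refine congrArg₂ (· + ·) rfl (congrArg (· • (1 : LevelAlg 𝔇 G)) ?_)
  unfold diracDeriv
  split_ifs <;> ring

lemma levelBracket_laxMode {z z' : ℂ} (hz : ¬ G.IsPole z) (hz' : ¬ G.IsPole z')
    (hzz' : z ^ T ≠ z' ^ T) (m n : ℤ) (x y : g) :
    levelBracket 𝔇 G (laxMode 𝔇 G z m x) (laxMode 𝔇 G z' n y)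
      = laxMode 𝔇 G z (m + n) ⁅x, finRop 𝔇 z z' y⁆
        + laxMode 𝔇 G z' (m + n) ⁅finRop 𝔇 z' z x, y⁆
        + ((diracDeriv m n * twist 𝔇 G z) • 𝔇.form x (finRop 𝔇 z z' y) • 1
          + (diracDeriv m n * twist 𝔇 G z') • 𝔇.form (finRop 𝔇 z' z x) y • 1) := by
  refine (levelBracket_laxObs 𝔇 G hz hz' hzz' rfl rfl).trans ?_
  simp only [loopLin_apply]
  rw [affRop_loop, affRop_loop, laxObs_affBracket_loop, laxObs_affBracket_loop]
  exact add_add_add_comm _ _ _ _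

variable {ι : Type*} [Fintype ι] [DecidableEq ι] (b : Module.Basis ι ℂ g)

/-- Reality of the form on the vectors fixed by τ carries the reality of a basis over to its dual
basis. -/
lemma τ_dualB (hb : ∀ a, 𝔇.τ (b a) = b a) (a : ι) : 𝔇.τ (dualB 𝔇 b a) = dualB 𝔇 b a := by
  refine (dualB 𝔇 b).ext_elem fun c => ?_
  rw [dualB, LinearMap.BilinForm.dualBasis_repr_apply, LinearMap.BilinForm.dualBasis_repr_apply,
    ← dualB]
  conv_lhs => rw [← hb c]
  rw [𝔇.form_τ, form_dualB]
  split_ifs <;> simp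

lemma affτ_loop (n : ℤ) (x : g) : 𝔇.affτ (Aff.loop n x) = Aff.loop (-n) (𝔇.τ x) := by
  refine Prod.ext ?_ (Prod.ext ?_ ?_)
  · exact 𝔇.loopτ_single n x
  · change -conj (0 : ℂ) = 0
    simp
  · change -conj (0 : ℂ) = 0
    simp

/-- The series with values in `g` attached to a linear function on the affine algebra. -/
def seriesOf (V : Type*) [AddCommGroup V] [Module ℂ V] :
    (Aff g →ₗ[ℂ] V) →ₗ[ℂ] (ℤ → g ⊗[ℂ] V) where
  toFun Ψ m := gen 𝔇 b (Ψ ∘ₗ loopLin (-m))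
  map_add' Ψ Ψ' := by
    funext m
    simp [gen, TensorProduct.tmul_add, Finset.sum_add_distrib]
  map_smul' c Ψ := by
    funext m
    simp [gen, Finset.smul_sum]

/-- The link between the Lax matrix and `laxObs`: σ acting on I_a becomes its adjoint σ^(T-1) acting
on I^a, that is, precomposition on linear maps. -/
lemma lax_eq (hb : ∀ a, 𝔇.τ (b a) = b a) (z : ℂ) : lax 𝔇 G b z
    = (twist 𝔇 G z)⁻¹ • fun m => gen 𝔇 b (laxMode 𝔇 G z (-m)) := by
  have hF : laxSum 𝔇 G (seriesσ 𝔇) (classicalField 𝔇 G b) z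
      = laxSum 𝔇 G (seriesσ 𝔇) (fun x p => seriesOf 𝔇 b _ (obsLin 𝔇 G x p)) z := by
    refine laxSum_congr 𝔇 G _ (fun x p hx hp => ?_) z
    funext m
    refine Finset.sum_congr rfl fun a _ => ?_
    rw [LinearMap.comp_apply, loopLin_apply, obsLin_apply]
    split_ifs
    · rfl
    -- τ fixes I^a and reverses the mode; this matches the e_n in place of e_{-n} in the fields at
    -- conjugate points.
    · rw [affτ_loop, hb, neg_neg]
  rw [lax, hF, ← map_laxSum 𝔇 G (seriesOf 𝔇 b _)
    (s := LinearMap.lcomp ℂ (LevelAlg 𝔇 G) (𝔇.affσ ^ (T - 1)))]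
  · rfl
  · intro Ψ
    funext m
    have hT : 𝔇.σ * 𝔇.σ ^ (T - 1) = 1 := by
      rw [← pow_succ', Nat.sub_add_cancel (Nat.one_le_iff_ne_zero.2 (NeZero.ne T)), 𝔇.σ_pow]
    have h := sum_adjoint_tmul 𝔇 b (A := 𝔇.σ) (A' := 𝔇.σ ^ (T - 1)) (fun x y => by
      rw [← 𝔇.form_σ x, ← Module.End.mul_apply, hT, Module.End.one_apply]) (Ψ ∘ₗ loopLin (-m))
    change ∑ a, _ = (𝔇.σ.rTensor _) (∑ a, _)
    simp only [map_sum, LinearMap.rTensor_tmul]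
    rw [h]
    refine Finset.sum_congr rfl fun a _ => ?_
    simp only [LinearMap.comp_apply, LinearMap.lcomp_apply, loopLin_apply, affσ_pow_loop]

lemma distMul₁_dirac {M : Type*} [AddCommGroup M] [Module ℂ M] (A : ℤ → M) (m n : ℤ) :
    distMul₁ A dirac m n = A (m + n) := by
  unfold distMul₁ dirac
  rw [finsum_eq_single _ (m + n)]
  · rw [if_pos (by ring), one_smul]
  · intro k hk
    rw [if_neg (by omega), zero_smul]

lemma distMul₂_dirac {M : Type*} [AddCommGroup M] [Module ℂ M] (A : ℤ → M) (m n : ℤ) :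
    distMul₂ A dirac m n = A (m + n) := by
  unfold distMul₂ dirac
  rw [finsum_eq_single _ (m + n)]
  · rw [if_pos (by ring), one_smul]
  · intro k hk
    rw [if_neg (by omega), zero_smul]

lemma Rswap_eq {z z' : ℂ} (h : z ^ T ≠ z' ^ T) : Rswap 𝔇 G b z' z
    = (twist 𝔇 G z)⁻¹ • ∑ a, dualB 𝔇 b a ⊗ₜ[ℂ] finRop 𝔇 z' z (b a) := by
  rw [Rswap, Rmat, Rzero_eq 𝔇 b h.symm, map_smul, map_sum]
  simp only [TensorProduct.comm_tmul]

lemma diracDeriv_neg (m n : ℤ) : diracDeriv (-m) (-n) = -diracDeriv m n := by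
  unfold diracDeriv
  have : -m + -n = 0 ↔ m + n = 0 := by omega
  simp only [this]
  split_ifs <;> simp

lemma fieldBracket_smul {V : Type*} [AddCommGroup V] [Module ℂ V] (β : V →ₗ[ℂ] V →ₗ[ℂ] V)
    (c d : ℂ) (A B : ℤ → g ⊗[ℂ] V) (m n : ℤ) :
    fieldBracket β (c • A) (d • B) m n = (c * d) • fieldBracket β A B m n := by
  simp only [fieldBracket, Pi.smul_apply, TensorProduct.smul_tmul_smul, map_smul]

/-- Once every term is a `pairGen`, `levelBracket_laxMode` gives the relation. The coefficient of
e_m involves the mode -m, hence the minus sign in front of δ'. -/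
theorem fieldBracket_lax (hb : ∀ a, 𝔇.τ (b a) = b a) {z z' : ℂ} (hz : ¬ G.IsPole z)
    (hz' : ¬ G.IsPole z') (hφ : twist 𝔇 G z ≠ 0) (hφ' : twist 𝔇 G z' ≠ 0)
    (hzz' : z ^ T ≠ z' ^ T) :
    fieldBracket (levelBracket 𝔇 G) (lax 𝔇 G b z) (lax 𝔇 G b z')
      = distMul₁ (comm₁ (Rmat 𝔇 G b z z') (lax 𝔇 G b z)) dirac
        - distMul₂ (comm₂ (Rswap 𝔇 G b z' z) (lax 𝔇 G b z')) dirac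
        - distConst ((Rmat 𝔇 G b z z' + Rswap 𝔇 G b z' z) ⊗ₜ[ℂ] 1) diracDeriv := by
  funext m n
  rw [Pi.sub_apply, Pi.sub_apply, Pi.sub_apply, Pi.sub_apply, distMul₁_dirac, distMul₂_dirac,
    distConst, comm₁, comm₂, Rmat, Rzero_eq 𝔇 b hzz', Rswap_eq 𝔇 G b hzz', lax_eq 𝔇 G b hb,
    lax_eq 𝔇 G b hb, fieldBracket_smul, fieldBracket_gen]
  simp only [levelBracket_laxMode 𝔇 G hz hz' hzz', pairGen_add, pairGen_smul, Pi.smul_apply,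
    map_smul, LinearMap.rTensor_smul, LinearMap.smul_apply, brk₁_gen, brk₂_gen,
    TensorProduct.add_tmul, ← TensorProduct.smul_tmul', tmul_one_eq_pairGen₁,
    tmul_one_eq_pairGen₂, diracDeriv_neg, ← neg_add, smul_neg, smul_add]
  simp only [smul_smul]
  -- Each cocycle term carries the twist function of its own generating function; one of the two
  -- inverses cancels, leaving the one in the definition of the corresponding R.
  have e1 : (twist 𝔇 G z)⁻¹ * (twist 𝔇 G z')⁻¹ * (-diracDeriv m n * twist 𝔇 G z)
      = -(diracDeriv m n * (twist 𝔇 G z')⁻¹) := by field_simp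
  have e2 : (twist 𝔇 G z)⁻¹ * (twist 𝔇 G z')⁻¹ * (-diracDeriv m n * twist 𝔇 G z')
      = -(diracDeriv m n * (twist 𝔇 G z)⁻¹) := by field_simp
  rw [e1, e2, neg_smul, neg_smul, mul_comm (twist 𝔇 G z')⁻¹]
  abel

end Modes

/-! ### Zeros of the twist function -/

section Rational

open Polynomial Filter Topology

/-- A function which becomes polynomial after multiplication by a non-zero polynomial. -/
def IsRational (f : ℂ → ℂ) : Prop :=
  ∃ P Q : ℂ[X], Q ≠ 0 ∧ ∀ z, Q.eval z * f z = P.eval z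

lemma isRational_eval (P : ℂ[X]) : IsRational fun z => P.eval z :=
  ⟨P, 1, one_ne_zero, fun z => by simp⟩

lemma IsRational.add {f h : ℂ → ℂ} (hf : IsRational f) (hh : IsRational h) :
    IsRational fun z => f z + h z := by
  obtain ⟨P, Q, hQ, e⟩ := hf
  obtain ⟨P', Q', hQ', e'⟩ := hh
  refine ⟨P * Q' + P' * Q, Q * Q', mul_ne_zero hQ hQ', fun z => ?_⟩
  simp only [eval_mul, eval_add, ← e, ← e']
  ring

lemma IsRational.mul {f h : ℂ → ℂ} (hf : IsRational f) (hh : IsRational h) :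
    IsRational fun z => f z * h z := by
  obtain ⟨P, Q, hQ, e⟩ := hf
  obtain ⟨P', Q', hQ', e'⟩ := hh
  refine ⟨P * P', Q * Q', mul_ne_zero hQ hQ', fun z => ?_⟩
  simp only [eval_mul, ← e, ← e']
  ring

lemma IsRational.inv {f : ℂ → ℂ} (hf : IsRational f) : IsRational fun z => (f z)⁻¹ := by
  obtain ⟨P, Q, hQ, e⟩ := hf
  by_cases hP : P = 0
  · refine ⟨0, Q, hQ, fun z => ?_⟩
    have h := e z
    rw [hP, eval_zero, mul_eq_zero] at h
    rcases h with h | h <;> simp [h]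
  -- The denominator is P² and not P: at a zero of f the inverse is 0 by convention, and the extra
  -- factor P makes the numerator vanish there as well.
  · refine ⟨P * Q, P * P, mul_ne_zero hP hP, fun z => ?_⟩
    by_cases h : f z = 0
    · have := e z
      rw [h, mul_zero] at this
      simp [← this]
    · simp only [eval_mul, ← e]
      field_simp

lemma IsRational.sum {α : Type*} (s : Finset α) {f : α → ℂ → ℂ} (h : ∀ a, IsRational (f a)) :
    IsRational fun z => ∑ a ∈ s, f a z := by
  induction s using Finset.induction_on with
  | empty => simpa using isRational_eval 0
  | insert a s ha ih =>
    simp only [Finset.sum_insert ha]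
    exact (h a).add ih

/-- Every zero of f is a root of P. If P were zero, f would vanish off the finitely many roots of Q,
hence on a punctured neighbourhood of every point. -/
lemma IsRational.finite_zeros {f : ℂ → ℂ} (hf : IsRational f)
    (h : ∃ x, ¬ ∀ᶠ z in 𝓝[≠] x, f z = 0) : {z | f z = 0}.Finite := by
  obtain ⟨P, Q, hQ, e⟩ := hf
  obtain ⟨x, hx⟩ := h
  have hP : P ≠ 0 := by
    rintro rfl
    refine hx ?_
    have h1 : {z | Q.IsRoot z}.Finite := finite_setOfPred_isRoot hQ
    have h2 : ∀ᶠ z in 𝓝[≠] x, ¬ Q.IsRoot z := by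
      have := (h1.subset (Set.sdiff_subset (t := {x}))).isClosed.isOpen_compl.mem_nhds
        (x := x) (by simp)
      filter_upwards [nhdsWithin_le_nhds this, self_mem_nhdsWithin] with z hz hzx hr
      exact hz ⟨hr, hzx⟩
    filter_upwards [h2] with z hz
    have := e z
    rw [eval_zero, mul_eq_zero] at this
    exact this.resolve_left hz
  refine (finite_setOfPred_isRoot hP).subset fun z hz => ?_
  have := e z
  rw [show f z = 0 from hz, mul_zero] at this
  exact this.symm

/-- A function with a pole of positive order at `x` does not vanish near `x`. -/
lemma not_eventually_zero_of_pole {f h : ℂ → ℂ} {x : ℂ} {n : ℕ} {a : ℕ → ℂ} (hn : 0 < n)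
    (ha : a (n - 1) ≠ 0) (hh : ContinuousAt h x)
    (hf : ∀ z, f z = ∑ p ∈ Finset.range n, ((z - x) ^ (p + 1))⁻¹ * a p + h z) :
    ¬ ∀ᶠ z in 𝓝[≠] x, f z = 0 := by
  intro h0
  obtain ⟨m, rfl⟩ := Nat.exists_eq_add_of_le' hn
  rw [Nat.add_sub_cancel] at ha
  have h1 : ContinuousAt (fun z => ∑ p ∈ Finset.range (m + 1), (z - x) ^ (m - p) * a p
      + (z - x) ^ (m + 1) * h z) x := by
    have : Continuous fun z : ℂ => ∑ p ∈ Finset.range (m + 1), (z - x) ^ (m - p) * a p := by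
      fun_prop
    exact this.continuousAt.add (ContinuousAt.mul (by fun_prop) hh)
  have h2 : ∑ p ∈ Finset.range (m + 1), (x - x) ^ (m - p) * a p + (x - x) ^ (m + 1) * h x = a m := by
    rw [sub_self, Finset.sum_range_succ, Finset.sum_eq_zero]
    · simp
    · intro p hp
      rw [Finset.mem_range] at hp
      rw [zero_pow (by omega), zero_mul]
  have h3 : Tendsto (fun z => ∑ p ∈ Finset.range (m + 1), (z - x) ^ (m - p) * a p
      + (z - x) ^ (m + 1) * h z) (𝓝[≠] x) (𝓝 (a m)) := by
    have := h1.tendsto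
    rw [h2] at this
    exact this.mono_left nhdsWithin_le_nhds
  -- Near x the displayed function is (z - x)^{m+1} f(z), which tends to the leading coefficient; if
  -- f vanished there, this coefficient would be 0.
  refine ha (tendsto_nhds_unique h3 (tendsto_const_nhds.congr' ?_))
  filter_upwards [h0, self_mem_nhdsWithin] with z hz hzx
  have hzx' : z - x ≠ 0 := sub_ne_zero.2 hzx
  rw [show (0 : ℂ) = (z - x) ^ (m + 1) * f z by rw [hz, mul_zero], hf, mul_add, Finset.mul_sum]
  congr 1
  refine Finset.sum_congr rfl fun p hp => ?_
  rw [Finset.mem_range] at hp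
  have h4 : (z - x) ^ (m + 1) = (z - x) ^ (m - p) * (z - x) ^ (p + 1) := by
    rw [← pow_add]; congr 1; omega
  rw [h4]
  field_simp

variable (𝔇 : DihedralLie T g) (G : GaudinData T 𝔇.ω)

lemma isRational_twist : IsRational (twist 𝔇 G) := by
  have hX : IsRational fun z => z := by simpa using isRational_eval (X : ℂ[X])
  have hC : ∀ c : ℂ, IsRational fun _ => c := fun c => by simpa using isRational_eval (C c)
  have hpow : ∀ (n : ℕ) {f : ℂ → ℂ}, IsRational f → IsRational fun z => f z ^ n := by
    intro n f hf
    induction n with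
    | zero => simpa using hC 1
    | succ n ih => simpa only [pow_succ] using ih.mul hf
  have h1 : IsRational fun z => (T : ℂ)⁻¹ * ∑ k ∈ Finset.range T, ∑ x ∈ G.allPts.erase 0,
      ∑ p ∈ Finset.range (G.mult (x : OnePoint ℂ)),
        ((𝔇.ω ^ k)⁻¹ * (((𝔇.ω ^ k)⁻¹ * z + -x) ^ (p + 1))⁻¹) * G.level (x : OnePoint ℂ) p :=
    (hC _).mul (.sum _ fun k => .sum _ fun x => .sum _ fun p =>
      ((hC _).mul (hpow _ (((hC _).mul hX).add (hC _))).inv).mul (hC _))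
  have h2 : IsRational fun z => ∑ p ∈ Finset.range (G.mult ((0 : ℂ) : OnePoint ℂ)),
      (z ^ (p + 1))⁻¹ * G.level ((0 : ℂ) : OnePoint ℂ) p :=
    .sum _ fun p => (hpow _ hX).inv.mul (hC _)
  have h3 : IsRational fun z => (-1) * ∑ q ∈ Finset.range (G.mult OnePoint.infty - 1),
      z ^ q * G.level OnePoint.infty (q + 1) :=
    (hC (-1)).mul (.sum _ fun q => (hpow _ hX).mul (hC _))
  have h := (h1.add h2).add h3
  convert h using 1
  funext z
  simp only [twist, laxSum, smul_eq_mul, one_pow, Module.End.one_apply, div_eq_mul_inv,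
    sub_eq_add_neg, neg_one_mul]

lemma twist_apply (z : ℂ) : twist 𝔇 G z = (T : ℂ)⁻¹ * ∑ k ∈ Finset.range T,
      ∑ x ∈ G.allPts.erase 0, ∑ p ∈ Finset.range (G.mult (x : OnePoint ℂ)),
        ((𝔇.ω ^ k)⁻¹ / ((𝔇.ω ^ k)⁻¹ * z - x) ^ (p + 1)) * G.level (x : OnePoint ℂ) p
    + ∑ p ∈ Finset.range (G.mult ((0 : ℂ) : OnePoint ℂ)),
        (z ^ (p + 1))⁻¹ * G.level ((0 : ℂ) : OnePoint ℂ) p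
    - ∑ q ∈ Finset.range (G.mult OnePoint.infty - 1),
        z ^ q * G.level OnePoint.infty (q + 1) := by
  simp only [twist, laxSum, smul_eq_mul, one_pow, Module.End.one_apply]

/-- The orbits of different marked points are disjoint, and a conjugate of a complex marked point
is not in the rotation orbit of a marked point. -/
lemma eq_of_rot_eq {x y : ℂ} (hx : x ∈ G.pts) (hx0 : x ≠ 0) (hy : y ∈ G.allPts) {k : ℕ}
    (hk : k < T) (h : (𝔇.ω ^ k)⁻¹ * x = y) : k = 0 ∧ y = x := by
  have hω := 𝔇.ω_ne_zero
  have hr : x = 𝔇.zeta (k : ZMod T) * y := by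
    rw [← h, DihedralLie.zeta, ZMod.val_natCast, Nat.mod_eq_of_lt hk, ← mul_assoc,
      mul_inv_cancel₀ (pow_ne_zero _ hω), one_mul]
  rcases Finset.mem_union.1 hy with hy | hy
  · have hyx : y = x := G.orbits y hy x hx (.r k) (by rw [hr]; rfl)
    refine ⟨?_, hyx⟩
    by_contra hk0
    rw [hyx, inv_mul_eq_iff_eq_mul₀ (pow_ne_zero _ hω), eq_comm, mul_eq_right₀ hx0] at h
    exact 𝔇.ω_prim.pow_ne_one_of_pos_of_lt hk0 hk h
  · exfalso
    obtain ⟨w, hw, rfl⟩ := Finset.mem_image.1 hy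
    obtain ⟨hw, hc⟩ := Finset.mem_filter.1 hw
    -- If conj w lies in the rotation orbit of x, a reflection maps w to x. Disjointness of orbits
    -- gives w = x, so a reflection fixes w, which is impossible for a complex point.
    have hm : mobius 𝔇.ω (.sr (-k : ZMod T)) (w : OnePoint ℂ) = x := by
      rw [hr]
      simp only [mobius, OnePoint.map_some, pow_val_neg 𝔇.ω_prim.pow_eq_one, map_mul,
        Complex.conj_conj]
      rfl
    have hwx : w = x := G.orbits w hw x hx _ hm
    rw [← hwx] at hm
    have := hc _ hm
    rw [DihedralGroup.one_def] at this
    cases this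

lemma continuousAt_infty_part (x : ℂ) : ContinuousAt (fun z =>
    ∑ q ∈ Finset.range (G.mult OnePoint.infty - 1), z ^ q * G.level OnePoint.infty (q + 1)) x := by
  fun_prop

lemma continuousAt_term {x y : ℂ} {k : ℕ} (h : (𝔇.ω ^ k)⁻¹ * x ≠ y) : ContinuousAt (fun z =>
    ∑ p ∈ Finset.range (G.mult (y : OnePoint ℂ)),
      ((𝔇.ω ^ k)⁻¹ / ((𝔇.ω ^ k)⁻¹ * z - y) ^ (p + 1)) * G.level (y : OnePoint ℂ) p) x := by
  refine tendsto_finsetSum _ fun p _ => ?_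
  refine ContinuousAt.mul (ContinuousAt.div (by fun_prop) (by fun_prop) ?_) (by fun_prop)
  exact pow_ne_zero _ (sub_ne_zero.2 h)

/-- At x ≠ 0 only the summand with trivial rotation and y = x is singular, by `eq_of_rot_eq`, and
its top coefficient is the top level divided by T. At 0 only the separate sum over the powers
z^{-p-1} is singular, with the levels themselves as coefficients. -/
lemma twist_pole {x : ℂ} (hx : x ∈ G.pts) : ¬ ∀ᶠ z in 𝓝[≠] x, twist 𝔇 G z = 0 := by
  have hω := 𝔇.ω_ne_zero
  have hT : (T : ℂ) ≠ 0 := Nat.cast_ne_zero.2 (NeZero.ne T)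
  have hn : 0 < G.mult (x : OnePoint ℂ) :=
    (G.mult_pos _).2 (Or.inr ⟨x, hx, 1, (mobius_one _).symm⟩)
  by_cases hx0 : x = 0
  · subst hx0
    refine not_eventually_zero_of_pole (h := fun z => (T : ℂ)⁻¹ * ∑ k ∈ Finset.range T,
      ∑ x ∈ G.allPts.erase 0, ∑ p ∈ Finset.range (G.mult (x : OnePoint ℂ)),
        ((𝔇.ω ^ k)⁻¹ / ((𝔇.ω ^ k)⁻¹ * z - x) ^ (p + 1)) * G.level (x : OnePoint ℂ) p
      - ∑ q ∈ Finset.range (G.mult OnePoint.infty - 1), z ^ q * G.level OnePoint.infty (q + 1))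
      hn (G.level_top 0 hx) ?_ fun z => ?_
    · refine ContinuousAt.sub (ContinuousAt.mul (by fun_prop) ?_) (continuousAt_infty_part 𝔇 G 0)
      refine tendsto_finsetSum _ fun k _ => tendsto_finsetSum _ fun y hy => ?_
      refine continuousAt_term 𝔇 G ?_
      rw [mul_zero]
      exact (Finset.ne_of_mem_erase hy).symm
    · simp only [twist_apply, sub_zero]
      ring
  · refine not_eventually_zero_of_pole (a := fun p => (T : ℂ)⁻¹ * G.level (x : OnePoint ℂ) p)
      (h := fun z => (T : ℂ)⁻¹ * ∑ k ∈ Finset.range T, ∑ y ∈ G.allPts.erase 0,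
        (if k = 0 ∧ y = x then 0 else ∑ p ∈ Finset.range (G.mult (y : OnePoint ℂ)),
          ((𝔇.ω ^ k)⁻¹ / ((𝔇.ω ^ k)⁻¹ * z - y) ^ (p + 1)) * G.level (y : OnePoint ℂ) p)
      + ∑ p ∈ Finset.range (G.mult ((0 : ℂ) : OnePoint ℂ)),
        (z ^ (p + 1))⁻¹ * G.level ((0 : ℂ) : OnePoint ℂ) p
      - ∑ q ∈ Finset.range (G.mult OnePoint.infty - 1), z ^ q * G.level OnePoint.infty (q + 1))
      hn (mul_ne_zero (inv_ne_zero hT) (G.level_top x hx)) ?_ fun z => ?_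
    · refine ContinuousAt.sub (ContinuousAt.add (ContinuousAt.mul (by fun_prop) ?_) ?_)
        (continuousAt_infty_part 𝔇 G x)
      · refine tendsto_finsetSum _ fun k hk => tendsto_finsetSum _ fun y hy => ?_
        split_ifs with h
        · exact tendsto_const_nhds
        · exact continuousAt_term 𝔇 G fun he => h (eq_of_rot_eq 𝔇 G hx hx0
            (Finset.mem_of_mem_erase hy) (Finset.mem_range.1 hk) he)
      · refine tendsto_finsetSum _ fun p _ => ?_
        exact ContinuousAt.mul (ContinuousAt.inv₀ (by fun_prop) (pow_ne_zero _ hx0)) (by fun_prop)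
    · have hsplit : ∀ F : ℕ → ℂ → ℂ, ∑ k ∈ Finset.range T, ∑ y ∈ G.allPts.erase 0, F k y
          = F 0 x + ∑ k ∈ Finset.range T, ∑ y ∈ G.allPts.erase 0,
            (if k = 0 ∧ y = x then 0 else F k y) := by
        intro F
        have h1 : F 0 x = ∑ k ∈ Finset.range T, ∑ y ∈ G.allPts.erase 0,
            (if k = 0 ∧ y = x then F k y else 0) := by
          rw [Finset.sum_eq_single 0, Finset.sum_eq_single x]
          · simp
          · intro y _ hy; simp [hy]
          · intro h
            exact absurd (Finset.mem_erase.2 ⟨hx0, Finset.mem_union_left _ hx⟩) h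
          · intro k _ hk; simp [hk]
          · intro h
            exact absurd (Finset.mem_range.2 (Nat.pos_of_ne_zero (NeZero.ne T))) h
        rw [h1, ← Finset.sum_add_distrib]
        refine Finset.sum_congr rfl fun k _ => ?_
        rw [← Finset.sum_add_distrib]
        refine Finset.sum_congr rfl fun y _ => ?_
        split_ifs <;> simp
      rw [twist_apply, hsplit fun k y => ∑ p ∈ Finset.range (G.mult (y : OnePoint ℂ)),
          ((𝔇.ω ^ k)⁻¹ / ((𝔇.ω ^ k)⁻¹ * z - y) ^ (p + 1)) * G.level (y : OnePoint ℂ) p]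
      have h2 : (T : ℂ)⁻¹ * ∑ p ∈ Finset.range (G.mult (x : OnePoint ℂ)),
          ((𝔇.ω ^ 0)⁻¹ / ((𝔇.ω ^ 0)⁻¹ * z - x) ^ (p + 1)) * G.level (x : OnePoint ℂ) p
          = ∑ p ∈ Finset.range (G.mult (x : OnePoint ℂ)),
            ((z - x) ^ (p + 1))⁻¹ * ((T : ℂ)⁻¹ * G.level (x : OnePoint ℂ) p) := by
        rw [Finset.mul_sum]
        refine Finset.sum_congr rfl fun p _ => ?_
        rw [pow_zero, inv_one, one_mul, one_div]
        ring
      rw [mul_add, h2]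
      ring

/-- Without finite marked points φ is a polynomial, non-zero because of the top level at infinity;
otherwise it is rational with a true pole. All zeros in ℂ are covered, even those arising from the
convention for division by zero at a pole. -/
lemma finite_zeros_twist : {z : ℂ | twist 𝔇 G z = 0}.Finite := by
  rcases G.pts.eq_empty_or_nonempty with h | ⟨x, hx⟩
  · have h2 : 2 ≤ G.mult OnePoint.infty :=
      G.degree_ge.resolve_right (by rw [h]; exact Finset.not_nonempty_empty)
    have hall : G.allPts = ∅ := by
      simp [GaudinData.allPts, GaudinData.zc, h]
    have h0 : G.mult ((0 : ℂ) : OnePoint ℂ) = 0 := by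
      by_contra hc
      have := mult_zero_pos 𝔇 G (Nat.pos_of_ne_zero hc)
      rw [h] at this
      exact absurd this (Finset.notMem_empty _)
    have hP : ∀ z, twist 𝔇 G z = (-∑ q ∈ Finset.range (G.mult OnePoint.infty - 1),
        C (G.level OnePoint.infty (q + 1)) * X ^ q).eval z := by
      intro z
      rw [twist_apply, hall, h0]
      simp only [Finset.erase_empty, Finset.sum_empty, Finset.sum_const_zero, mul_zero,
        Finset.range_zero, zero_add, zero_sub, eval_neg, eval_finsetSum, eval_mul, eval_C,
        eval_pow, eval_X]
      exact congrArg Neg.neg (Finset.sum_congr rfl fun q _ => mul_comm _ _)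
    simp only [hP]
    refine finite_setOfPred_isRoot fun hz => G.level_top_infty h2 ?_
    -- The levels at infinity start at index 1, so the top one, of index n_∞ - 1, is up to sign the
    -- coefficient of z^{n_∞ - 2}.
    have hc := congrArg (fun P => P.coeff (G.mult OnePoint.infty - 2)) hz
    simp only [coeff_neg, finsetSum_coeff, coeff_C_mul, coeff_X_pow, coeff_zero, neg_eq_zero] at hc
    rw [Finset.sum_eq_single (G.mult OnePoint.infty - 2)] at hc
    · simpa [show G.mult OnePoint.infty - 2 + 1 = G.mult OnePoint.infty - 1 by omega] using hc
    · intro q _ hq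
      rw [if_neg hq.symm, mul_zero]
    · intro hq
      exact absurd (Finset.mem_range.2 (by omega)) hq
  · exact (isRational_twist 𝔇 G).finite_zeros ⟨x, twist_pole 𝔇 G hx⟩

end Rational

/-! ### The level-fixing map on the formal Lax matrix -/

section Level

variable (𝔇 : DihedralLie T g) (G : GaudinData T 𝔇.ω)
  {ι : Type*} [Fintype ι] [DecidableEq ι] (b : Module.Basis ι ℂ g)

lemma piD_single (y : OnePoint ℂ) (r : ℕ) (x : OnePoint ℂ) (p : ℕ) {X : Aff g}
    (hX : X.coefD = 0) : piD 𝔇 G b y r (single 𝔇 G x p X) = 0 := by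
  have h : coefDAt 𝔇 G y r (single 𝔇 G x p X) = 0 := by
    change ((single 𝔇 G x p X).1 y r).coefD = 0
    rw [single_apply]
    split_ifs
    · exact coefD_slotAverage 𝔇 x p hX
    · rfl
  unfold piD
  split_ifs <;>
    simp only [LinearMap.add_apply, LinearMap.comp_apply, h, map_zero, add_zero]

/-- Averaging creates no D-component, so the quadratic part of the level-fixing map does not
contribute. -/
lemma piLevel_symb (x : OnePoint ℂ) (p : ℕ) {X : Aff g} (hX : X.coefD = 0) :
    piLevel 𝔇 G b (symb 𝔇 G x p X) = toHat 𝔇 G (obs 𝔇 G x p X) := by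
  have h : LinearMap.liftBaseChange ℂ (∑ y ∈ G.markedPts, ∑ r ∈ G.exps y, piD 𝔇 G b y r)
      (symb 𝔇 G x p X) = 0 := by
    rw [symb_eq, map_sub, LinearMap.liftBaseChange_tmul, LinearMap.liftBaseChange_tmul]
    simp only [LinearMap.sum_apply, piD_single 𝔇 G b _ _ _ _ hX,
      piD_single 𝔇 G b _ _ _ _ (coefD_I_smul hX), Finset.sum_const_zero, smul_zero, sub_zero]
  rw [piLevel, LinearMap.add_apply, h, add_zero]
  rfl

/-- The action of `σ` on series of connections. -/
def connSeriesσ (V : Type*) [AddCommGroup V] [Module ℂ V] : Module.End ℂ (ConnSeries g V) :=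
  LinearMap.prodMap (seriesσ 𝔇) LinearMap.id

lemma rhoTensor_affSeriesσ {V W : Type*} [AddCommGroup V] [Module ℂ V] [AddCommGroup W]
    [Module ℂ W] (π : V →ₗ[ℂ] W) (v : AffSeries g V) :
    rhoTensor π (affSeriesσ 𝔇 v) = connSeriesσ 𝔇 W (rhoTensor π v) := by
  refine Prod.ext (funext fun m => ?_) rfl
  change (π.lTensor g) ((𝔇.σ.rTensor V) (v.1 m)) = (𝔇.σ.rTensor W) ((π.lTensor g) (v.1 m))
  rw [← LinearMap.comp_apply, ← LinearMap.comp_apply, LinearMap.lTensor_comp_rTensor,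
    LinearMap.rTensor_comp_lTensor]

/-- The component K ⊗ D^{(x)}_p is killed by ϱ, and D ⊗ K^{(x)}_p gives -i · i ℓ = ℓ. At a conjugate
point the sign of τ D = -D compensates ε_x = -1. -/
lemma rhoTensor_formalField (hb : ∀ a, 𝔇.τ (b a) = b a) {x : OnePoint ℂ} (hx : G.AllMarked x)
    {p : ℕ} (hp : p ∈ G.exps x) : rhoTensor (piLevel 𝔇 G b) (formalField 𝔇 G b x p)
      = ((fun m => (toHat 𝔇 G).toLinearMap.lTensor g (classicalField 𝔇 G b x p m),
        G.level x p • 1) : ConnSeries g (LevelHat 𝔇 G)) := by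
  have hK : piLevel 𝔇 G b (symb 𝔇 G x p Aff.K) = (G.sign x * Complex.I * G.level x p) • 1 := by
    rw [piLevel_symb 𝔇 G b x p rfl, obs_K 𝔇 G hx hp, AlgHom.commutes,
      Algebra.algebraMap_eq_smul_one]
  have hL : ∀ (n : ℤ) (y : g), piLevel 𝔇 G b (symb 𝔇 G x p (Aff.loop n y))
      = toHat 𝔇 G (obs 𝔇 G x p (Aff.loop n y)) := fun n y => piLevel_symb 𝔇 G b x p rfl
  unfold formalField
  split_ifs with hm
  · refine Prod.ext (funext fun m => ?_) ?_
    · change (piLevel 𝔇 G b).lTensor g (∑ a, _) = (toHat 𝔇 G).toLinearMap.lTensor g (∑ a, _)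
      simp only [map_sum, LinearMap.lTensor_tmul, hL, if_pos hm]
      rfl
    · change (-Complex.I) • piLevel 𝔇 G b (symb 𝔇 G x p Aff.K) = _
      rw [hK, smul_smul, GaudinData.sign, if_pos hm]
      congr 1
      linear_combination (-G.level x p) * Complex.I_mul_I
  · refine Prod.ext (funext fun m => ?_) ?_
    · change (piLevel 𝔇 G b).lTensor g (∑ a, _) = (toHat 𝔇 G).toLinearMap.lTensor g (∑ a, _)
      simp only [map_sum, LinearMap.lTensor_tmul, hL, if_neg hm, τ_dualB 𝔇 b hb]
      rfl
    · change (-Complex.I) • piLevel 𝔇 G b (-symb 𝔇 G x p Aff.K) = _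
      rw [map_neg, hK, smul_neg, smul_smul, ← neg_smul, GaudinData.sign, if_neg hm]
      congr 1
      linear_combination (-G.level x p) * Complex.I_mul_I

lemma laxSum_prod {M N : Type*} [AddCommGroup M] [Module ℂ M] [AddCommGroup N] [Module ℂ N]
    (s : Module.End ℂ M) (s' : Module.End ℂ N) (F : OnePoint ℂ → ℕ → M) (F' : OnePoint ℂ → ℕ → N)
    (z : ℂ) : laxSum 𝔇 G (LinearMap.prodMap s s') (fun x p => (F x p, F' x p)) z
      = (laxSum 𝔇 G s F z, laxSum 𝔇 G s' F' z) := by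
  have h1 := map_laxSum 𝔇 G (LinearMap.fst ℂ M N) (s := LinearMap.prodMap s s') (s' := s)
    (fun _ => rfl) (fun x p => (F x p, F' x p)) z
  have h2 := map_laxSum 𝔇 G (LinearMap.snd ℂ M N) (s := LinearMap.prodMap s s') (s' := s')
    (fun _ => rfl) (fun x p => (F x p, F' x p)) z
  simp only [LinearMap.fst_apply, LinearMap.snd_apply] at h1 h2
  exact Prod.ext h1 h2

lemma lTensor_laxSum {V W : Type*} [AddCommGroup V] [Module ℂ V] [AddCommGroup W] [Module ℂ W]
    (f : V →ₗ[ℂ] W) (F : OnePoint ℂ → ℕ → ℤ → g ⊗[ℂ] V) (z : ℂ) :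
    laxSum 𝔇 G (seriesσ 𝔇) (fun x p m => f.lTensor g (F x p m)) z
      = fun m => f.lTensor g (laxSum 𝔇 G (seriesσ 𝔇) F z m) := by
  refine (map_laxSum 𝔇 G ((f.lTensor g).compLeft ℤ) (s := seriesσ 𝔇)
    (fun v => funext fun m => ?_) F z).symm
  change (f.lTensor g) ((𝔇.σ.rTensor V) (v m)) = (𝔇.σ.rTensor W) ((f.lTensor g) (v m))
  rw [← LinearMap.comp_apply, ← LinearMap.comp_apply, LinearMap.lTensor_comp_rTensor,
    LinearMap.rTensor_comp_lTensor]

lemma laxSum_level_smul {V : Type*} [AddCommGroup V] [Module ℂ V] (v : V) (z : ℂ) :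
    laxSum 𝔇 G LinearMap.id (fun x p => G.level x p • v) z = twist 𝔇 G z • v :=
  (map_laxSum 𝔇 G (LinearMap.toSpanSingleton ℂ V v) (s := 1) (fun _ => rfl) G.level z).symm

theorem rhoTensor_formalLax (hb : ∀ a, 𝔇.τ (b a) = b a) {z : ℂ} (hφ : twist 𝔇 G z ≠ 0) :
    rhoTensor (piLevel 𝔇 G b) (formalLax 𝔇 G b z) = twist 𝔇 G z • laxConn 𝔇 G b z := by
  rw [formalLax, map_laxSum 𝔇 G (rhoTensor (piLevel 𝔇 G b)) (rhoTensor_affSeriesσ 𝔇 _),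
    laxSum_congr 𝔇 G _ fun x p hx hp => rhoTensor_formalField 𝔇 G b hb hx hp, connSeriesσ,
    laxSum_prod, lTensor_laxSum, laxSum_level_smul, laxConn, Prod.smul_mk]
  congr 1
  funext m
  rw [Pi.smul_apply, lax, Pi.smul_apply, map_smul, smul_smul, mul_inv_cancel₀ hφ, one_smul]

end Level

/-! ### The two forms of the bracket -/

section Forms

variable {V : Type*} [AddCommGroup V] [Module ℂ V]

lemma comm₁_add (X Y : g ⊗[ℂ] g) (A : ℤ → g ⊗[ℂ] V) :
    comm₁ (X + Y) A = comm₁ X A + comm₁ Y A := by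
  funext m
  simp only [comm₁, map_add, LinearMap.rTensor_add, LinearMap.add_apply, Pi.add_apply]

lemma comm₂_sub (X Y : g ⊗[ℂ] g) (A : ℤ → g ⊗[ℂ] V) :
    comm₂ (X - Y) A = comm₂ X A - comm₂ Y A := by
  funext m
  simp only [comm₂, map_sub, LinearMap.rTensor_sub, LinearMap.sub_apply, Pi.sub_apply]

variable (𝔇 : DihedralLie T g) (G : GaudinData T 𝔇.ω)
  {ι : Type*} [Fintype ι] [DecidableEq ι] (b : Module.Basis ι ℂ g)

lemma rmat_add_smat (z z' : ℂ) : rmat 𝔇 G b z z' + smat 𝔇 G b z z' = Rmat 𝔇 G b z z' := by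
  unfold rmat smat
  module

lemma smat_sub_rmat (z z' : ℂ) : smat 𝔇 G b z z' - rmat 𝔇 G b z z' = Rswap 𝔇 G b z' z := by
  unfold rmat smat
  module

lemma two_smul_smat (z z' : ℂ) :
    (2 : ℂ) • smat 𝔇 G b z z' = Rmat 𝔇 G b z z' + Rswap 𝔇 G b z' z := by
  unfold smat
  module

/-- Substitution of R_{12} = r + s and R_{21} = s - r; the identity holds for arbitrary fields A and
B. -/
lemma rs_form (A B : ℤ → g ⊗[ℂ] V) (v : V) (z z' : ℂ) :
    distMul₁ (comm₁ (Rmat 𝔇 G b z z') A) dirac - distMul₂ (comm₂ (Rswap 𝔇 G b z' z) B) dirac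
        - distConst ((Rmat 𝔇 G b z z' + Rswap 𝔇 G b z' z) ⊗ₜ[ℂ] v) diracDeriv
      = distMul₁ (comm₁ (rmat 𝔇 G b z z') A) dirac + distMul₂ (comm₂ (rmat 𝔇 G b z z') B) dirac
        + distMul₁ (comm₁ (smat 𝔇 G b z z') A) dirac - distMul₂ (comm₂ (smat 𝔇 G b z z') B) dirac
        - (2 : ℂ) • distConst (smat 𝔇 G b z z' ⊗ₜ[ℂ] v) diracDeriv := by
  rw [← two_smul_smat, ← smat_sub_rmat, ← rmat_add_smat, comm₁_add, comm₂_sub]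
  funext m n
  simp only [Pi.sub_apply, Pi.add_apply, Pi.smul_apply, distMul₁_dirac, distMul₂_dirac,
    distConst, ← TensorProduct.smul_tmul', smul_comm (2 : ℂ)]
  abel

end Forms

end AffineGaudin

end

theorem mainTheorem3 {T : ℕ} [NeZero T] {g : Type*} [LieRing g] [LieAlgebra ℂ g]
    [FiniteDimensional ℂ g] (𝔇 : AffineGaudin.DihedralLie T g)
    (G : AffineGaudin.GaudinData T 𝔇.ω)
    {ι : Type*} [Fintype ι] [DecidableEq ι] (b : Module.Basis ι ℂ g)
    (hb : ∀ a, 𝔇.τ (b a) = b a) :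
    {z : ℂ | ¬ G.IsPole z ∧ AffineGaudin.twist 𝔇 G z = 0}.Finite ∧
    (∀ z : ℂ, ¬ G.IsPole z → AffineGaudin.twist 𝔇 G z ≠ 0 →
      AffineGaudin.rhoTensor (AffineGaudin.piLevel 𝔇 G b) (AffineGaudin.formalLax 𝔇 G b z)
        = AffineGaudin.twist 𝔇 G z • AffineGaudin.laxConn 𝔇 G b z) ∧
    (∀ z z' : ℂ, ¬ G.IsPole z → ¬ G.IsPole z' → AffineGaudin.twist 𝔇 G z ≠ 0 →
      AffineGaudin.twist 𝔇 G z' ≠ 0 → z ^ T ≠ z' ^ T →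
      AffineGaudin.fieldBracket (AffineGaudin.levelBracket 𝔇 G)
          (AffineGaudin.lax 𝔇 G b z) (AffineGaudin.lax 𝔇 G b z')
        = AffineGaudin.distMul₁
              (AffineGaudin.comm₁ (AffineGaudin.Rmat 𝔇 G b z z') (AffineGaudin.lax 𝔇 G b z))
              AffineGaudin.dirac
          - AffineGaudin.distMul₂
              (AffineGaudin.comm₂ (AffineGaudin.Rswap 𝔇 G b z' z) (AffineGaudin.lax 𝔇 G b z'))
              AffineGaudin.dirac
          - AffineGaudin.distConst
              ((AffineGaudin.Rmat 𝔇 G b z z' + AffineGaudin.Rswap 𝔇 G b z' z) ⊗ₜ[ℂ] 1)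
              AffineGaudin.diracDeriv ∧
      AffineGaudin.fieldBracket (AffineGaudin.levelBracket 𝔇 G)
          (AffineGaudin.lax 𝔇 G b z) (AffineGaudin.lax 𝔇 G b z')
        = AffineGaudin.distMul₁
              (AffineGaudin.comm₁ (AffineGaudin.rmat 𝔇 G b z z') (AffineGaudin.lax 𝔇 G b z))
              AffineGaudin.dirac
          + AffineGaudin.distMul₂
              (AffineGaudin.comm₂ (AffineGaudin.rmat 𝔇 G b z z') (AffineGaudin.lax 𝔇 G b z'))
              AffineGaudin.dirac
          + AffineGaudin.distMul₁
              (AffineGaudin.comm₁ (AffineGaudin.smat 𝔇 G b z z') (AffineGaudin.lax 𝔇 G b z))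
              AffineGaudin.dirac
          - AffineGaudin.distMul₂
              (AffineGaudin.comm₂ (AffineGaudin.smat 𝔇 G b z z') (AffineGaudin.lax 𝔇 G b z'))
              AffineGaudin.dirac
          - (2 : ℂ) • AffineGaudin.distConst
              (AffineGaudin.smat 𝔇 G b z z' ⊗ₜ[ℂ] 1) AffineGaudin.diracDeriv) := by
  refine ⟨(AffineGaudin.finite_zeros_twist 𝔇 G).subset fun z hz => hz.2,
    fun z _ hφ => AffineGaudin.rhoTensor_formalLax 𝔇 G b hb hφ, fun z z' hz hz' hφ hφ' hzz' => ?_⟩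
  have h := AffineGaudin.fieldBracket_lax 𝔇 G b hb hz hz' hφ hφ' hzz'
  exact ⟨h, h.trans (AffineGaudin.rs_form 𝔇 G b _ _ _ _ _)⟩
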